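/- **Setting.** Clusters are i.i.d. copies $\mathbf O_1,\mathbf O_2,\dots$ of $\mathbf O=(\mathbf Y,\mathbf A,\mathbf X,N)\sim\mathbb P$, where $N$ is the cluster size, $\mathbf Y\in\mathbb R^N$ the outcomes, $\mathbf A\in\mathcal A(N)=\{0,1\}^N$ the treatments and $\mathbf X\in(\mathbb R^p)^N$ the covariates. Assume $N\le n_{\max}$ almost surely for some $n_{\max}$, and, for some $C_Y<\infty$, $|\mathbb E(Y_j^q\mid\mathbf A,\mathbf X,N)|\le C_Y$ almost surely for all units $j$ and all $q\le 4$. Let $G(\mathbf a,\mathbf x,n)=\mathbb E(\mathbf Y\mid\mathbf A=\mathbf a,\mathbf X=\mathbf x,N=n)$ and $H(\mathbf a,\mathbf x,n)=\mathbb P(\mathbf A=\mathbf a\mid\mathbf X=\mathbf x,N=n)$. Let $w(\mathbf a,\mathbf x,n)\in\mathbb R^n$ be a weight function, which may depend on $\mathbb P$, and let $\phi(\mathbf a',\mathbf x,n;\mathbf a)\in\mathbb R^n$ be such that the efficient influence function of $w(\mathbf a,\mathbf x,n)$ in the nonparametric model is $\{\mathbb 1(\mathbf X=\mathbf x,N=n)/d\mathbb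 P(\mathbf x,n)\}\,\phi(\mathbf A,\mathbf X,N;\mathbf a)$. (For general covariates this is understood after integration in $(\mathbf x,n)$: for every bounded measurable $g$, every choice of $\mathbf t(n)\in\mathcal A(n)$ for each $n$, and every coordinate $j$, the efficient influence function at $\mathbb P$ of $\mathbb Q\mapsto\int g(\mathbf x,n)\,w_{\mathbb Q}(\mathbf t(n),\mathbf x,n)_j\,d\mathbb P(\mathbf x,n)$ is $g(\mathbf X,N)\,\phi(\mathbf A,\mathbf X,N;\mathbf t(N))_j$.) Put $\boldsymbol\eta=(G,H,w,\phi)$, $$\Psi(w)=\mathbb E\Big\{\sum_{\mathbf a\in\mathcal A(N)}w(\mathbf a,\mathbf X,N)^\top G(\mathbf a,\mathbf X,N)\Big\},$$ $$\varphi(\mathbf O;\boldsymbol\eta)=\sum_{\mathbf a\in\mathcal A(N)}\{w(\mathbf a,\mathbf X,N)+\phi(\mathbf A,\mathbf X,N;\mathbf a)\}^\top G(\mathbf a,\mathbf X,N)+\frac{w(\mathbf A,\mathbf X,N)^\top\{\mathbf Y-G(\mathbf A,\mathbf X,N)\}}{H(\mathbf A,\mathbf X,N)},$$ and $\sigma^2(w)=\mathbb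 E[\{\varphi(\mathbf O;\boldsymbol\eta)-\Psi(w)\}^2]$. **Estimators.** The first $m$ clusters are partitioned at random, independently of the data, into a fixed number $K$ of groups of sizes $m_1,\dots,m_K$ with $m_k/m\to 1/K$ in probability as $m\to\infty$. For each $k$, $\widehat{\boldsymbol\eta}^{(-k)}=(\widehat G^{(-k)},\widehat H^{(-k)},\widehat w^{(-k)},\widehat\phi^{(-k)})$ is an estimator of $\boldsymbol\eta$ trained on the clusters outside group $k$ (possibly with additional randomness independent of the data). With $\mathbb P_m^k f=m_k^{-1}\sum_{i\text{ in group }k}f(\mathbf O_i)$, let $$\widehat\Psi(w)=\frac1K\sum_{k=1}^K\mathbb P_m^k\{\varphi(\cdot;\widehat{\boldsymbol\eta}^{(-k)})\},\qquad \widehat\sigma^2(w)=\frac1K\sum_{k=1}^K\mathbb P_m^k\big[\{\varphi(\cdot;\widehat{\boldsymbol\eta}^{(-k)})-\widehat\Psi(w)\}^2\big].$$ **Assumptions.** Let $\|f\|_{L_2(\mathbb P)}=\{\int f(\mathbf o)^2d\mathbb P(\mathbf o)\}^{1/2}$, estimated functions being treated as fixed. There are $c\in(0,1)$, $C\in(0,\infty)$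 and positive sequences $r_G,r_H,r_\phi,r_w$ (indexed by $m$) such that for every $k$, and (in (B1)–(B4)) for all $\mathbf a,\mathbf a'\in\mathcal A(n)$ and almost all values $(\mathbf x,n)$ of $(\mathbf X,N)$, almost surely: * (B1) $H(\mathbf a,\mathbf x,n)$ and $\widehat H^{(-k)}(\mathbf a,\mathbf x,n)$ lie in $(c,1-c)$; * (B2) $\|G(\mathbf a,\mathbf x,n)\|_2\le C$ and $\|\widehat G^{(-k)}(\mathbf a,\mathbf x,n)\|_2\le C$; * (B3) $\|\phi(\mathbf a',\mathbf x,n;\mathbf a)\|_2\le C$ and $\|\widehat\phi^{(-k)}(\mathbf a',\mathbf x,n;\mathbf a)\|_2\le C$; * (B4) $\|w(\mathbf a,\mathbf x,n)\|_2\le C$ and $\|\widehat w^{(-k)}(\mathbf a,\mathbf x,n)\|_2\le C$; * (B5) $\big\|\sum_{\mathbf a\in\mathcal A(N)}|(\widehat H^{(-k)}-H)(\mathbf a,\mathbf X,N)|\big\|_{L_2(\mathbb P)}=O_{\mathbb P}(r_H)$; * (B6) $\big\|\sum_{\mathbf a\in\mathcal A(N)}\|(\widehat G^{(-k)}-G)(\mathbf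 a,\mathbf X,N)\|_2\big\|_{L_2(\mathbb P)}=O_{\mathbb P}(r_G)$; * (B7) $\big\|\sum_{\mathbf a\in\mathcal A(N)}\|(\widehat\phi^{(-k)}-\phi)(\mathbf A,\mathbf X,N;\mathbf a)\|_2\big\|_{L_2(\mathbb P)}=O_{\mathbb P}(r_\phi)$; * (B8) $\big\|\sum_{\mathbf a\in\mathcal A(N)}\big\|(\widehat w^{(-k)}-w)(\mathbf a,\mathbf X,N)+\sum_{\mathbf a'\in\mathcal A(N)}\widehat\phi^{(-k)}(\mathbf a',\mathbf X,N;\mathbf a)H(\mathbf a',\mathbf X,N)\big\|_2\big\|_{L_2(\mathbb P)}=O_{\mathbb P}(r_w^2)$. **Theorem.** If $r_w,r_G,r_H,r_\phi$ are all $o(1)$ as $m\to\infty$, then $\widehat\sigma^2(w)\to\sigma^2(w)$ in probability. If moreover $r_w=o(m^{-1/4})$, $r_G(r_H+r_\phi)=o(m^{-1/2})$ and $\sigma^2(w)>0$, then $$\sqrt m\,\{\widehat\Psi(w)-\Psi(w)\}/\widehat\sigma(w)\ \overset{d}{\to}\ N(0,1).$$ -/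

import Mathlib

open MeasureTheory ProbabilityTheory Filter Asymptotics
open scoped Topology

noncomputable section

namespace ClusterPolicy

/-! ### Clustered data -/

/-- Length-`n` real vectors with the Euclidean norm (outcomes and weights of a cluster). -/
abbrev Vec (n : ℕ) := EuclideanSpace ℝ (Fin n)

/-- `𝒜(n)`: binary treatment vectors of length `n`. -/
abbrev Trt (n : ℕ) := Fin n → Bool

/-- Covariates of a cluster of size `n`: one vector in `ℝ^p` for each unit. -/
abbrev Cov (p n : ℕ) := Fin n → EuclideanSpace ℝ (Fin p)

/-- The observation `(Y, A, X, N)` made on a cluster, of variable size `N`. -/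
abbrev Cluster (p : ℕ) := Σ n : ℕ, Vec n × Trt n × Cov p n

variable {p : ℕ}

/-- Cluster size `N`. -/
abbrev size (o : Cluster p) : ℕ := o.1

/-- Outcome vector `Y`. -/
abbrev outcome (o : Cluster p) : Vec (size o) := o.2.1

/-- Treatment vector `A`. -/
abbrev treat (o : Cluster p) : Trt (size o) := o.2.2.1

/-- Covariates `X`. -/
abbrev covar (o : Cluster p) : Cov p (size o) := o.2.2.2

/-- The triple `(A, X, N)`. -/
def toAXN (o : Cluster p) : Σ n : ℕ, Trt n × Cov p n := ⟨size o, treat o, covar o⟩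

/-- The pair `(X, N)`. -/
def toXN (o : Cluster p) : Σ n : ℕ, Cov p n := ⟨size o, covar o⟩

/-- A map out of a disjoint union is measurable when it is measurable on each piece. -/
theorem measurable_sigma_of {ι γ : Type*} {β : ι → Type*} [∀ i, MeasurableSpace (β i)]
    [MeasurableSpace γ] {f : (Σ i, β i) → γ} (hf : ∀ i, Measurable fun b : β i => f ⟨i, b⟩) :
    Measurable f := by
  intro s hs
  refine MeasurableSpace.measurableSet_iInf.2 fun i => ?_
  exact hf i hs

theorem measurable_sigma_mk {ι : Type*} {β : ι → Type*} [∀ i, MeasurableSpace (β i)] (i : ι) :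
    Measurable (Sigma.mk i : β i → Σ i, β i) := by
  intro s hs
  exact MeasurableSpace.measurableSet_iInf.1 hs i

theorem measurable_toAXN : Measurable (toAXN (p := p)) :=
  measurable_sigma_of fun n =>
    (measurable_sigma_mk (β := fun n => Trt n × Cov p n) n).comp measurable_snd

theorem measurable_toXN : Measurable (toXN (p := p)) :=
  measurable_sigma_of fun n =>
    (measurable_sigma_mk (β := fun n => Cov p n) n).comp (measurable_snd.comp measurable_snd)

/-- The σ-algebra generated by `(A, X, N)`. -/
abbrev sigmaAXN (p : ℕ) : MeasurableSpace (Cluster p) := MeasurableSpace.comap toAXN inferInstance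

/-- The σ-algebra generated by `(X, N)`. -/
abbrev sigmaXN (p : ℕ) : MeasurableSpace (Cluster p) := MeasurableSpace.comap toXN inferInstance

/-- The `j`-th coordinate of a vector of variable length, `0` beyond its length. It lets a statement
about every unit of a cluster of random size be one about real random variables. -/
def coord {n : ℕ} (v : Vec n) (j : ℕ) : ℝ := if h : j < n then v ⟨j, h⟩ else 0

/-! ### Nuisance functions -/

/-- Vector-valued functions of `(a, x, n)`, with value in `ℝ^n`. -/
abbrev VecFn (p : ℕ) := ∀ n : ℕ, Trt n → Cov p n → Vec n

/-- A quadruple `η = (G, H, w, φ)`; the value `φ(a', x, n; a)` is `phi n a' x a`. -/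
structure Nuisance (p : ℕ) where
  /-- outcome regression -/
  G : VecFn p
  /-- treatment probability -/
  H : ∀ n : ℕ, Trt n → Cov p n → ℝ
  /-- weight function -/
  w : VecFn p
  /-- influence function of the weight -/
  phi : ∀ n : ℕ, Trt n → Cov p n → Trt n → Vec n

/-- All components are measurable in the covariates. -/
structure Nuisance.IsMeasurable (η : Nuisance p) : Prop where
  G : ∀ n a, Measurable (η.G n a)
  H : ∀ n a, Measurable (η.H n a)
  w : ∀ n a, Measurable (η.w n a)
  phi : ∀ n a' a, Measurable fun x => η.phi n a' x a

/-- `G(a, x, n) = E(Y | A = a, X = x, N = n)`. -/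
def IsOutcomeRegression (P : Measure (Cluster p)) (G : VecFn p) : Prop :=
  ∀ j : ℕ, Integrable (fun o : Cluster p => coord (outcome o) j) P ∧
    P[fun o : Cluster p => coord (outcome o) j | sigmaAXN p]
      =ᵐ[P] fun o => coord (G (size o) (treat o) (covar o)) j

/-- `H(a, x, n) = P(A = a | X = x, N = n)`: for each choice `t` of one treatment vector for each
cluster size, `P(A = t(N) | X, N) = H(t(N), X, N)` almost surely. -/
def IsTreatmentProb (P : Measure (Cluster p)) (H : ∀ n : ℕ, Trt n → Cov p n → ℝ) : Prop :=
  ∀ t : (∀ n : ℕ, Trt n),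
    P⟦{o : Cluster p | treat o = t (size o)} | sigmaXN p⟧
      =ᵐ[P] fun o => H (size o) (t (size o)) (covar o)

/-! ### Efficient influence functions in the nonparametric model -/

/-- Scores: bounded measurable functions with mean zero. -/
structure IsScore (P : Measure (Cluster p)) (s : Cluster p → ℝ) : Prop where
  measurable : Measurable s
  bounded : ∃ B : ℝ, ∀ o, |s o| ≤ B
  mean_zero : ∫ o, s o ∂P = 0

/-- The one-dimensional submodel `dP_ε = (1 + ε s) dP` through `P` with score `s`
(a probability measure for small `ε`). -/
def submodel (P : Measure (Cluster p)) (s : Cluster p → ℝ) (ε : ℝ) : Measure (Cluster p) :=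
  P.withDensity fun o => ENNReal.ofReal (1 + ε * s o)

/-- `ψ` is the efficient influence function at `P` of the real parameter `θ` in the nonparametric
model: `ψ` is square integrable with mean zero and represents the derivative of `θ` along every
submodel, `dθ(P_ε)/dε = E(ψ s)` at `ε = 0`. -/
structure IsEIF (P : Measure (Cluster p)) (θ : Measure (Cluster p) → ℝ) (ψ : Cluster p → ℝ) :
    Prop where
  memLp : MemLp ψ 2 P
  mean_zero : ∫ o, ψ o ∂P = 0
  deriv : ∀ s, IsScore P s →
    HasDerivAt (fun ε : ℝ => θ (submodel P s ε)) (∫ o, ψ o * s o ∂P) 0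

/-- The weight `w(a, x, n) = W(P)(a, x, n)` has efficient influence function
`{1(X = x, N = n) / dP(x, n)} φ(A, X, N; a)`. As `(X, N)` may have a continuous distribution, this is
read after integration in `(x, n)`: for each bounded measurable `g`, each choice `t` of one treatment
vector for each cluster size and each coordinate `j`, the parameter
`Q ↦ ∫ g(x, n) W(Q)(t(n), x, n)_j dP(x, n)` has efficient influence function
`g(X, N) φ(A, X, N; t(N))_j`. -/
def IsWeightEIF (P : Measure (Cluster p)) (W : Measure (Cluster p) → VecFn p)
    (phi : ∀ n : ℕ, Trt n → Cov p n → Trt n → Vec n) : Prop :=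
  ∀ g : (Σ n : ℕ, Cov p n) → ℝ, Measurable g → (∃ B : ℝ, ∀ z, |g z| ≤ B) →
  ∀ (t : ∀ n : ℕ, Trt n) (j : ℕ),
    (∀ s, IsScore P s → ∀ᶠ ε in 𝓝 (0 : ℝ), Integrable (fun o : Cluster p =>
      g (toXN o) * coord (W (submodel P s ε) (size o) (t (size o)) (covar o)) j) P) ∧
    IsEIF P
      (fun Q => ∫ o, g (toXN o) * coord (W Q (size o) (t (size o)) (covar o)) j ∂P)
      (fun o => g (toXN o) * coord (phi (size o) (treat o) (covar o) (t (size o))) j)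

/-! ### Estimand, uncentered influence function, asymptotic variance -/

/-- `Ψ(w) = E{ ∑_a w(a, X, N)ᵀ E(Y | A = a, X, N) }`. -/
def estimand (P : Measure (Cluster p)) (η : Nuisance p) : ℝ :=
  ∫ o, ∑ a : Trt (size o),
    inner ℝ (η.w (size o) a (covar o)) (η.G (size o) a (covar o)) ∂P

/-- The uncentered efficient influence function `φ(O; η)` of `Ψ(w)`. -/
def uncenteredEIF (η : Nuisance p) (o : Cluster p) : ℝ :=
  (∑ a : Trt (size o),
    inner ℝ (η.w (size o) a (covar o) + η.phi (size o) (treat o) (covar o) a)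
      (η.G (size o) a (covar o)))
  + inner ℝ (η.w (size o) (treat o) (covar o))
      (outcome o - η.G (size o) (treat o) (covar o)) / η.H (size o) (treat o) (covar o)

/-- `σ²(w) = E[{φ(O; η) - Ψ(w)}²]`. -/
def asympVar (P : Measure (Cluster p)) (η : Nuisance p) : ℝ :=
  ∫ o, (uncenteredEIF η o - estimand P η) ^ 2 ∂P

/-! ### Assumptions on the law of the data and on the nuisance functions -/

/-- Finite conditional moments: `|E(Y_j^q | A, X, N)| ≤ C` for `q ≤ 4` and every unit `j`. -/
def FiniteMoments (P : Measure (Cluster p)) : Prop :=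
  ∃ C : ℝ, ∀ j q : ℕ, q ≤ 4 →
    Integrable (fun o : Cluster p => coord (outcome o) j ^ q) P ∧
    ∀ᵐ o ∂P, |(P[fun o : Cluster p => coord (outcome o) j ^ q | sigmaAXN p]) o| ≤ C

/-- Finite cluster size: `N ≤ n_max` almost surely. -/
def FiniteClusterSize (P : Measure (Cluster p)) : Prop :=
  ∃ nmax : ℕ, ∀ᵐ o ∂P, size o ≤ nmax

/-- The bounds on `H`, `G`, `φ`, `w`, for almost every value of `(X, N)` and all treatment
vectors. -/
def IsBoundedBy (P : Measure (Cluster p)) (c C : ℝ) (η : Nuisance p) : Prop :=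
  ∀ᵐ o ∂P, ∀ a a' : Trt (size o),
    η.H (size o) a (covar o) ∈ Set.Ioo c (1 - c) ∧
    ‖η.G (size o) a (covar o)‖ ≤ C ∧
    ‖η.phi (size o) a' (covar o) a‖ ≤ C ∧
    ‖η.w (size o) a (covar o)‖ ≤ C

/-- The norm `‖f‖_{L₂(P)} = {∫ f² dP}^{1/2}`. -/
def normL2 (P : Measure (Cluster p)) (f : Cluster p → ℝ) : ℝ := √(∫ o, f o ^ 2 ∂P)

/-- `‖ ∑_a |(Ĥ - H)(a, X, N)| ‖_{L₂(P)}`. -/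
def errH (P : Measure (Cluster p)) (η' η : Nuisance p) : ℝ :=
  normL2 P fun o => ∑ a : Trt (size o),
    |η'.H (size o) a (covar o) - η.H (size o) a (covar o)|

/-- `‖ ∑_a ‖(Ĝ - G)(a, X, N)‖ ‖_{L₂(P)}`. -/
def errG (P : Measure (Cluster p)) (η' η : Nuisance p) : ℝ :=
  normL2 P fun o => ∑ a : Trt (size o),
    ‖η'.G (size o) a (covar o) - η.G (size o) a (covar o)‖

/-- `‖ ∑_a ‖(φ̂ - φ)(A, X, N; a)‖ ‖_{L₂(P)}`. -/
def errPhi (P : Measure (Cluster p)) (η' η : Nuisance p) : ℝ :=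
  normL2 P fun o => ∑ a : Trt (size o),
    ‖η'.phi (size o) (treat o) (covar o) a - η.phi (size o) (treat o) (covar o) a‖

/-- `‖ ∑_a ‖(ŵ - w)(a, X, N) + ∑_{a'} φ̂(a', X, N; a) H(a', X, N)‖ ‖_{L₂(P)}`. -/
def errW (P : Measure (Cluster p)) (η' η : Nuisance p) : ℝ :=
  normL2 P fun o => ∑ a : Trt (size o),
    ‖(η'.w (size o) a (covar o) - η.w (size o) a (covar o))
      + ∑ a' : Trt (size o),
          η.H (size o) a' (covar o) • η'.phi (size o) a' (covar o) a‖

/-- `Z_m = O_ℙ(r_m)` as `m → ∞`. -/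
def IsBigOP {Ω : Type*} [MeasurableSpace Ω] (μ : Measure Ω) (Z : ℕ → Ω → ℝ) (r : ℕ → ℝ) : Prop :=
  ∀ ε : ℝ, 0 < ε → ∃ M : ℝ, ∀ᶠ m in atTop, μ {ω | M * r m < |Z m ω|} ≤ ENNReal.ofReal ε

/-! ### Sample splitting estimators -/

/-- A sample splitting scheme with `K` groups. All randomness that does not come from the data (the
random partition, and possibly randomized learners) comes from a variable with values in `𝒰`; when
it takes the value `u`, cluster `i` of the first `m` ones is put into group `split m u i`, and
`est m k u d` is the estimate `η̂^(-k)` of the nuisance functions obtained from the data `d`. -/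
structure Scheme (p K : ℕ) (𝒰 : Type*) [MeasurableSpace 𝒰] where
  /-- group membership -/
  split : ∀ m : ℕ, 𝒰 → Fin m → Fin K
  /-- nuisance estimators -/
  est : ∀ m : ℕ, Fin K → 𝒰 → (Fin m → Cluster p) → Nuisance p
  measurable_split : ∀ m, Measurable (split m)
  /-- `η̂^(-k)` is trained on the groups other than `k`. -/
  trained_off : ∀ m k u (d d' : Fin m → Cluster p),
    (∀ i, split m u i ≠ k → d i = d' i) → est m k u d = est m k u d'
  measurable_G : ∀ m k n a, Measurable fun z : 𝒰 × (Fin m → Cluster p) × Cov p n =>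
    (est m k z.1 z.2.1).G n a z.2.2
  measurable_H : ∀ m k n a, Measurable fun z : 𝒰 × (Fin m → Cluster p) × Cov p n =>
    (est m k z.1 z.2.1).H n a z.2.2
  measurable_w : ∀ m k n a, Measurable fun z : 𝒰 × (Fin m → Cluster p) × Cov p n =>
    (est m k z.1 z.2.1).w n a z.2.2
  measurable_phi : ∀ m k n a' a, Measurable fun z : 𝒰 × (Fin m → Cluster p) × Cov p n =>
    (est m k z.1 z.2.1).phi n a' z.2.2 a

namespace Scheme

variable {K : ℕ} {𝒰 : Type*} [MeasurableSpace 𝒰] (S : Scheme p K 𝒰) (m : ℕ) (u : 𝒰)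
  (d : Fin m → Cluster p)

/-- The set of clusters in group `k`. -/
def group (k : Fin K) : Finset (Fin m) := Finset.univ.filter fun i => S.split m u i = k

/-- The average `ℙ_m^k f_k` over group `k`, averaged over the `K` groups. -/
def groupAverage (f : Fin K → Cluster p → ℝ) : ℝ :=
  (K : ℝ)⁻¹ * ∑ k : Fin K, ((S.group m u k).card : ℝ)⁻¹ * ∑ i ∈ S.group m u k, f k (d i)

/-- `Ψ̂(w) = K⁻¹ ∑_k ℙ_m^k{φ(O; η̂^(-k))}`. -/
def psiHat : ℝ := S.groupAverage m u d fun k o => uncenteredEIF (S.est m k u d) o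

/-- `σ̂²(w) = K⁻¹ ∑_k ℙ_m^k[{φ(O; η̂^(-k)) - Ψ̂(w)}²]`. -/
def varHat : ℝ :=
  S.groupAverage m u d fun k o => (uncenteredEIF (S.est m k u d) o - S.psiHat m u d) ^ 2

end Scheme

/-- The data of the first `m` clusters. -/
def sample {Ω : Type*} (O : ℕ → Ω → Cluster p) (m : ℕ) (ω : Ω) : Fin m → Cluster p :=
  fun i => O i ω

end ClusterPolicy

end

open ClusterPolicy

/-!
The asymptotic normality rests on three facts.

*The bias is of second order.* Write `f̂` and `f` for the uncentered influence functions at the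
estimated and at the true nuisance functions. Conditioning on `(A, X, N)` and then on `(X, N)` turns
`E f̂ - Ψ` into an integral over `(X, N)` of sums over treatment vectors, in which the propensity
score is explicit. The errors of `w` and of `φ` enter linearly only through
`ŵ - w + ∑_{a'} φ̂(a') H(a')`, whose norm is assumed small; every other term is a product of
`Ĝ - G` with `Ĥ - H` or with `ŵ - w` (`abs_bias_summand_le`). Now
`∑_{a'} φ(a', x, n; a) H(a', x, n) = 0`, since the efficient influence function of `∫ g w` has mean
zero for every bounded `g` (`ae_sum_H_smul_phi_eq_zero`). So `ŵ - w` is itself controlled by the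
combination above and by `φ̂ - φ` (`exists_normL2_devW_le`), and the bias is at most of the order
`r_w² + r_G (r_H + r_φ)` (`RegularModel.exists_abs_mean_sub_le`).

*Cross-fitting.* Given the training data, `f̂ - f` is a fixed function for the clusters of the
held-out group. Its mean square is bounded by the errors of the nuisance estimates
(`RegularModel.exists_integral_sub_sq_le`), so it tends to zero in probability.
Conditional expectations given the training data are avoided: a function of the data off group `k`
does not change when cluster `i` of group `k` is replaced by an independent copy, so Fubini's
theorem on the product space computes the moments that are needed, on the event where the
conditional mean square is small. This gives
`IsSampling.tendsto_sum_sq` and, for the centred sums on the scale `√m`,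
`IsSampling.tendsto_sum_centred`.

*Linearization.* What remains is the average of `f - Ψ` over groups of random sizes. As the sizes
are balanced, it differs from the average over all clusters by a weight tending to `0` times a sum
that is bounded in probability. So the estimator is asymptotically linear
(`tendsto_sqrt_mul_psiHat_sub`), and the variance estimator is consistent (`tendsto_varHat`). The
central limit theorem and Slutsky's theorem finish the proof.
-/

noncomputable section

namespace ClusterPolicy

variable {p : ℕ}

/-! ### Measurability on disjoint unions -/

theorem measurableEmbedding_sigmaMk {ι : Type*} {β : ι → Type*} [∀ i, MeasurableSpace (β i)]
    (i : ι) : MeasurableEmbedding (Sigma.mk i : β i → Σ i, β i) where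
  injective := sigma_mk_injective
  measurable := measurable_sigma_mk i
  measurableSet_image' := by
    intro s hs
    refine MeasurableSpace.measurableSet_iInf.2 fun j => ?_
    change MeasurableSet (Sigma.mk j ⁻¹' (Sigma.mk i '' s))
    by_cases h : j = i
    · subst h
      rwa [Set.preimage_image_eq _ sigma_mk_injective]
    · convert MeasurableSet.empty (α := β j)
      ext x
      simp only [Set.mem_preimage, Set.mem_image, Set.mem_empty_iff_false, iff_false]
      rintro ⟨y, _, hy⟩
      exact h (congrArg Sigma.fst hy).symm

/-- A map out of `α × Σ i, β i` is measurable when it is measurable on each `α × β i`. -/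
theorem measurable_prod_sigma_of {α ι γ : Type*} [Countable ι] {β : ι → Type*}
    [MeasurableSpace α] [∀ i, MeasurableSpace (β i)] [MeasurableSpace γ] {f : α × (Σ i, β i) → γ}
    (hf : ∀ i, Measurable fun z : α × β i => f (z.1, ⟨i, z.2⟩)) : Measurable f := by
  intro s hs
  have h : f ⁻¹' s = ⋃ i, Prod.map id (Sigma.mk i) ''
      ((fun z : α × β i => f (z.1, ⟨i, z.2⟩)) ⁻¹' s) := by
    ext ⟨x, i, y⟩
    simp only [Set.mem_preimage, Set.mem_iUnion, Set.mem_image, Prod.exists, Prod.map_apply, id]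
    constructor
    · intro h
      exact ⟨i, x, y, h, rfl⟩
    · rintro ⟨i', x', y', h, he⟩
      rw [← he]
      exact h
  rw [h]
  exact MeasurableSet.iUnion fun i =>
    (MeasurableEmbedding.id.prodMap (measurableEmbedding_sigmaMk i)).measurableSet_image.2
      (hf i hs)

theorem measurable_coord {n : ℕ} (j : ℕ) : Measurable fun v : Vec n => coord v j := by
  unfold coord
  split_ifs <;> fun_prop

/-! ### Measurable families of nuisance functions -/

/-- A family of nuisance functions whose components depend jointly measurably on the parameter and
on the covariates, as the estimators of a `Scheme` do. -/
structure IsMeasurableFamily {Z : Type*} [MeasurableSpace Z] (E : Z → Nuisance p) : Prop where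
  G : ∀ n a, Measurable fun z : Z × Cov p n => (E z.1).G n a z.2
  H : ∀ n a, Measurable fun z : Z × Cov p n => (E z.1).H n a z.2
  w : ∀ n a, Measurable fun z : Z × Cov p n => (E z.1).w n a z.2
  phi : ∀ n a' a, Measurable fun z : Z × Cov p n => (E z.1).phi n a' z.2 a

theorem IsMeasurableFamily.isMeasurable {Z : Type*} [MeasurableSpace Z] {E : Z → Nuisance p}
    (hE : IsMeasurableFamily E) (z : Z) : (E z).IsMeasurable where
  G n a := (hE.G n a).comp measurable_prodMk_left
  H n a := (hE.H n a).comp measurable_prodMk_left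
  w n a := (hE.w n a).comp measurable_prodMk_left
  phi n a' a := (hE.phi n a' a).comp measurable_prodMk_left

theorem Nuisance.IsMeasurable.isMeasurableFamily {Z : Type*} [MeasurableSpace Z] {η : Nuisance p}
    (hη : η.IsMeasurable) : IsMeasurableFamily fun _ : Z => η where
  G n a := (hη.G n a).comp measurable_snd
  H n a := (hη.H n a).comp measurable_snd
  w n a := (hη.w n a).comp measurable_snd
  phi n a' a := (hη.phi n a' a).comp measurable_snd

theorem Scheme.isMeasurableFamily_est {K : ℕ} {𝒰 : Type*} [MeasurableSpace 𝒰] (S : Scheme p K 𝒰)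
    (m : ℕ) (k : Fin K) :
    IsMeasurableFamily fun z : 𝒰 × (Fin m → Cluster p) => S.est m k z.1 z.2 where
  G n a := (S.measurable_G m k n a).comp MeasurableEquiv.prodAssoc.measurable
  H n a := (S.measurable_H m k n a).comp MeasurableEquiv.prodAssoc.measurable
  w n a := (S.measurable_w m k n a).comp MeasurableEquiv.prodAssoc.measurable
  phi n a' a := (S.measurable_phi m k n a' a).comp MeasurableEquiv.prodAssoc.measurable

theorem measurable_uncenteredEIF_family {Z : Type*} [MeasurableSpace Z] {E : Z → Nuisance p}
    (hE : IsMeasurableFamily E) :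
    Measurable fun z : Z × Cluster p => uncenteredEIF (E z.1) z.2 := by
  refine measurable_prod_sigma_of fun n => ?_
  have he : Measurable fun z : Z × (Vec n × Trt n × Cov p n) =>
      ((z.1, z.2.1, z.2.2.2), z.2.2.1) := by fun_prop
  have hF : Measurable fun z : (Z × Vec n × Cov p n) × Trt n =>
      uncenteredEIF (E z.1.1) ⟨n, z.1.2.1, z.2, z.1.2.2⟩ := by
    refine measurable_from_prod_countable_left fun a => ?_
    have hx : Measurable fun z : Z × Vec n × Cov p n => (z.1, z.2.2) := by fun_prop
    have hG : ∀ a, Measurable fun z : Z × Vec n × Cov p n => (E z.1).G n a z.2.2 :=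
      fun a => (hE.G n a).comp hx
    have hH : ∀ a, Measurable fun z : Z × Vec n × Cov p n => (E z.1).H n a z.2.2 :=
      fun a => (hE.H n a).comp hx
    have hw : ∀ a, Measurable fun z : Z × Vec n × Cov p n => (E z.1).w n a z.2.2 :=
      fun a => (hE.w n a).comp hx
    have hphi : ∀ a' a, Measurable fun z : Z × Vec n × Cov p n => (E z.1).phi n a' z.2.2 a :=
      fun a' a => (hE.phi n a' a).comp hx
    have hy : Measurable fun z : Z × Vec n × Cov p n => z.2.1 := by fun_prop
    dsimp only [uncenteredEIF, size, treat, covar, outcome]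
    refine Measurable.add ?_ ?_
    · exact Finset.measurable_sum Finset.univ fun a' _ =>
        Measurable.inner (𝕜 := ℝ) ((hw a').add (hphi a a')) (hG a')
    · exact (Measurable.inner (𝕜 := ℝ) (hw a) (hy.sub (hG a))).div (hH a)
  have h := hF.comp he
  simpa only [Function.comp_def] using h

theorem measurable_uncenteredEIF {η : Nuisance p} (hη : η.IsMeasurable) :
    Measurable (uncenteredEIF η) := by
  have h := (measurable_uncenteredEIF_family (hη.isMeasurableFamily (Z := Unit))).comp
    (measurable_prodMk_left (x := ()))
  simpa only [Function.comp_def] using h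

/-- A function of `(A, X, N)` is measurable when it is measurable in the covariates. -/
theorem measurable_trt_cov {γ : Type*} [MeasurableSpace γ] {h : ∀ n : ℕ, Trt n → Cov p n → γ}
    (hh : ∀ n a, Measurable (h n a)) :
    Measurable fun z : (Σ n : ℕ, Trt n × Cov p n) => h z.1 z.2.1 z.2.2 :=
  measurable_sigma_of fun n => measurable_from_prod_countable_right fun a => hh n a

theorem sigmaAXN_le : sigmaAXN p ≤ (inferInstance : MeasurableSpace (Cluster p)) :=
  measurable_toAXN.comap_le

theorem sigmaXN_le : sigmaXN p ≤ (inferInstance : MeasurableSpace (Cluster p)) :=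
  measurable_toXN.comap_le

/-! ### Coordinates of vectors of variable length -/

theorem coord_sub {n : ℕ} (v w : Vec n) (j : ℕ) : coord (v - w) j = coord v j - coord w j := by
  unfold coord
  split_ifs <;> simp

theorem coord_sum_smul {n : ℕ} {ι : Type*} (s : Finset ι) (r : ι → ℝ) (v : ι → Vec n) (j : ℕ) :
    coord (∑ i ∈ s, r i • v i) j = ∑ i ∈ s, r i * coord (v i) j := by
  unfold coord
  split_ifs <;> simp

theorem eq_zero_of_coord_eq_zero {n : ℕ} {v : Vec n} (h : ∀ j, coord v j = 0) : v = 0 := by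
  ext i
  simpa [coord] using h i

theorem abs_coord_le_norm {n : ℕ} (v : Vec n) (j : ℕ) : |coord v j| ≤ ‖v‖ := by
  unfold coord
  split_ifs
  · exact PiLp.norm_apply_le v _
  · simp

theorem inner_eq_sum_coord {n N : ℕ} (h : n ≤ N) (v y : Vec n) :
    inner ℝ v y = ∑ j ∈ Finset.range N, coord v j * coord y j := by
  have h1 : ∑ j ∈ Finset.range N, coord v j * coord y j
      = ∑ j ∈ Finset.range n, coord v j * coord y j := by
    symm
    refine Finset.sum_subset (Finset.range_mono h) fun j _ hj => ?_
    have hj' : ¬ j < n := by simpa using hj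
    simp [coord, hj']
  rw [h1, Finset.sum_range, PiLp.inner_apply]
  refine Finset.sum_congr rfl fun i _ => ?_
  simp [coord, mul_comm]

/-! ### Consequences of the definitions of the nuisance functions -/

theorem IsBoundedBy.abs_H_le_one {P : Measure (Cluster p)} {c C : ℝ} {η : Nuisance p} (hc : 0 < c)
    (hη : IsBoundedBy P c C η) :
    ∀ᵐ o ∂P, ∀ a : Trt (size o), |η.H (size o) a (covar o)| ≤ 1 := by
  filter_upwards [hη] with o ho a
  obtain ⟨h1, h2⟩ := (ho a a).1
  rw [abs_le]
  constructor <;> linarith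

variable {P : Measure (Cluster p)} [IsProbabilityMeasure P]

theorem integral_mul_condExp {Ω : Type*} {m m₀ : MeasurableSpace Ω} (hm : m ≤ m₀)
    {μ : Measure Ω} [IsFiniteMeasure μ] {f g : Ω → ℝ} (hf : Measurable[m] f)
    (hg : Integrable g μ) {B : ℝ} (hB : ∀ᵐ ω ∂μ, |f ω| ≤ B) :
    ∫ ω, f ω * g ω ∂μ = ∫ ω, f ω * (μ[g | m]) ω ∂μ := by
  have h := condExp_stronglyMeasurable_mul_of_bound hm hf.stronglyMeasurable hg B hB
  have h2 := integral_condExp hm (μ := μ) (f := f * g)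
  rw [integral_congr_ae h] at h2
  exact h2.symm

theorem measurable_norm_outcome : Measurable fun o : Cluster p => ‖outcome o‖ :=
  measurable_sigma_of fun n => (measurable_norm (α := Vec n)).comp measurable_fst

theorem measurable_vec_coord {v : VecFn p} (hv : ∀ n a, Measurable (v n a)) (j : ℕ) :
    Measurable fun z : (Σ n : ℕ, Trt n × Cov p n) => coord (v z.1 z.2.1 z.2.2) j :=
  measurable_trt_cov (h := fun n a x => coord (v n a x) j)
    fun n a => (measurable_coord j).comp (hv n a)

/-- The residual `Y - G(A, X, N)` is orthogonal to every bounded function of `(A, X, N)`. -/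
theorem integral_inner_residual (hsize : FiniteClusterSize P) {G : VecFn p}
    (hG : IsOutcomeRegression P G) {v : VecFn p}
    (hv : ∀ n a, Measurable (v n a)) {B : ℝ}
    (hB : ∀ᵐ o ∂P, ‖v (size o) (treat o) (covar o)‖ ≤ B) :
    Integrable (fun o : Cluster p => (inner ℝ (v (size o) (treat o) (covar o))
      (outcome o - G (size o) (treat o) (covar o)) : ℝ)) P ∧
    ∫ o, inner ℝ (v (size o) (treat o) (covar o))
      (outcome o - G (size o) (treat o) (covar o)) ∂P = 0 := by
  obtain ⟨N, hN⟩ := hsize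
  have hvB : ∀ j, ∀ᵐ o ∂P, |coord (v (size o) (treat o) (covar o)) j| ≤ B := fun j => by
    filter_upwards [hB] with o ho using (abs_coord_le_norm _ j).trans ho
  have hvm : ∀ j, Measurable[sigmaAXN p] fun o : Cluster p =>
      coord (v (size o) (treat o) (covar o)) j := fun j =>
    (measurable_vec_coord hv j).comp (comap_measurable toAXN)
  have hvm' : ∀ j, Measurable fun o : Cluster p =>
      coord (v (size o) (treat o) (covar o)) j := fun j =>
    (measurable_vec_coord hv j).comp measurable_toAXN
  have hGi : ∀ j, Integrable (fun o : Cluster p =>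
      coord (G (size o) (treat o) (covar o)) j) P := fun j =>
    integrable_condExp.congr (hG j).2
  have hi1 : ∀ j, Integrable (fun o : Cluster p =>
      coord (v (size o) (treat o) (covar o)) j * coord (outcome o) j) P := fun j =>
    (hG j).1.bdd_mul (hvm' j).aestronglyMeasurable (hvB j)
  have hi2 : ∀ j, Integrable (fun o : Cluster p => coord (v (size o) (treat o) (covar o)) j *
      coord (G (size o) (treat o) (covar o)) j) P := fun j =>
    (hGi j).bdd_mul (hvm' j).aestronglyMeasurable (hvB j)
  have hs : (fun o : Cluster p => (inner ℝ (v (size o) (treat o) (covar o))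
      (outcome o - G (size o) (treat o) (covar o)) : ℝ)) =ᵐ[P] fun o =>
      ∑ j ∈ Finset.range N, (coord (v (size o) (treat o) (covar o)) j * coord (outcome o) j -
        coord (v (size o) (treat o) (covar o)) j *
          coord (G (size o) (treat o) (covar o)) j) := by
    filter_upwards [hN] with o ho
    rw [inner_eq_sum_coord ho]
    exact Finset.sum_congr rfl fun j _ => by rw [coord_sub, mul_sub]
  have hi : ∀ j ∈ Finset.range N, Integrable (fun o : Cluster p =>
      coord (v (size o) (treat o) (covar o)) j * coord (outcome o) j -
        coord (v (size o) (treat o) (covar o)) j *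
          coord (G (size o) (treat o) (covar o)) j) P := fun j _ => (hi1 j).sub (hi2 j)
  constructor
  · exact (integrable_finsetSum _ hi).congr hs.symm
  · rw [integral_congr_ae hs, integral_finsetSum _ hi]
    refine Finset.sum_eq_zero fun j _ => ?_
    rw [integral_sub (hi1 j) (hi2 j), integral_mul_condExp sigmaAXN_le (hvm j) (hG j).1 (hvB j),
      sub_eq_zero]
    refine integral_congr_ae ?_
    filter_upwards [(hG j).2] with o ho
    rw [ho]

/-- The outcomes have a second moment, uniformly bounded conditionally on `(A, X, N)`. -/
theorem exists_integral_mul_norm_outcome_sq_le (hsize : FiniteClusterSize P)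
    (hmom : FiniteMoments P) :
    ∃ M : ℝ, 0 ≤ M ∧ ∀ (h : (Σ n : ℕ, Trt n × Cov p n) → ℝ) (B : ℝ), Measurable h →
      (∀ z, 0 ≤ h z) → (∀ᵐ o ∂P, h (toAXN o) ≤ B) →
      Integrable (fun o => h (toAXN o) * ‖outcome o‖ ^ 2) P ∧
      ∫ o, h (toAXN o) * ‖outcome o‖ ^ 2 ∂P ≤ M * ∫ o, h (toAXN o) ∂P := by
  obtain ⟨N, hN⟩ := hsize
  obtain ⟨C, hC⟩ := hmom
  refine ⟨N * |C|, by positivity, fun h B hh h0 hB => ?_⟩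
  have hB' : ∀ᵐ o ∂P, ‖h (toAXN o)‖ ≤ B := by
    filter_upwards [hB] with o ho
    rwa [Real.norm_of_nonneg (h0 _)]
  have hm : Measurable fun o : Cluster p => h (toAXN o) := hh.comp measurable_toAXN
  have hm' : Measurable[sigmaAXN p] fun o : Cluster p => h (toAXN o) :=
    hh.comp (comap_measurable toAXN)
  have hhi : Integrable (fun o : Cluster p => h (toAXN o)) P :=
    Integrable.of_bound hm.aestronglyMeasurable B hB'
  have hi : ∀ j, Integrable (fun o : Cluster p => h (toAXN o) * coord (outcome o) j ^ 2) P :=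
    fun j => (hC j 2 (by norm_num)).1.bdd_mul hm.aestronglyMeasurable hB'
  have hs : (fun o : Cluster p => h (toAXN o) * ‖outcome o‖ ^ 2) =ᵐ[P] fun o =>
      ∑ j ∈ Finset.range N, h (toAXN o) * coord (outcome o) j ^ 2 := by
    filter_upwards [hN] with o ho
    rw [← real_inner_self_eq_norm_sq, inner_eq_sum_coord ho, Finset.mul_sum]
    exact Finset.sum_congr rfl fun j _ => by rw [sq]
  refine ⟨(integrable_finsetSum _ fun j _ => hi j).congr hs.symm, ?_⟩
  rw [integral_congr_ae hs, integral_finsetSum _ fun j _ => hi j]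
  have hj : ∀ j ∈ Finset.range N, ∫ o, h (toAXN o) * coord (outcome o) j ^ 2 ∂P
      ≤ |C| * ∫ o, h (toAXN o) ∂P := fun j _ => by
    rw [integral_mul_condExp sigmaAXN_le hm' (hC j 2 (by norm_num)).1 hB', ← integral_const_mul]
    refine integral_mono_ae (integrable_condExp.bdd_mul hm.aestronglyMeasurable hB')
      (hhi.const_mul _) ?_
    filter_upwards [(hC j 2 (by norm_num)).2] with o ho
    rw [mul_comm]
    exact mul_le_mul_of_nonneg_right ((le_abs_self _).trans (ho.trans (le_abs_self C))) (h0 _)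
  refine (Finset.sum_le_sum hj).trans ?_
  rw [Finset.sum_const, Finset.card_range, nsmul_eq_mul, mul_assoc]

theorem measurableSet_treat_eq (t : ∀ n : ℕ, Trt n) :
    MeasurableSet {o : Cluster p | treat o = t (size o)} := by
  refine MeasurableSpace.measurableSet_iInf.2 fun n => ?_
  change MeasurableSet {b : Vec n × Trt n × Cov p n | b.2.1 = t n}
  exact measurableSet_eq_fun (by fun_prop) measurable_const

theorem integral_mul_indicator_treat {H : ∀ n : ℕ, Trt n → Cov p n → ℝ}
    (hH : IsTreatmentProb P H) (t : ∀ n : ℕ, Trt n) {k : (Σ n : ℕ, Cov p n) → ℝ}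
    (hk : Measurable k) {B : ℝ} (hB : ∀ᵐ o ∂P, |k (toXN o)| ≤ B) :
    ∫ o, k (toXN o) * ({o : Cluster p | treat o = t (size o)}.indicator (fun _ => (1 : ℝ)) o) ∂P
      = ∫ o, k (toXN o) * H (size o) (t (size o)) (covar o) ∂P := by
  have hi : Integrable ({o : Cluster p | treat o = t (size o)}.indicator fun _ => (1 : ℝ)) P :=
    (integrable_const 1).indicator (measurableSet_treat_eq t)
  have hk' : Measurable[sigmaXN p] fun o : Cluster p => k (toXN o) :=
    hk.comp (comap_measurable toXN)
  rw [integral_mul_condExp sigmaXN_le hk' hi hB]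
  refine integral_congr_ae ?_
  filter_upwards [hH t] with o ho
  rw [ho]

/-- The treatment vector which is `a` in clusters of size `n`. -/
def extendTrt {n : ℕ} (a : Trt n) : ∀ n : ℕ, Trt n :=
  Function.update (fun _ _ => false) n a

theorem extendTrt_self {n : ℕ} (a : Trt n) : extendTrt a n = a := by
  simp [extendTrt]

/-- Averaging over the treatments given `(X, N)`:
`E{h(A, X, N)} = E{∑_a H(a, X, N) h(a, X, N)}`. -/
theorem integral_treat_eq_integral_sum (hsize : FiniteClusterSize P)
    {H : ∀ n : ℕ, Trt n → Cov p n → ℝ} (hHm : ∀ n a, Measurable (H n a))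
    (hH : IsTreatmentProb P H)
    (hH1 : ∀ᵐ o ∂P, ∀ a : Trt (size o), |H (size o) a (covar o)| ≤ 1)
    {h : ∀ n : ℕ, Trt n → Cov p n → ℝ} (hh : ∀ n a, Measurable (h n a)) {B : ℝ}
    (hB : ∀ᵐ o ∂P, ∀ a : Trt (size o), |h (size o) a (covar o)| ≤ B) :
    ∫ o, h (size o) (treat o) (covar o) ∂P
      = ∫ o, ∑ a : Trt (size o), H (size o) a (covar o) * h (size o) a (covar o) ∂P := by
  classical
  obtain ⟨N, hN⟩ := hsize
  have hB0 : 0 ≤ B := by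
    obtain ⟨o, ho⟩ := hB.exists
    exact (abs_nonneg _).trans (ho fun _ => false)
  let t : ∀ n : ℕ, Trt n → ∀ n' : ℕ, Trt n' := fun n a => extendTrt a
  have ht : ∀ n a, t n a n = a := fun n a => extendTrt_self a
  let k : ∀ n : ℕ, Trt n → (Σ n : ℕ, Cov p n) → ℝ := fun n a z =>
    if z.1 = n then h z.1 (t n a z.1) z.2 else 0
  have hkm : ∀ n a, Measurable (k n a) := fun n a => by
    refine measurable_sigma_of fun n' => ?_
    by_cases hn : n' = n
    · simpa [k, hn] using hh n' (t n a n')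
    · simp [k, hn]
  have hkB : ∀ n a, ∀ᵐ o ∂P, |k n a (toXN o)| ≤ B := fun n a => by
    filter_upwards [hB] with o ho
    change |if size o = n then h (size o) (t n a (size o)) (covar o) else 0| ≤ B
    split_ifs
    · exact ho _
    · simpa using hB0
  have hkm' : ∀ n a, Measurable fun o : Cluster p => k n a (toXN o) := fun n a =>
    (hkm n a).comp measurable_toXN
  have hki : ∀ n a, Integrable (fun o : Cluster p => k n a (toXN o)) P := fun n a =>
    Integrable.of_bound (hkm' n a).aestronglyMeasurable B (hkB n a)
  have hHm' : ∀ n a, Measurable fun o : Cluster p => H (size o) (t n a (size o)) (covar o) :=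
    fun n a => (measurable_sigma_of (f := fun z : (Σ n : ℕ, Cov p n) => H z.1 (t n a z.1) z.2)
      fun n' => hHm n' (t n a n')).comp measurable_toXN
  have hi1 : ∀ n a, Integrable (fun o : Cluster p => k n a (toXN o) *
      ({o : Cluster p | treat o = t n a (size o)}.indicator (fun _ => (1 : ℝ)) o)) P := by
    intro n a
    refine (hki n a).mul_bdd (c := 1)
      (measurable_const.indicator (measurableSet_treat_eq _)).aestronglyMeasurable ?_
    refine Eventually.of_forall fun o => ?_
    simp only [Set.indicator]
    split_ifs <;> simp
  have hi2 : ∀ n a, Integrable (fun o : Cluster p => k n a (toXN o) *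
      H (size o) (t n a (size o)) (covar o)) P := by
    intro n a
    refine (hki n a).mul_bdd (c := 1) (hHm' n a).aestronglyMeasurable ?_
    filter_upwards [hH1] with o ho using ho _
  have hl : (fun o : Cluster p => h (size o) (treat o) (covar o)) =ᵐ[P] fun o =>
      ∑ n ∈ Finset.range (N + 1), ∑ a : Trt n, k n a (toXN o) *
        ({o : Cluster p | treat o = t n a (size o)}.indicator (fun _ => (1 : ℝ)) o) := by
    filter_upwards [hN] with o ho
    obtain ⟨n, y, a, x⟩ := o
    rw [Finset.sum_eq_single_of_mem n (by simpa [Nat.lt_succ_iff] using ho)]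
    · rw [Finset.sum_eq_single_of_mem a (Finset.mem_univ _)]
      · simp [k, toXN, ht]
      · intro b _ hb
        have hb' : ¬ a = b := fun e => hb e.symm
        simp [toXN, ht, hb']
    · intro n' _ hn'
      refine Finset.sum_eq_zero fun a' _ => ?_
      have hn'' : ¬ n = n' := fun e => hn' e.symm
      simp [k, toXN, hn'']
  have hr : (fun o : Cluster p => ∑ a : Trt (size o),
      H (size o) a (covar o) * h (size o) a (covar o)) =ᵐ[P] fun o =>
      ∑ n ∈ Finset.range (N + 1), ∑ a : Trt n, k n a (toXN o) *
        H (size o) (t n a (size o)) (covar o) := by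
    filter_upwards [hN] with o ho
    obtain ⟨n, y, a, x⟩ := o
    rw [Finset.sum_eq_single_of_mem n (by simpa [Nat.lt_succ_iff] using ho)]
    · refine Finset.sum_congr rfl fun b _ => ?_
      simp [k, toXN, ht, mul_comm]
    · intro n' _ hn'
      refine Finset.sum_eq_zero fun a' _ => ?_
      have hn'' : ¬ n = n' := fun e => hn' e.symm
      simp [k, toXN, hn'']
  rw [integral_congr_ae hl, integral_congr_ae hr,
    integral_finsetSum _ fun n _ => integrable_finsetSum _ fun a _ => hi1 n a,
    integral_finsetSum _ fun n _ => integrable_finsetSum _ fun a _ => hi2 n a]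
  refine Finset.sum_congr rfl fun n _ => ?_
  rw [integral_finsetSum _ fun a _ => hi1 n a, integral_finsetSum _ fun a _ => hi2 n a]
  exact Finset.sum_congr rfl fun a _ => integral_mul_indicator_treat hH _ (hkm n a) (hkB n a)

/-- The influence function of the weight has conditional mean zero given `(X, N)`. This is what the
normalization of an efficient influence function, `E{g(X, N) φ(A, X, N; t(N))_j} = 0` for all
bounded `g`, amounts to. -/
theorem ae_sum_H_smul_phi_eq_zero (hsize : FiniteClusterSize P) {η : Nuisance p}
    (hη : η.IsMeasurable) (hH : IsTreatmentProb P η.H) {W : Measure (Cluster p) → VecFn p}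
    (hphi : IsWeightEIF P W η.phi) {c C : ℝ} (hc : 0 < c) (hbdd : IsBoundedBy P c C η) :
    ∀ᵐ o ∂P, ∀ a : Trt (size o),
      ∑ a' : Trt (size o), η.H (size o) a' (covar o) • η.phi (size o) a' (covar o) a = 0 := by
  have hH1 := hbdd.abs_H_le_one hc
  have key : ∀ (t : ∀ n : ℕ, Trt n) (j : ℕ), ∀ᵐ o ∂P, ∑ a' : Trt (size o),
      η.H (size o) a' (covar o) * coord (η.phi (size o) a' (covar o) (t (size o))) j = 0 := by
    intro t j
    let S : (Σ n : ℕ, Cov p n) → ℝ := fun z =>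
      ∑ a' : Trt z.1, η.H z.1 a' z.2 * coord (η.phi z.1 a' z.2 (t z.1)) j
    have hS : Measurable S := measurable_sigma_of fun n =>
      Finset.measurable_sum Finset.univ fun a' _ =>
        (hη.H n a').mul ((measurable_coord j).comp (hη.phi n a' (t n)))
    -- test against the sign of the conditional mean itself
    let g : (Σ n : ℕ, Cov p n) → ℝ := fun z => if 0 ≤ S z then 1 else -1
    have hg : Measurable g :=
      Measurable.ite (measurableSet_le measurable_const hS) measurable_const measurable_const
    have hg1 : ∀ z, |g z| ≤ 1 := fun z => by
      simp only [g]
      split_ifs <;> simp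
    have h0 := (hphi g hg ⟨1, hg1⟩ t j).2.mean_zero
    have h1 := integral_treat_eq_integral_sum hsize hη.H hH hH1
      (h := fun n a x => g ⟨n, x⟩ * coord (η.phi n a x (t n)) j) (B := C)
      (fun n a => (hg.comp (measurable_sigma_mk (β := fun n => Cov p n) n)).mul
        ((measurable_coord j).comp (hη.phi n a (t n)))) (by
        filter_upwards [hbdd] with o ho a
        rw [abs_mul]
        have h2 := abs_coord_le_norm (η.phi (size o) a (covar o) (t (size o))) j
        have h3 := (ho (t (size o)) a).2.2.1
        have h4 := hg1 ⟨size o, covar o⟩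
        nlinarith [abs_nonneg (coord (η.phi (size o) a (covar o) (t (size o))) j)])
    have h2 : ∫ o, |S (toXN o)| ∂P = 0 := by
      rw [← h0]
      refine Eq.trans ?_ h1.symm
      refine integral_congr_ae (Eventually.of_forall fun o => ?_)
      have h3 : |S (toXN o)| = g (toXN o) * S (toXN o) := by
        simp only [g]
        split_ifs with h
        · rw [abs_of_nonneg h, one_mul]
        · rw [abs_of_neg (not_le.1 h), neg_one_mul]
      change |S (toXN o)| = _
      rw [h3]
      simp only [S, Finset.mul_sum, toXN]
      exact Finset.sum_congr rfl fun a _ => by ring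
    have hSm : Measurable fun o : Cluster p => |S (toXN o)| :=
      (hS.comp measurable_toXN).abs
    have hSi : Integrable (fun o : Cluster p => |S (toXN o)|) P := by
      obtain ⟨N, hN⟩ := hsize
      refine Integrable.of_bound hSm.aestronglyMeasurable (2 ^ N * C) ?_
      filter_upwards [hN, hbdd, hH1] with o ho1 ho2 ho3
      have hC : 0 ≤ C := (norm_nonneg _).trans (ho2 (fun _ => false) fun _ => false).2.1
      have : |S (toXN o)| ≤ ∑ a' : Trt (size o), C := by
        refine (Finset.abs_sum_le_sum_abs _ _).trans (Finset.sum_le_sum fun a' _ => ?_)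
        rw [abs_mul]
        have h2 := abs_coord_le_norm (η.phi (size o) a' (covar o) (t (size o))) j
        have h3 := (ho2 (t (size o)) a').2.2.1
        have h4 := ho3 a'
        change |η.H (size o) a' (covar o)| * |coord (η.phi (size o) a' (covar o) (t (size o))) j|
          ≤ C
        nlinarith [abs_nonneg (coord (η.phi (size o) a' (covar o) (t (size o))) j)]
      rw [Real.norm_eq_abs, abs_abs]
      refine this.trans ?_
      simp only [Finset.sum_const, Finset.card_univ, Fintype.card_fun, Fintype.card_bool,
        Fintype.card_fin, nsmul_eq_mul, Nat.cast_pow, Nat.cast_ofNat]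
      gcongr
      · norm_num
    have h3 := (integral_eq_zero_iff_of_nonneg (fun o => abs_nonneg _) hSi).1 h2
    filter_upwards [h3] with o ho
    simpa [S, toXN] using ho
  have hall : ∀ᵐ o ∂P, ∀ (n : ℕ) (a : Trt n) (j : ℕ), ∑ a' : Trt (size o),
      η.H (size o) a' (covar o) *
        coord (η.phi (size o) a' (covar o) (extendTrt a (size o))) j = 0 :=
    ae_all_iff.2 fun n => ae_all_iff.2 fun a => ae_all_iff.2 fun j => key _ j
  filter_upwards [hall] with o ho a
  refine eq_zero_of_coord_eq_zero fun j => ?_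
  have := ho (size o) a j
  rw [extendTrt_self] at this
  rw [coord_sum_smul, this]

/-! ### Deviations of the nuisance estimates -/

/-- `∑_a |(Ĥ - H)(a, x, n)|`, as a function of `(a, x, n)`. -/
def devH (η' η : Nuisance p) (z : Σ n : ℕ, Trt n × Cov p n) : ℝ :=
  ∑ a : Trt z.1, |η'.H z.1 a z.2.2 - η.H z.1 a z.2.2|

/-- `∑_a ‖(Ĝ - G)(a, x, n)‖`, as a function of `(a, x, n)`. -/
def devG (η' η : Nuisance p) (z : Σ n : ℕ, Trt n × Cov p n) : ℝ :=
  ∑ a : Trt z.1, ‖η'.G z.1 a z.2.2 - η.G z.1 a z.2.2‖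

/-- `∑_a ‖(φ̂ - φ)(a', x, n; a)‖`, as a function of `(a', x, n)`. -/
def devPhi (η' η : Nuisance p) (z : Σ n : ℕ, Trt n × Cov p n) : ℝ :=
  ∑ a : Trt z.1, ‖η'.phi z.1 z.2.1 z.2.2 a - η.phi z.1 z.2.1 z.2.2 a‖

/-- `∑_a ‖(ŵ - w)(a, x, n)‖`, as a function of `(a, x, n)`. -/
def devW (η' η : Nuisance p) (z : Σ n : ℕ, Trt n × Cov p n) : ℝ :=
  ∑ a : Trt z.1, ‖η'.w z.1 a z.2.2 - η.w z.1 a z.2.2‖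

/-- The second-order remainder `∑_a ‖(ŵ - w)(a, x, n) + ∑_{a'} φ̂(a', x, n; a) H(a', x, n)‖` of the
weight, as a function of `(a, x, n)`. -/
def remW (η' η : Nuisance p) (z : Σ n : ℕ, Trt n × Cov p n) : ℝ :=
  ∑ a : Trt z.1, ‖(η'.w z.1 a z.2.2 - η.w z.1 a z.2.2)
    + ∑ a' : Trt z.1, η.H z.1 a' z.2.2 • η'.phi z.1 a' z.2.2 a‖

theorem devH_nonneg (η' η : Nuisance p) (z : Σ n : ℕ, Trt n × Cov p n) : 0 ≤ devH η' η z :=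
  Finset.sum_nonneg fun _ _ => abs_nonneg _

theorem devG_nonneg (η' η : Nuisance p) (z : Σ n : ℕ, Trt n × Cov p n) : 0 ≤ devG η' η z :=
  Finset.sum_nonneg fun _ _ => norm_nonneg _

theorem devPhi_nonneg (η' η : Nuisance p) (z : Σ n : ℕ, Trt n × Cov p n) : 0 ≤ devPhi η' η z :=
  Finset.sum_nonneg fun _ _ => norm_nonneg _

theorem devW_nonneg (η' η : Nuisance p) (z : Σ n : ℕ, Trt n × Cov p n) : 0 ≤ devW η' η z :=
  Finset.sum_nonneg fun _ _ => norm_nonneg _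

theorem remW_nonneg (η' η : Nuisance p) (z : Σ n : ℕ, Trt n × Cov p n) : 0 ≤ remW η' η z :=
  Finset.sum_nonneg fun _ _ => norm_nonneg _

section Measurability

variable {η' η : Nuisance p}

theorem measurable_devH (hη' : η'.IsMeasurable) (hη : η.IsMeasurable) :
    Measurable (devH η' η) :=
  measurable_trt_cov (h := fun n _ x => ∑ a : Trt n, |η'.H n a x - η.H n a x|) fun n _ =>
    Finset.measurable_sum Finset.univ fun a _ => ((hη'.H n a).sub (hη.H n a)).abs

theorem measurable_devG (hη' : η'.IsMeasurable) (hη : η.IsMeasurable) :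
    Measurable (devG η' η) :=
  measurable_trt_cov (h := fun n _ x => ∑ a : Trt n, ‖η'.G n a x - η.G n a x‖) fun n _ =>
    Finset.measurable_sum Finset.univ fun a _ => ((hη'.G n a).sub (hη.G n a)).norm

theorem measurable_devPhi (hη' : η'.IsMeasurable) (hη : η.IsMeasurable) :
    Measurable (devPhi η' η) :=
  measurable_trt_cov (h := fun n a' x => ∑ a : Trt n, ‖η'.phi n a' x a - η.phi n a' x a‖)
    fun n a' => Finset.measurable_sum Finset.univ fun a _ =>
      ((hη'.phi n a' a).sub (hη.phi n a' a)).norm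

theorem measurable_devW (hη' : η'.IsMeasurable) (hη : η.IsMeasurable) :
    Measurable (devW η' η) :=
  measurable_trt_cov (h := fun n _ x => ∑ a : Trt n, ‖η'.w n a x - η.w n a x‖) fun n _ =>
    Finset.measurable_sum Finset.univ fun a _ => ((hη'.w n a).sub (hη.w n a)).norm

theorem measurable_remW (hη' : η'.IsMeasurable) (hη : η.IsMeasurable) :
    Measurable (remW η' η) :=
  measurable_trt_cov (h := fun n _ x => ∑ a : Trt n, ‖(η'.w n a x - η.w n a x)
      + ∑ a' : Trt n, η.H n a' x • η'.phi n a' x a‖) fun n _ =>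
    Finset.measurable_sum Finset.univ fun a _ => (((hη'.w n a).sub (hη.w n a)).add
      (Finset.measurable_fun_sum Finset.univ fun a' _ =>
        (hη.H n a').smul (hη'.phi n a' a))).norm

end Measurability

/-! ### Pointwise bounds -/

/-- The bounds on `H`, `G`, `φ`, `w` at one value of `(X, N)`. -/
def BoundedAt (c C : ℝ) (η : Nuisance p) (o : Cluster p) : Prop :=
  ∀ a a' : Trt (size o),
    η.H (size o) a (covar o) ∈ Set.Ioo c (1 - c) ∧
    ‖η.G (size o) a (covar o)‖ ≤ C ∧
    ‖η.phi (size o) a' (covar o) a‖ ≤ C ∧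
    ‖η.w (size o) a (covar o)‖ ≤ C

section Pointwise

variable {c C : ℝ} {η' η : Nuisance p} {o : Cluster p}

theorem abs_inner_le {n : ℕ} {v w : Vec n} {s t : ℝ} (hv : ‖v‖ ≤ s) (hw : ‖w‖ ≤ t) :
    |inner ℝ v w| ≤ s * t :=
  (abs_real_inner_le_norm v w).trans
    (mul_le_mul hv hw (norm_nonneg _) ((norm_nonneg _).trans hv))

theorem abs_weighted_residual_sub_le {n : ℕ} {c C : ℝ} (hc : 0 < c) {w w' y G G' : Vec n}
    {H H' : ℝ} (hw : ‖w‖ ≤ C) (hG : ‖G‖ ≤ C) (hG' : ‖G'‖ ≤ C) (hH : c < H) (hH' : c < H') :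
    |inner ℝ w' (y - G') / H' - inner ℝ w (y - G) / H|
      ≤ ‖w' - w‖ * ((‖y‖ + C) * c⁻¹) + ‖G' - G‖ * (C * c⁻¹)
        + |H' - H| * (C * (‖y‖ + C) * (c⁻¹ * c⁻¹)) := by
  have h0 : 0 < H := hc.trans hH
  have h0' : 0 < H' := hc.trans hH'
  have hC : 0 ≤ C := (norm_nonneg _).trans hw
  have hi : H⁻¹ ≤ c⁻¹ := inv_anti₀ hc hH.le
  have hi' : H'⁻¹ ≤ c⁻¹ := inv_anti₀ hc hH'.le
  have hi0 : 0 < H⁻¹ := inv_pos.2 h0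
  have hi0' : 0 < H'⁻¹ := inv_pos.2 h0'
  have e : inner ℝ w' (y - G') / H' - inner ℝ w (y - G) / H
      = inner ℝ (w' - w) (y - G') * H'⁻¹ + (-(inner ℝ w (G' - G))) * H'⁻¹
        + (H - H') * inner ℝ w (y - G) * (H⁻¹ * H'⁻¹) := by
    simp only [inner_sub_left, inner_sub_right]
    field_simp
    ring
  have hy : ‖y - G'‖ ≤ ‖y‖ + C := (norm_sub_le _ _).trans (by linarith)
  have hy' : ‖y - G‖ ≤ ‖y‖ + C := (norm_sub_le _ _).trans (by linarith)
  have hyC : 0 ≤ ‖y‖ + C := by positivity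
  have h1 : |inner ℝ (w' - w) (y - G') * H'⁻¹| ≤ ‖w' - w‖ * ((‖y‖ + C) * c⁻¹) := by
    rw [abs_mul, abs_of_pos hi0', ← mul_assoc]
    exact mul_le_mul (abs_inner_le le_rfl hy) hi' hi0'.le (by positivity)
  have h2 : |(-(inner ℝ w (G' - G))) * H'⁻¹| ≤ ‖G' - G‖ * (C * c⁻¹) := by
    rw [abs_mul, abs_neg, abs_of_pos hi0', ← mul_assoc, mul_comm ‖G' - G‖]
    exact mul_le_mul (abs_inner_le hw le_rfl) hi' hi0'.le (by positivity)
  have h3 : |(H - H') * inner ℝ w (y - G) * (H⁻¹ * H'⁻¹)|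
      ≤ |H' - H| * (C * (‖y‖ + C) * (c⁻¹ * c⁻¹)) := by
    rw [abs_mul, abs_mul, abs_of_pos (mul_pos hi0 hi0'), abs_sub_comm, mul_assoc]
    refine mul_le_mul_of_nonneg_left ?_ (abs_nonneg _)
    refine mul_le_mul (abs_inner_le hw hy') (mul_le_mul hi hi' hi0'.le (by positivity))
      (by positivity) (by positivity)
  rw [e]
  exact (abs_add_le _ _).trans (add_le_add ((abs_add_le _ _).trans (add_le_add h1 h2)) h3)

theorem abs_inner_sub_inner_le {n : ℕ} {C : ℝ} {w w' f f' G G' : Vec n}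
    (hw : ‖w‖ ≤ C) (hf : ‖f‖ ≤ C) (hG' : ‖G'‖ ≤ C) :
    |inner ℝ (w' + f') G' - inner ℝ (w + f) G|
      ≤ C * ‖w' - w‖ + C * ‖f' - f‖ + 2 * C * ‖G' - G‖ := by
  have e : inner ℝ (w' + f') G' - inner ℝ (w + f) G
      = inner ℝ (w' - w) G' + inner ℝ (f' - f) G' + inner ℝ (w + f) (G' - G) := by
    simp only [inner_sub_left, inner_sub_right, inner_add_left]
    ring
  have h1 : |inner ℝ (w' - w) G'| ≤ C * ‖w' - w‖ := by
    rw [mul_comm]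
    exact abs_inner_le le_rfl hG'
  have h2 : |inner ℝ (f' - f) G'| ≤ C * ‖f' - f‖ := by
    rw [mul_comm]
    exact abs_inner_le le_rfl hG'
  have h3 : |inner ℝ (w + f) (G' - G)| ≤ 2 * C * ‖G' - G‖ :=
    abs_inner_le ((norm_add_le _ _).trans (by linarith)) le_rfl
  rw [e]
  exact (abs_add_le _ _).trans (add_le_add ((abs_add_le _ _).trans (add_le_add h1 h2)) h3)

/-- The uncentered influence function is Lipschitz in the nuisance functions, with a constant
proportional to `1 + ‖Y‖`. -/
theorem abs_uncenteredEIF_sub_le (hc : c ∈ Set.Ioo (0 : ℝ) 1) (hC : 0 < C)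
    (h : BoundedAt c C η o) (h' : BoundedAt c C η' o) :
    |uncenteredEIF η' o - uncenteredEIF η o| ≤ 3 * ((1 + C) ^ 2 * (c⁻¹) ^ 2) * (1 + ‖outcome o‖) *
      (devW η' η (toAXN o) + devPhi η' η (toAXN o) + devG η' η (toAXN o)
        + devH η' η (toAXN o)) := by
  obtain ⟨n, y, t, x⟩ := o
  change ∀ a a' : Trt n, _ at h h'
  have h1 : |∑ a : Trt n, (inner ℝ (η'.w n a x + η'.phi n t x a) (η'.G n a x)
      - inner ℝ (η.w n a x + η.phi n t x a) (η.G n a x))|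
      ≤ C * devW η' η ⟨n, t, x⟩ + C * devPhi η' η ⟨n, t, x⟩ + 2 * C * devG η' η ⟨n, t, x⟩ := by
    simp only [devW, devPhi, devG, Finset.mul_sum, ← Finset.sum_add_distrib]
    refine (Finset.abs_sum_le_sum_abs _ _).trans (Finset.sum_le_sum fun a _ => ?_)
    exact abs_inner_sub_inner_le (h a t).2.2.2 (h a t).2.2.1 (h' a t).2.1
  have h2 := abs_weighted_residual_sub_le (c := c) (C := C) (w := η.w n t x) (w' := η'.w n t x)
    (y := y) (G := η.G n t x) (G' := η'.G n t x) (H := η.H n t x) (H' := η'.H n t x)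
    hc.1 (h t t).2.2.2 (h t t).2.1 (h' t t).2.1 (h t t).1.1 (h' t t).1.1
  have hW : ‖η'.w n t x - η.w n t x‖ ≤ devW η' η ⟨n, t, x⟩ :=
    Finset.single_le_sum (f := fun a : Trt n => ‖η'.w n a x - η.w n a x‖)
      (fun _ _ => norm_nonneg _) (Finset.mem_univ t)
  have hG : ‖η'.G n t x - η.G n t x‖ ≤ devG η' η ⟨n, t, x⟩ :=
    Finset.single_le_sum (f := fun a : Trt n => ‖η'.G n a x - η.G n a x‖)
      (fun _ _ => norm_nonneg _) (Finset.mem_univ t)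
  have hH : |η'.H n t x - η.H n t x| ≤ devH η' η ⟨n, t, x⟩ :=
    Finset.single_le_sum (f := fun a : Trt n => |η'.H n a x - η.H n a x|)
      (fun _ _ => abs_nonneg _) (Finset.mem_univ t)
  have hPhi0 := devPhi_nonneg η' η ⟨n, t, x⟩
  have hW0 := devW_nonneg η' η ⟨n, t, x⟩
  have hG0 := devG_nonneg η' η ⟨n, t, x⟩
  have hH0 := devH_nonneg η' η ⟨n, t, x⟩
  have e : uncenteredEIF η' ⟨n, y, t, x⟩ - uncenteredEIF η ⟨n, y, t, x⟩
      = ∑ a : Trt n, (inner ℝ (η'.w n a x + η'.phi n t x a) (η'.G n a x)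
          - inner ℝ (η.w n a x + η.phi n t x a) (η.G n a x))
        + (inner ℝ (η'.w n t x) (y - η'.G n t x) / η'.H n t x
          - inner ℝ (η.w n t x) (y - η.G n t x) / η.H n t x) := by
    rw [Finset.sum_sub_distrib]
    simp only [uncenteredEIF]
    ring
  rw [e]
  refine (abs_add_le _ _).trans ((add_le_add h1 h2).trans ?_)
  change _ ≤ 3 * ((1 + C) ^ 2 * (c⁻¹) ^ 2) * (1 + ‖y‖) *
      (devW η' η ⟨n, t, x⟩ + devPhi η' η ⟨n, t, x⟩ + devG η' η ⟨n, t, x⟩ + devH η' η ⟨n, t, x⟩)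
  have he : 1 ≤ c⁻¹ := (one_le_inv₀ hc.1).2 hc.2.le
  have hee : c⁻¹ ≤ c⁻¹ ^ 2 := by nlinarith
  have hy := norm_nonneg y
  generalize ‖y‖ = Y at *
  generalize c⁻¹ = e at *
  set Q := (1 + C) ^ 2 * e ^ 2 * (1 + Y) with hQ
  have hCY : (Y + C) ≤ (1 + C) ^ 2 * (1 + Y) := by
    nlinarith [mul_nonneg hC.le hy, sq_nonneg C, mul_nonneg (sq_nonneg C) hy]
  have hCC : C * (Y + C) ≤ (1 + C) ^ 2 * (1 + Y) := by
    nlinarith [mul_nonneg hC.le hy, sq_nonneg C, mul_nonneg (sq_nonneg C) hy]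
  have hC1 : C ≤ (1 + C) ^ 2 * (1 + Y) := by
    nlinarith [mul_nonneg hC.le hy, sq_nonneg C, mul_nonneg (sq_nonneg C) hy]
  have hP : 0 ≤ (1 + C) ^ 2 * (1 + Y) := by positivity
  have q1 : C ≤ Q := by
    calc C ≤ (1 + C) ^ 2 * (1 + Y) * 1 := by simpa using hC1
      _ ≤ (1 + C) ^ 2 * (1 + Y) * e ^ 2 := by gcongr; nlinarith
      _ = Q := by rw [hQ]; ring
  have q2 : (Y + C) * e ≤ Q := by
    calc (Y + C) * e ≤ (1 + C) ^ 2 * (1 + Y) * e ^ 2 :=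
          mul_le_mul hCY hee (by linarith) hP
      _ = Q := by rw [hQ]; ring
  have q3 : C * e ≤ Q := by
    calc C * e ≤ (1 + C) ^ 2 * (1 + Y) * e ^ 2 := mul_le_mul hC1 hee (by linarith) hP
      _ = Q := by rw [hQ]; ring
  have q4 : C * (Y + C) * (e * e) ≤ Q := by
    calc C * (Y + C) * (e * e) ≤ (1 + C) ^ 2 * (1 + Y) * (e * e) := by gcongr
      _ = Q := by rw [hQ]; ring
  have hQ0 : 0 ≤ Q := hC.le.trans q1
  have t1 := mul_le_mul hW q2 (by positivity) hW0
  have t2 := mul_le_mul hG q3 (by positivity) hG0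
  have t3 := mul_le_mul hH q4 (by positivity) hH0
  have t4 := mul_le_mul_of_nonneg_right q1 hW0
  have t5 := mul_le_mul_of_nonneg_right q1 hPhi0
  have t6 := mul_le_mul_of_nonneg_right q1 hG0
  have e2 : 3 * ((1 + C) ^ 2 * e ^ 2) * (1 + Y) = 3 * Q := by rw [hQ]; ring
  rw [e2]
  nlinarith [mul_nonneg hQ0 hW0, mul_nonneg hQ0 hPhi0, mul_nonneg hQ0 hG0, mul_nonneg hQ0 hH0]

end Pointwise

/-! ### Bounds in `L₂(P)` -/

section L2

variable {P : Measure (Cluster p)}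

theorem sq_normL2 (f : Cluster p → ℝ) : normL2 P f ^ 2 = ∫ o, f o ^ 2 ∂P :=
  Real.sq_sqrt (integral_nonneg fun _ => sq_nonneg _)

theorem normL2_nonneg (f : Cluster p → ℝ) : 0 ≤ normL2 P f := Real.sqrt_nonneg _

theorem integral_mul_le_normL2 {f g : Cluster p → ℝ} (hf0 : ∀ o, 0 ≤ f o) (hg0 : ∀ o, 0 ≤ g o)
    (hf : MemLp f 2 P) (hg : MemLp g 2 P) :
    ∫ o, f o * g o ∂P ≤ normL2 P f * normL2 P g := by
  have h := integral_mul_le_Lp_mul_Lq_of_nonneg (μ := P) Real.HolderConjugate.two_two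
    (Eventually.of_forall hf0) (Eventually.of_forall hg0) (by simpa using hf) (by simpa using hg)
  simpa [normL2, Real.sqrt_eq_rpow] using h

theorem integral_le_normL2 [IsProbabilityMeasure P] {f : Cluster p → ℝ} (hf0 : ∀ o, 0 ≤ f o)
    (hf : MemLp f 2 P) : ∫ o, f o ∂P ≤ normL2 P f := by
  have h := integral_mul_le_normL2 (P := P) (g := fun _ => 1) hf0 (fun _ => zero_le_one) hf
    (memLp_const 1)
  simpa [normL2] using h

theorem normL2_le_of_bound [IsProbabilityMeasure P] {f : Cluster p → ℝ} {B : ℝ} (hB0 : 0 ≤ B)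
    (hf : MemLp f 2 P) (hB : ∀ᵐ o ∂P, |f o| ≤ B) : normL2 P f ≤ B := by
  refine Real.sqrt_le_iff.2 ⟨hB0, ?_⟩
  have h : ∫ o, f o ^ 2 ∂P ≤ ∫ _, B ^ 2 ∂P := by
    refine integral_mono_ae hf.integrable_sq (integrable_const _) ?_
    filter_upwards [hB] with o ho
    exact sq_le_sq.2 (by rwa [abs_of_nonneg hB0])
  simpa using h

end L2

theorem sum_trt_le {n N : ℕ} (h : n ≤ N) {f : Trt n → ℝ} {B : ℝ} (hB : 0 ≤ B)
    (hf : ∀ a, f a ≤ B) : ∑ a, f a ≤ 2 ^ N * B := by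
  refine (Finset.sum_le_sum fun a _ => hf a).trans ?_
  simp only [Finset.sum_const, Finset.card_univ, Fintype.card_fun, Fintype.card_bool,
    Fintype.card_fin, nsmul_eq_mul, Nat.cast_pow, Nat.cast_ofNat]
  gcongr
  norm_num

/-- The assumptions on the law of one cluster and on the true nuisance functions. The efficient
influence function of the weight enters only through its conditional mean `0` given `(X, N)`. -/
structure RegularModel (P : Measure (Cluster p)) (η : Nuisance p) (c C : ℝ) : Prop where
  finite_size : FiniteClusterSize P
  moments : FiniteMoments P
  meas : η.IsMeasurable
  regression : IsOutcomeRegression P η.G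
  propensity : IsTreatmentProb P η.H
  phi_mean_zero : ∀ᵐ o ∂P, ∀ a : Trt (size o),
    ∑ a' : Trt (size o), η.H (size o) a' (covar o) • η.phi (size o) a' (covar o) a = 0
  c_mem : c ∈ Set.Ioo (0 : ℝ) 1
  C_pos : 0 < C
  bdd : IsBoundedBy P c C η

section Deviation

variable {P : Measure (Cluster p)} {η η' : Nuisance p} {c C : ℝ}

theorem memLp_comp_toAXN [IsProbabilityMeasure P] {h : (Σ n : ℕ, Trt n × Cov p n) → ℝ}
    (hh : Measurable h) (h0 : ∀ z, 0 ≤ h z) {B : ℝ} (hB : ∀ᵐ o ∂P, h (toAXN o) ≤ B) :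
    MemLp (fun o : Cluster p => h (toAXN o)) 2 P := by
  refine MemLp.of_bound (hh.comp measurable_toAXN).aestronglyMeasurable B ?_
  filter_upwards [hB] with o ho
  rwa [Real.norm_of_nonneg (h0 _)]

/-- The deviations of bounded nuisance functions are bounded, uniformly in the estimates. -/
theorem exists_dev_le (hsize : FiniteClusterSize P) (hc : 0 < c) (hC : 0 < C)
    (hη : IsBoundedBy P c C η) :
    ∃ B : ℝ, 0 ≤ B ∧ ∀ η' : Nuisance p, IsBoundedBy P c C η' → ∀ᵐ o ∂P,
      devH η' η (toAXN o) ≤ B ∧ devG η' η (toAXN o) ≤ B ∧ devPhi η' η (toAXN o) ≤ B ∧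
      devW η' η (toAXN o) ≤ B ∧ remW η' η (toAXN o) ≤ B ∧
      ∀ a, devPhi η' η ⟨size o, a, covar o⟩ ≤ B := by
  obtain ⟨N, hN⟩ := hsize
  refine ⟨2 ^ N * (1 + 2 * C + 2 ^ N * C), by positivity, fun η' hη' => ?_⟩
  filter_upwards [hN, hη, hη'] with o hn h h'
  have hp : 0 ≤ 2 ^ N * C := by positivity
  have hphi : ∀ a, devPhi η' η ⟨size o, a, covar o⟩ ≤ 2 ^ N * (1 + 2 * C + 2 ^ N * C) :=
    fun a' => sum_trt_le hn (by positivity) fun a => by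
      have h1 := (h a a').2.2.1
      have h2 := (h' a a').2.2.1
      exact (norm_sub_le _ _).trans (by linarith)
  refine ⟨?_, ?_, hphi (treat o), ?_, ?_, hphi⟩
  · refine sum_trt_le hn (by positivity) fun a => ?_
    obtain ⟨h1, h2⟩ := (h a a).1
    obtain ⟨h3, h4⟩ := (h' a a).1
    refine abs_le.2 ⟨?_, ?_⟩ <;> simp only [toAXN] <;> linarith
  · refine sum_trt_le hn (by positivity) fun a => ?_
    exact (norm_sub_le _ _).trans ((add_le_add (h' a a).2.1 (h a a).2.1).trans (by linarith))
  · refine sum_trt_le hn (by positivity) fun a => ?_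
    exact (norm_sub_le _ _).trans
      ((add_le_add (h' a a).2.2.2 (h a a).2.2.2).trans (by linarith))
  · refine sum_trt_le hn (by positivity) fun a => ?_
    have h1 := (h a a).2.2.2
    have h2 := (h' a a).2.2.2
    have h3 : ‖∑ a' : Trt (size o), η.H (size o) a' (covar o) • η'.phi (size o) a' (covar o) a‖
        ≤ 2 ^ N * C := by
      refine (norm_sum_le _ _).trans (sum_trt_le hn hC.le fun a' => ?_)
      obtain ⟨h4, h5⟩ := (h a' a').1
      rw [norm_smul, Real.norm_of_nonneg (hc.trans h4).le]
      have h6 := (h' a a').2.2.1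
      nlinarith [norm_nonneg (η'.phi (size o) a' (covar o) a)]
    exact (norm_add_le _ _).trans ((add_le_add ((norm_sub_le _ _).trans
      (add_le_add h2 h1)) h3).trans (by linarith))

/-- The deviation of the weight is the remainder minus the conditional mean of the deviation of its
influence function, since the true influence function has conditional mean zero. -/
theorem devW_le {o : Cluster p} (hH : ∀ a, 0 ≤ η.H (size o) a (covar o))
    (h0 : ∀ a : Trt (size o),
      ∑ a' : Trt (size o), η.H (size o) a' (covar o) • η.phi (size o) a' (covar o) a = 0) :
    devW η' η (toAXN o) ≤ remW η' η (toAXN o) +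
      ∑ a' : Trt (size o), η.H (size o) a' (covar o) * devPhi η' η ⟨size o, a', covar o⟩ := by
  obtain ⟨n, y, t, x⟩ := o
  change ∑ a : Trt n, ‖η'.w n a x - η.w n a x‖ ≤ ∑ a : Trt n, ‖(η'.w n a x - η.w n a x)
      + ∑ a' : Trt n, η.H n a' x • η'.phi n a' x a‖
      + ∑ a' : Trt n, η.H n a' x * ∑ a : Trt n, ‖η'.phi n a' x a - η.phi n a' x a‖
  simp only [Finset.mul_sum]
  rw [Finset.sum_comm, ← Finset.sum_add_distrib]
  refine Finset.sum_le_sum fun a _ => ?_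
  have e : η'.w n a x - η.w n a x = (η'.w n a x - η.w n a x
      + ∑ a' : Trt n, η.H n a' x • η'.phi n a' x a)
      - ∑ a' : Trt n, η.H n a' x • (η'.phi n a' x a - η.phi n a' x a) := by
    have h1 : ∑ a' : Trt n, η.H n a' x • η.phi n a' x a = 0 := h0 a
    simp only [smul_sub, Finset.sum_sub_distrib, h1]
    abel
  calc ‖η'.w n a x - η.w n a x‖ ≤ ‖(η'.w n a x - η.w n a x
      + ∑ a' : Trt n, η.H n a' x • η'.phi n a' x a)‖
      + ‖∑ a' : Trt n, η.H n a' x • (η'.phi n a' x a - η.phi n a' x a)‖ := by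
        conv_lhs => rw [e]
        exact norm_sub_le _ _
    _ ≤ _ := by
        refine add_le_add le_rfl ((norm_sum_le _ _).trans (Finset.sum_le_sum fun a' _ => ?_))
        rw [norm_smul, Real.norm_of_nonneg (hH a')]

theorem two_mul_sq_add_le {L x y : ℝ} (hL : 1 ≤ L) (hx : 0 ≤ x) (hy : 0 ≤ y) :
    2 * x ^ 2 + 2 * L * y ^ 2 ≤ (2 * L * (x + y)) ^ 2 := by
  have h1 : L ≤ L ^ 2 := by nlinarith
  have h2 := mul_le_mul_of_nonneg_right (hL.trans h1) (sq_nonneg x)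
  have h3 := mul_le_mul_of_nonneg_right h1 (sq_nonneg y)
  have h4 : 0 ≤ L ^ 2 * (x * y) := by positivity
  have h5 : 0 ≤ L ^ 2 * x ^ 2 := by positivity
  have h6 : 0 ≤ L ^ 2 * y ^ 2 := by positivity
  linarith

/-- Consistency of the weight estimate follows from the rates of the remainder and of its influence
function; no separate rate for `ŵ - w` is assumed. -/
theorem exists_normL2_devW_le [IsProbabilityMeasure P] (hM : RegularModel P η c C) :
    ∃ M : ℝ, 0 ≤ M ∧ ∀ η' : Nuisance p, η'.IsMeasurable → IsBoundedBy P c C η' →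
      normL2 P (fun o => devW η' η (toAXN o)) ≤ M * (errW P η' η + errPhi P η' η) := by
  obtain ⟨B, hB0, hB⟩ := exists_dev_le hM.finite_size hM.c_mem.1 hM.C_pos hM.bdd
  obtain ⟨N, hN⟩ := hM.finite_size
  have hH1 := hM.bdd.abs_H_le_one hM.c_mem.1
  refine ⟨2 * 2 ^ N, by positivity, fun η' hη' hb' => ?_⟩
  have hd := hB η' hb'
  have hmR := measurable_remW hη' hM.meas
  have hmP := measurable_devPhi hη' hM.meas
  have hmW := measurable_devW hη' hM.meas
  have hR : MemLp (fun o : Cluster p => remW η' η (toAXN o)) 2 P :=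
    memLp_comp_toAXN hmR (remW_nonneg _ _) (hd.mono fun o ho => ho.2.2.2.2.1)
  have hPh : MemLp (fun o : Cluster p => devPhi η' η (toAXN o)) 2 P :=
    memLp_comp_toAXN hmP (devPhi_nonneg _ _) (hd.mono fun o ho => ho.2.2.1)
  have hW : MemLp (fun o : Cluster p => devW η' η (toAXN o)) 2 P :=
    memLp_comp_toAXN hmW (devW_nonneg _ _) (hd.mono fun o ho => ho.2.2.2.1)
  have eW : errW P η' η = normL2 P fun o => remW η' η (toAXN o) := rfl
  have eP : errPhi P η' η = normL2 P fun o => devPhi η' η (toAXN o) := rfl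
  have hswap := integral_treat_eq_integral_sum hM.finite_size hM.meas.H hM.propensity hH1
    (h := fun n a x => devPhi η' η ⟨n, a, x⟩ ^ 2) (B := B ^ 2)
    (fun n a => (hmP.comp ((measurable_sigma_mk (β := fun n => Trt n × Cov p n) n).comp
      measurable_prodMk_left)).pow_const 2) (by
      filter_upwards [hd] with o ho a
      rw [abs_of_nonneg (sq_nonneg _)]
      exact pow_le_pow_left₀ (devPhi_nonneg _ _ _) (ho.2.2.2.2.2 a) 2)
  let S : Cluster p → ℝ := fun o => ∑ a : Trt (size o),
    η.H (size o) a (covar o) * devPhi η' η ⟨size o, a, covar o⟩ ^ 2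
  have hSm : Measurable S := by
    have : Measurable fun z : (Σ n : ℕ, Cov p n) => ∑ a : Trt z.1,
        η.H z.1 a z.2 * devPhi η' η ⟨z.1, a, z.2⟩ ^ 2 := measurable_sigma_of fun n =>
      Finset.measurable_sum Finset.univ fun a _ => (hM.meas.H n a).mul
        ((hmP.comp ((measurable_sigma_mk (β := fun n => Trt n × Cov p n) n).comp
          measurable_prodMk_left)).pow_const 2)
    exact this.comp measurable_toXN
  have hswap' : ∫ o, devPhi η' η (toAXN o) ^ 2 ∂P = ∫ o, S o ∂P := hswap
  have hSi : Integrable S P := by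
    refine Integrable.of_bound hSm.aestronglyMeasurable (2 ^ N * B ^ 2) ?_
    filter_upwards [hN, hd, hH1] with o hn ho h1
    refine (norm_sum_le _ _).trans (sum_trt_le hn (by positivity) fun a => ?_)
    have h2 := pow_le_pow_left₀ (devPhi_nonneg _ _ _) (ho.2.2.2.2.2 a) 2
    rw [norm_mul, Real.norm_eq_abs, Real.norm_of_nonneg (sq_nonneg _)]
    have h3 := h1 a
    nlinarith [sq_nonneg (devPhi η' η ⟨size o, a, covar o⟩)]
  have hpt : ∀ᵐ o ∂P, devW η' η (toAXN o) ^ 2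
      ≤ 2 * remW η' η (toAXN o) ^ 2 + 2 * 2 ^ N * S o := by
    filter_upwards [hN, hM.bdd, hM.phi_mean_zero, hH1] with o hn hb h0 h1
    have hH0 : ∀ a, 0 ≤ η.H (size o) a (covar o) := fun a => (hM.c_mem.1.trans (hb a a).1.1).le
    have h2 := devW_le (η' := η') hH0 h0
    have hcs := sq_sum_le_card_mul_sum_sq (s := (Finset.univ : Finset (Trt (size o))))
      (f := fun a => η.H (size o) a (covar o) * devPhi η' η ⟨size o, a, covar o⟩)
    have h3 : ∑ a : Trt (size o), (η.H (size o) a (covar o) *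
        devPhi η' η ⟨size o, a, covar o⟩) ^ 2 ≤ S o := by
      refine Finset.sum_le_sum fun a _ => ?_
      rw [mul_pow]
      refine mul_le_mul_of_nonneg_right ?_ (sq_nonneg _)
      have := (abs_le.1 (h1 a)).2
      nlinarith [hH0 a]
    have h4 : ((Finset.univ : Finset (Trt (size o))).card : ℝ) ≤ 2 ^ N := by
      have := sum_trt_le hn (f := fun _ => (1 : ℝ)) zero_le_one fun _ => le_rfl
      simpa using this
    have h5 : (0 : ℝ) ≤ ∑ a : Trt (size o), (η.H (size o) a (covar o) *
        devPhi η' η ⟨size o, a, covar o⟩) ^ 2 := Finset.sum_nonneg fun _ _ => sq_nonneg _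
    have h6 := hcs.trans (mul_le_mul h4 h3 h5 (by positivity))
    have h7 := pow_le_pow_left₀ (devW_nonneg _ _ _) h2 2
    refine h7.trans ?_
    have h8 := add_sq_le (a := remW η' η (toAXN o)) (b := ∑ a : Trt (size o),
      η.H (size o) a (covar o) * devPhi η' η ⟨size o, a, covar o⟩)
    linarith
  have hint : ∫ o, devW η' η (toAXN o) ^ 2 ∂P
      ≤ 2 * errW P η' η ^ 2 + 2 * 2 ^ N * errPhi P η' η ^ 2 := by
    rw [eW, eP, sq_normL2, sq_normL2]
    refine (integral_mono_ae hW.integrable_sq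
      ((hR.integrable_sq.const_mul 2).add (hSi.const_mul (2 * 2 ^ N))) hpt).trans ?_
    rw [integral_add' (hR.integrable_sq.const_mul 2) (hSi.const_mul (2 * 2 ^ N)),
      integral_const_mul, integral_const_mul]
    rw [hswap']
  exact Real.sqrt_le_iff.2 ⟨mul_nonneg (by positivity)
    (add_nonneg (normL2_nonneg _) (normL2_nonneg _)), hint.trans
      (two_mul_sq_add_le (one_le_pow₀ one_le_two) (normL2_nonneg _) (normL2_nonneg _))⟩

end Deviation

/-! ### Mean square error and conditional bias of the influence function -/

section Bias

variable {P : Measure (Cluster p)} [IsProbabilityMeasure P] {η η' : Nuisance p} {c C : ℝ}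

theorem memLp_norm_outcome (hsize : FiniteClusterSize P) (hmom : FiniteMoments P) :
    MemLp (fun o : Cluster p => ‖outcome o‖) 2 P := by
  obtain ⟨M, _, hM⟩ := exists_integral_mul_norm_outcome_sq_le hsize hmom
  have h := (hM (fun _ => 1) 1 measurable_const (fun _ => zero_le_one)
    (Eventually.of_forall fun _ => le_rfl)).1
  rw [memLp_two_iff_integrable_sq measurable_norm_outcome.aestronglyMeasurable]
  simpa using h

theorem abs_uncenteredEIF_le (hc : 0 < c) (hC : 0 < C) {N : ℕ} {o : Cluster p} (hn : size o ≤ N)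
    (hb : BoundedAt c C η o) :
    |uncenteredEIF η o| ≤ 2 ^ N * (2 * C * C) + C * (‖outcome o‖ + C) * c⁻¹ := by
  obtain ⟨n, y, t, x⟩ := o
  change |∑ a : Trt n, inner ℝ (η.w n a x + η.phi n t x a) (η.G n a x)
    + inner ℝ (η.w n t x) (y - η.G n t x) / η.H n t x|
    ≤ 2 ^ N * (2 * C * C) + C * (‖y‖ + C) * c⁻¹
  refine (abs_add_le _ _).trans (add_le_add ?_ ?_)
  · refine (Finset.abs_sum_le_sum_abs _ _).trans (sum_trt_le hn (by positivity) fun a => ?_)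
    exact abs_inner_le ((norm_add_le _ _).trans ((add_le_add (hb a t).2.2.2
      (hb a t).2.2.1).trans (by linarith))) (hb a a).2.1
  · obtain ⟨⟨h1, -⟩, h2, -, h3⟩ := hb t t
    have h4 : 0 < η.H n t x := hc.trans h1
    rw [div_eq_mul_inv, abs_mul, abs_of_pos (inv_pos.2 h4)]
    exact mul_le_mul (abs_inner_le h3 ((norm_sub_le _ _).trans (add_le_add le_rfl h2)))
      (inv_anti₀ hc h1.le) (inv_pos.2 h4).le (by positivity)

theorem RegularModel.memLp_uncenteredEIF (hM : RegularModel P η c C) (hη' : η'.IsMeasurable)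
    (hb' : IsBoundedBy P c C η') : MemLp (uncenteredEIF η') 2 P := by
  have hY := memLp_norm_outcome hM.finite_size hM.moments
  obtain ⟨N, hN⟩ := hM.finite_size
  have hg : MemLp (fun o : Cluster p => 2 ^ N * (2 * C * C) + C * (‖outcome o‖ + C) * c⁻¹) 2 P := by
    have h := ((hY.add (memLp_const C)).const_mul C).mul_const c⁻¹
    exact (memLp_const (2 ^ N * (2 * C * C))).add h
  refine hg.mono' (measurable_uncenteredEIF hη').aestronglyMeasurable ?_
  filter_upwards [hN, hb'] with o hn hb
  exact abs_uncenteredEIF_le hM.c_mem.1 hM.C_pos hn hb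

/-- The estimated influence function is close to the true one in mean square when the nuisance
estimates are close to the truth. -/
theorem RegularModel.exists_integral_sub_sq_le (hM : RegularModel P η c C) :
    ∃ M : ℝ, 0 ≤ M ∧ ∀ η' : Nuisance p, η'.IsMeasurable → IsBoundedBy P c C η' →
      ∫ o, (uncenteredEIF η' o - uncenteredEIF η o) ^ 2 ∂P
        ≤ M * (errW P η' η + errPhi P η' η + errG P η' η + errH P η' η) ^ 2 := by
  obtain ⟨M₁, hM₁0, hM₁⟩ := exists_integral_mul_norm_outcome_sq_le hM.finite_size hM.moments
  obtain ⟨M₂, hM₂0, hM₂⟩ := exists_normL2_devW_le hM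
  obtain ⟨B, hB0, hB⟩ := exists_dev_le hM.finite_size hM.c_mem.1 hM.C_pos hM.bdd
  set K : ℝ := 3 * ((1 + C) ^ 2 * (c⁻¹) ^ 2) with hK
  refine ⟨8 * K ^ 2 * (1 + M₁) * (M₂ ^ 2 + 1), by positivity, fun η' hη' hb' => ?_⟩
  have hd := hB η' hb'
  let D : (Σ n : ℕ, Trt n × Cov p n) → ℝ := fun z =>
    devW η' η z ^ 2 + devPhi η' η z ^ 2 + devG η' η z ^ 2 + devH η' η z ^ 2
  have hW : MemLp (fun o : Cluster p => devW η' η (toAXN o)) 2 P :=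
    memLp_comp_toAXN (measurable_devW hη' hM.meas) (devW_nonneg _ _)
      (hd.mono fun o ho => ho.2.2.2.1)
  have hPh : MemLp (fun o : Cluster p => devPhi η' η (toAXN o)) 2 P :=
    memLp_comp_toAXN (measurable_devPhi hη' hM.meas) (devPhi_nonneg _ _)
      (hd.mono fun o ho => ho.2.2.1)
  have hG : MemLp (fun o : Cluster p => devG η' η (toAXN o)) 2 P :=
    memLp_comp_toAXN (measurable_devG hη' hM.meas) (devG_nonneg _ _) (hd.mono fun o ho => ho.2.1)
  have hH : MemLp (fun o : Cluster p => devH η' η (toAXN o)) 2 P :=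
    memLp_comp_toAXN (measurable_devH hη' hM.meas) (devH_nonneg _ _) (hd.mono fun o ho => ho.1)
  have hDm : Measurable D :=
    ((((measurable_devW hη' hM.meas).pow_const 2).add
      ((measurable_devPhi hη' hM.meas).pow_const 2)).add
      ((measurable_devG hη' hM.meas).pow_const 2)).add ((measurable_devH hη' hM.meas).pow_const 2)
  have hD0 : ∀ z, 0 ≤ D z := fun z => by positivity
  have hDB : ∀ᵐ o ∂P, D (toAXN o) ≤ 4 * B ^ 2 := by
    filter_upwards [hd] with o ho
    have h1 := pow_le_pow_left₀ (devW_nonneg _ _ _) ho.2.2.2.1 2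
    have h2 := pow_le_pow_left₀ (devPhi_nonneg _ _ _) ho.2.2.1 2
    have h3 := pow_le_pow_left₀ (devG_nonneg _ _ _) ho.2.1 2
    have h4 := pow_le_pow_left₀ (devH_nonneg _ _ _) ho.1 2
    simp only [D]
    linarith
  obtain ⟨hi, hle⟩ := hM₁ D _ hDm hD0 hDB
  have hi₂ : Integrable (fun o : Cluster p =>
      devW η' η (toAXN o) ^ 2 + devPhi η' η (toAXN o) ^ 2) P :=
    hW.integrable_sq.add hPh.integrable_sq
  have hi₃ : Integrable (fun o : Cluster p => devW η' η (toAXN o) ^ 2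
      + devPhi η' η (toAXN o) ^ 2 + devG η' η (toAXN o) ^ 2) P := hi₂.add hG.integrable_sq
  have hDi : Integrable (fun o : Cluster p => D (toAXN o)) P := hi₃.add hH.integrable_sq
  have hDint : ∫ o, D (toAXN o) ∂P = normL2 P (fun o => devW η' η (toAXN o)) ^ 2
      + errPhi P η' η ^ 2 + errG P η' η ^ 2 + errH P η' η ^ 2 := by
    have e1 : errPhi P η' η ^ 2 = ∫ o, devPhi η' η (toAXN o) ^ 2 ∂P := sq_normL2 _
    have e2 : errG P η' η ^ 2 = ∫ o, devG η' η (toAXN o) ^ 2 ∂P := sq_normL2 _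
    have e3 : errH P η' η ^ 2 = ∫ o, devH η' η (toAXN o) ^ 2 ∂P := sq_normL2 _
    rw [sq_normL2, e1, e2, e3, ← integral_add hW.integrable_sq hPh.integrable_sq,
      ← integral_add hi₂ hG.integrable_sq, ← integral_add hi₃ hH.integrable_sq]
  have hpt : ∀ᵐ o ∂P, (uncenteredEIF η' o - uncenteredEIF η o) ^ 2
      ≤ 8 * K ^ 2 * (D (toAXN o) + D (toAXN o) * ‖outcome o‖ ^ 2) := by
    filter_upwards [hM.bdd, hb'] with o h h'
    have h1 := abs_uncenteredEIF_sub_le hM.c_mem hM.C_pos h h'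
    rw [← hK] at h1
    rw [← sq_abs]
    refine (pow_le_pow_left₀ (abs_nonneg _) h1 2).trans ?_
    have h2 : (1 + ‖outcome o‖) ^ 2 ≤ 2 * (1 + ‖outcome o‖ ^ 2) := by
      nlinarith [sq_nonneg (1 - ‖outcome o‖)]
    have h3 : (devW η' η (toAXN o) + devPhi η' η (toAXN o) + devG η' η (toAXN o)
        + devH η' η (toAXN o)) ^ 2 ≤ 4 * D (toAXN o) := by
      simp only [D]
      generalize devW η' η (toAXN o) = x
      generalize devPhi η' η (toAXN o) = y
      generalize devG η' η (toAXN o) = z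
      generalize devH η' η (toAXN o) = t
      nlinarith [sq_nonneg (x - y), sq_nonneg (x - z), sq_nonneg (x - t), sq_nonneg (y - z),
        sq_nonneg (y - t), sq_nonneg (z - t)]
    rw [mul_pow, mul_pow]
    calc K ^ 2 * (1 + ‖outcome o‖) ^ 2 * _
        ≤ K ^ 2 * (2 * (1 + ‖outcome o‖ ^ 2)) * (4 * D (toAXN o)) := by gcongr
      _ = _ := by ring
  have hsub : MemLp (fun o => uncenteredEIF η' o - uncenteredEIF η o) 2 P :=
    (hM.memLp_uncenteredEIF hη' hb').sub (hM.memLp_uncenteredEIF hM.meas hM.bdd)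
  have h1 := integral_mono_ae hsub.integrable_sq ((hDi.add hi).const_mul (8 * K ^ 2)) hpt
  rw [integral_const_mul, integral_add' hDi hi] at h1
  have h2 := hM₂ η' hη' hb'
  have h3 := pow_le_pow_left₀ (normL2_nonneg _) h2 2
  have hW0 : 0 ≤ errW P η' η := normL2_nonneg _
  have hP0 : 0 ≤ errPhi P η' η := normL2_nonneg _
  have hG0 : 0 ≤ errG P η' η := normL2_nonneg _
  have hH0 : 0 ≤ errH P η' η := normL2_nonneg _
  have h4 : ∫ o, D (toAXN o) ∂P
      ≤ (M₂ ^ 2 + 1) * (errW P η' η + errPhi P η' η + errG P η' η + errH P η' η) ^ 2 := by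
    rw [hDint]
    rw [mul_pow] at h3
    generalize errW P η' η = x at *
    generalize errPhi P η' η = y at *
    generalize errG P η' η = z at *
    generalize errH P η' η = t at *
    have h5 : (x + y) ^ 2 ≤ (x + y + z + t) ^ 2 :=
      pow_le_pow_left₀ (by positivity) (by linarith) 2
    have h6 : y ^ 2 + z ^ 2 + t ^ 2 ≤ (x + y + z + t) ^ 2 := by
      nlinarith [mul_nonneg hW0 hP0, mul_nonneg hW0 hG0, mul_nonneg hW0 hH0, mul_nonneg hP0 hG0,
        mul_nonneg hP0 hH0, mul_nonneg hG0 hH0, sq_nonneg x]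
    have h7 := mul_le_mul_of_nonneg_left h5 (sq_nonneg M₂)
    linarith
  have hD0' : 0 ≤ ∫ o, D (toAXN o) ∂P := integral_nonneg fun o => hD0 _
  calc ∫ o, (uncenteredEIF η' o - uncenteredEIF η o) ^ 2 ∂P
      ≤ 8 * K ^ 2 * ((1 + M₁) * ∫ o, D (toAXN o) ∂P) := by
        refine h1.trans ?_
        gcongr
        linarith
    _ ≤ 8 * K ^ 2 * ((1 + M₁) * ((M₂ ^ 2 + 1) *
        (errW P η' η + errPhi P η' η + errG P η' η + errH P η' η) ^ 2)) := by gcongr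
    _ = _ := by ring

/-- The second-order expansion behind double robustness, for the summand of one treatment vector:
primes mark the estimates, and `f` stands for `∑_{a'} φ̂(a') H(a')`. -/
theorem abs_bias_summand_le {n : ℕ} {c C : ℝ} (hc : 0 < c) {w w' f G G' : Vec n} {H H' : ℝ}
    (hw' : ‖w'‖ ≤ C) (hG' : ‖G'‖ ≤ C) (hH' : c < H') :
    |inner ℝ w' G' + inner ℝ f G' + H * (inner ℝ w' (G - G') / H') - inner ℝ w G|
      ≤ C * ‖w' - w + f‖ + ‖G' - G‖ * ‖w' - w‖ + C * c⁻¹ * (‖G' - G‖ * |H' - H|) := by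
  have h0' : 0 < H' := hc.trans hH'
  have hC : 0 ≤ C := (norm_nonneg _).trans hw'
  have hi' : H'⁻¹ ≤ c⁻¹ := inv_anti₀ hc hH'.le
  have hi0' : 0 < H'⁻¹ := inv_pos.2 h0'
  have e : inner ℝ w' G' + inner ℝ f G' + H * (inner ℝ w' (G - G') / H') - inner ℝ w G
      = inner ℝ (w' - w + f) G' + -(inner ℝ (G' - G) (w' - w))
        + (H' - H) * (inner ℝ w' (G' - G) * H'⁻¹) := by
    rw [real_inner_comm (w' - w) (G' - G)]
    simp only [inner_sub_left, inner_sub_right, inner_add_left]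
    field_simp
    ring
  have h1 : |inner ℝ (w' - w + f) G'| ≤ C * ‖w' - w + f‖ := by
    rw [mul_comm]
    exact abs_inner_le le_rfl hG'
  have h2 : |(-(inner ℝ (G' - G) (w' - w)) : ℝ)| ≤ ‖G' - G‖ * ‖w' - w‖ := by
    rw [abs_neg]
    exact abs_inner_le le_rfl le_rfl
  have h3 : |(H' - H) * (inner ℝ w' (G' - G) * H'⁻¹)|
      ≤ C * c⁻¹ * (‖G' - G‖ * |H' - H|) := by
    rw [abs_mul, abs_mul, abs_of_pos hi0']
    calc |H' - H| * (|inner ℝ w' (G' - G)| * H'⁻¹)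
        ≤ |H' - H| * (C * ‖G' - G‖ * c⁻¹) := by
          gcongr
          exact abs_inner_le hw' le_rfl
      _ = _ := by ring
  rw [e]
  exact (abs_add_le _ _).trans (add_le_add ((abs_add_le _ _).trans (add_le_add h1 h2)) h3)

theorem sum_mul_le_sum_mul_sum {ι : Type*} (s : Finset ι) {f g : ι → ℝ} (hf : ∀ i, 0 ≤ f i)
    (hg : ∀ i, 0 ≤ g i) : ∑ i ∈ s, f i * g i ≤ (∑ i ∈ s, f i) * ∑ i ∈ s, g i := by
  rw [Finset.sum_mul]
  exact Finset.sum_le_sum fun i hi => mul_le_mul_of_nonneg_left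
    (Finset.single_le_sum (fun j _ => hg j) hi) (hf i)

/-- The conditional mean of the estimated influence function given `(X, N)`, minus the integrand of
the estimand, is of second order. -/
theorem abs_condMean_sub_le (hc : 0 < c) {o : Cluster p} (hb' : BoundedAt c C η' o) :
    |∑ a : Trt (size o), inner ℝ (η'.w (size o) a (covar o)) (η'.G (size o) a (covar o))
      + ∑ a' : Trt (size o), η.H (size o) a' (covar o) *
        (∑ a : Trt (size o), inner ℝ (η'.phi (size o) a' (covar o) a) (η'.G (size o) a (covar o))
          + inner ℝ (η'.w (size o) a' (covar o))
            (η.G (size o) a' (covar o) - η'.G (size o) a' (covar o)) / η'.H (size o) a' (covar o))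
      - ∑ a : Trt (size o), inner ℝ (η.w (size o) a (covar o)) (η.G (size o) a (covar o))|
    ≤ C * remW η' η (toAXN o) + devG η' η (toAXN o) * devW η' η (toAXN o)
      + C * c⁻¹ * (devG η' η (toAXN o) * devH η' η (toAXN o)) := by
  obtain ⟨n, y, t, x⟩ := o
  change |∑ a : Trt n, inner ℝ (η'.w n a x) (η'.G n a x)
      + ∑ a' : Trt n, η.H n a' x * (∑ a : Trt n, inner ℝ (η'.phi n a' x a) (η'.G n a x)
          + inner ℝ (η'.w n a' x) (η.G n a' x - η'.G n a' x) / η'.H n a' x)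
      - ∑ a : Trt n, inner ℝ (η.w n a x) (η.G n a x)|
    ≤ C * (∑ a : Trt n, ‖(η'.w n a x - η.w n a x) + ∑ a' : Trt n, η.H n a' x • η'.phi n a' x a‖)
      + (∑ a : Trt n, ‖η'.G n a x - η.G n a x‖) * (∑ a : Trt n, ‖η'.w n a x - η.w n a x‖)
      + C * c⁻¹ * ((∑ a : Trt n, ‖η'.G n a x - η.G n a x‖)
        * ∑ a : Trt n, |η'.H n a x - η.H n a x|)
  have hb : ∀ a : Trt n, c < η'.H n a x ∧ ‖η'.G n a x‖ ≤ C ∧ ‖η'.w n a x‖ ≤ C := fun a =>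
    ⟨(hb' a a).1.1, (hb' a a).2.1, (hb' a a).2.2.2⟩
  have hC : 0 ≤ C := (norm_nonneg _).trans (hb t).2.1
  have hcc : 0 ≤ C * c⁻¹ := mul_nonneg hC (inv_pos.2 hc).le
  have e : ∑ a : Trt n, inner ℝ (η'.w n a x) (η'.G n a x)
      + ∑ a' : Trt n, η.H n a' x * (∑ a : Trt n, inner ℝ (η'.phi n a' x a) (η'.G n a x)
          + inner ℝ (η'.w n a' x) (η.G n a' x - η'.G n a' x) / η'.H n a' x)
      - ∑ a : Trt n, inner ℝ (η.w n a x) (η.G n a x)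
      = ∑ a : Trt n, (inner ℝ (η'.w n a x) (η'.G n a x)
        + inner ℝ (∑ a' : Trt n, η.H n a' x • η'.phi n a' x a) (η'.G n a x)
        + η.H n a x * (inner ℝ (η'.w n a x) (η.G n a x - η'.G n a x) / η'.H n a x)
        - inner ℝ (η.w n a x) (η.G n a x)) := by
    have e1 : ∑ a : Trt n, inner ℝ (∑ a' : Trt n, η.H n a' x • η'.phi n a' x a) (η'.G n a x)
        = ∑ a' : Trt n, η.H n a' x * ∑ a : Trt n, inner ℝ (η'.phi n a' x a) (η'.G n a x) := by
      simp only [sum_inner, inner_smul_left, Finset.mul_sum]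
      rw [Finset.sum_comm]
      simp
    simp only [mul_add, Finset.sum_add_distrib, Finset.sum_sub_distrib]
    rw [e1]
    ring
  rw [e]
  refine (Finset.abs_sum_le_sum_abs _ _).trans ((Finset.sum_le_sum fun a _ =>
    abs_bias_summand_le hc (hb a).2.2 (hb a).2.1 (hb a).1).trans ?_)
  rw [Finset.sum_add_distrib, Finset.sum_add_distrib, ← Finset.mul_sum, ← Finset.mul_sum]
  gcongr
  · exact sum_mul_le_sum_mul_sum _ (fun _ => norm_nonneg _) fun _ => norm_nonneg _
  · exact sum_mul_le_sum_mul_sum _ (fun _ => norm_nonneg _) fun _ => abs_nonneg _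

end Bias

/-! ### Bias of the estimated influence function -/

section Mean

variable {P : Measure (Cluster p)} [IsProbabilityMeasure P] {η η' : Nuisance p} {c C : ℝ}

theorem measurable_sum_inner_trt {v w : VecFn p} (hv : ∀ n a, Measurable (v n a))
    (hw : ∀ n a, Measurable (w n a)) :
    Measurable fun o : Cluster p => ∑ a : Trt (size o),
      (inner ℝ (v (size o) a (covar o)) (w (size o) a (covar o)) : ℝ) := by
  have h : Measurable fun z : (Σ n : ℕ, Cov p n) =>
      ∑ a : Trt z.1, (inner ℝ (v z.1 a z.2) (w z.1 a z.2) : ℝ) := measurable_sigma_of fun n =>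
    Finset.measurable_sum Finset.univ fun a _ => Measurable.inner (𝕜 := ℝ) (hv n a) (hw n a)
  exact h.comp measurable_toXN

theorem measurable_sum_mul_trt {H h : ∀ n : ℕ, Trt n → Cov p n → ℝ}
    (hH : ∀ n a, Measurable (H n a)) (hh : ∀ n a, Measurable (h n a)) :
    Measurable fun o : Cluster p => ∑ a : Trt (size o),
      H (size o) a (covar o) * h (size o) a (covar o) := by
  have h : Measurable fun z : (Σ n : ℕ, Cov p n) => ∑ a : Trt z.1, H z.1 a z.2 * h z.1 a z.2 :=
    measurable_sigma_of fun n =>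
      Finset.measurable_sum Finset.univ fun a _ => (hH n a).mul (hh n a)
  exact h.comp measurable_toXN

/-- The part of the influence function which depends on the treatment received, with `Y` replaced
by its conditional mean. -/
def treatPart (η' η : Nuisance p) (n : ℕ) (a' : Trt n) (x : Cov p n) : ℝ :=
  ∑ a : Trt n, inner ℝ (η'.phi n a' x a) (η'.G n a x)
    + inner ℝ (η'.w n a' x) (η.G n a' x - η'.G n a' x) / η'.H n a' x

theorem measurable_treatPart (hη' : η'.IsMeasurable) (hη : η.IsMeasurable) (n : ℕ)
    (a' : Trt n) : Measurable (treatPart η' η n a') := by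
  have h1 : Measurable fun x => ∑ a : Trt n, (inner ℝ (η'.phi n a' x a) (η'.G n a x) : ℝ) :=
    Finset.measurable_sum Finset.univ fun a _ =>
      Measurable.inner (𝕜 := ℝ) (hη'.phi n a' a) (hη'.G n a)
  have h2 : Measurable fun x =>
      (inner ℝ (η'.w n a' x) (η.G n a' x - η'.G n a' x) : ℝ) / η'.H n a' x :=
    (Measurable.inner (𝕜 := ℝ) (hη'.w n a') ((hη.G n a').sub (hη'.G n a'))).div (hη'.H n a')
  exact h1.add h2

theorem abs_treatPart_le (hc : 0 < c) (hC : 0 < C) {N : ℕ} {o : Cluster p} (hn : size o ≤ N)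
    (hb : BoundedAt c C η o) (hb' : BoundedAt c C η' o) (a' : Trt (size o)) :
    |treatPart η' η (size o) a' (covar o)| ≤ 2 ^ N * (C * C) + C * (C + C) * c⁻¹ := by
  refine (abs_add_le _ _).trans (add_le_add ?_ ?_)
  · refine (Finset.abs_sum_le_sum_abs _ _).trans (sum_trt_le hn (by positivity) fun a => ?_)
    exact abs_inner_le (hb' a a').2.2.1 (hb' a a).2.1
  · obtain ⟨⟨h1, -⟩, h2, -, h3⟩ := hb' a' a'
    have h4 : 0 < η'.H (size o) a' (covar o) := hc.trans h1
    rw [div_eq_mul_inv, abs_mul, abs_of_pos (inv_pos.2 h4)]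
    exact mul_le_mul (abs_inner_le h3 ((norm_sub_le _ _).trans (add_le_add (hb a' a').2.1 h2)))
      (inv_anti₀ hc h1.le) (inv_pos.2 h4).le (by positivity)

/-- The estimated influence function as the sum of a function of `(X, N)`, a function of `(A, X, N)`
and a term linear in the residual `Y - G(A, X, N)`, which has conditional mean zero. -/
theorem uncenteredEIF_eq (o : Cluster p) :
    uncenteredEIF η' o =
      ∑ a : Trt (size o), inner ℝ (η'.w (size o) a (covar o)) (η'.G (size o) a (covar o))
      + treatPart η' η (size o) (treat o) (covar o)
      + inner ℝ ((η'.H (size o) (treat o) (covar o))⁻¹ • η'.w (size o) (treat o) (covar o))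
        (outcome o - η.G (size o) (treat o) (covar o)) := by
  simp only [uncenteredEIF, treatPart, inner_add_left, Finset.sum_add_distrib, real_inner_smul_left,
    inner_sub_right]
  ring

/-- The mean of the estimated influence function is the mean of its conditional mean given
`(X, N)`. -/
theorem RegularModel.integral_uncenteredEIF_sub_estimand (hM : RegularModel P η c C)
    (hη' : η'.IsMeasurable) (hb' : IsBoundedBy P c C η') :
    ∫ o, uncenteredEIF η' o ∂P - estimand P η = ∫ o,
      (∑ a : Trt (size o), inner ℝ (η'.w (size o) a (covar o)) (η'.G (size o) a (covar o))
      + ∑ a' : Trt (size o), η.H (size o) a' (covar o) * treatPart η' η (size o) a' (covar o)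
      - ∑ a : Trt (size o), inner ℝ (η.w (size o) a (covar o)) (η.G (size o) a (covar o))) ∂P := by
  have hc := hM.c_mem.1
  have hC := hM.C_pos
  have hH1 := hM.bdd.abs_H_le_one hc
  obtain ⟨N, hN⟩ := hM.finite_size
  have bound : ∀ η₀ : Nuisance p, η₀.IsMeasurable → IsBoundedBy P c C η₀ →
      Integrable (fun o : Cluster p => ∑ a : Trt (size o),
        (inner ℝ (η₀.w (size o) a (covar o)) (η₀.G (size o) a (covar o)) : ℝ)) P := by
    intro η₀ hη₀ hb₀
    refine Integrable.of_bound (measurable_sum_inner_trt hη₀.w hη₀.G).aestronglyMeasurable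
      (2 ^ N * (C * C)) ?_
    filter_upwards [hN, hb₀] with o hn hb
    refine (norm_sum_le _ _).trans (sum_trt_le hn (by positivity) fun a => ?_)
    exact abs_inner_le (hb a a).2.2.2 (hb a a).2.1
  have i1 := bound η' hη' hb'
  have i0 := bound η hM.meas hM.bdd
  have hB : ∀ᵐ o ∂P, ∀ a : Trt (size o), |treatPart η' η (size o) a (covar o)|
      ≤ 2 ^ N * (C * C) + C * (C + C) * c⁻¹ := by
    filter_upwards [hN, hM.bdd, hb'] with o hn hb hb'
    exact abs_treatPart_le hc hC hn hb hb'
  have hm := measurable_treatPart hη' hM.meas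
  have hcp := inv_pos.2 hc
  have i2 : Integrable (fun o : Cluster p => treatPart η' η (size o) (treat o) (covar o)) P := by
    refine Integrable.of_bound ((measurable_trt_cov hm).comp
      measurable_toAXN).aestronglyMeasurable (2 ^ N * (C * C) + C * (C + C) * c⁻¹) ?_
    filter_upwards [hB] with o ho using ho _
  have i3 : Integrable (fun o : Cluster p => ∑ a' : Trt (size o),
      η.H (size o) a' (covar o) * treatPart η' η (size o) a' (covar o)) P := by
    refine Integrable.of_bound (measurable_sum_mul_trt hM.meas.H hm).aestronglyMeasurable
      (2 ^ N * (2 ^ N * (C * C) + C * (C + C) * c⁻¹)) ?_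
    filter_upwards [hN, hB, hH1] with o hn ho h1
    refine (norm_sum_le _ _).trans (sum_trt_le hn (by positivity) fun a => ?_)
    rw [norm_mul, Real.norm_eq_abs, Real.norm_eq_abs]
    exact (mul_le_mul (h1 a) (ho a) (abs_nonneg _) zero_le_one).trans_eq (one_mul _)
  obtain ⟨i4, h4⟩ := integral_inner_residual hM.finite_size hM.regression
    (v := fun n a x => (η'.H n a x)⁻¹ • η'.w n a x) (B := c⁻¹ * C)
    (fun n a => (hη'.H n a).inv.smul (hη'.w n a)) (by
      filter_upwards [hb'] with o hb
      obtain ⟨⟨h1, -⟩, -, -, h3⟩ := hb (treat o) (treat o)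
      have h4 := inv_pos.2 (hc.trans h1)
      rw [norm_smul, Real.norm_of_nonneg h4.le]
      exact mul_le_mul (inv_anti₀ hc h1.le) h3 (norm_nonneg _) hcp.le)
  have h2 := integral_treat_eq_integral_sum hM.finite_size hM.meas.H hM.propensity hH1 hm hB
  have i12 : Integrable (fun o : Cluster p =>
      ∑ a : Trt (size o), (inner ℝ (η'.w (size o) a (covar o)) (η'.G (size o) a (covar o)) : ℝ)
      + treatPart η' η (size o) (treat o) (covar o)) P := i1.add i2
  have i13 : Integrable (fun o : Cluster p =>
      ∑ a : Trt (size o), (inner ℝ (η'.w (size o) a (covar o)) (η'.G (size o) a (covar o)) : ℝ)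
      + ∑ a' : Trt (size o), η.H (size o) a' (covar o)
        * treatPart η' η (size o) a' (covar o)) P := i1.add i3
  rw [integral_congr_ae (Eventually.of_forall (uncenteredEIF_eq (η' := η') (η := η))),
    integral_add i12 i4, h4, integral_add i1 i2, h2, integral_sub i13 i0, integral_add i1 i3,
    add_zero]
  rfl

/-- Double robustness: the bias of the estimated influence function is of second order in the
errors of the nuisance estimates. -/
theorem RegularModel.exists_abs_mean_sub_le (hM : RegularModel P η c C) :
    ∃ M : ℝ, 0 ≤ M ∧ ∀ η' : Nuisance p, η'.IsMeasurable → IsBoundedBy P c C η' →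
      |∫ o, uncenteredEIF η' o ∂P - estimand P η|
        ≤ M * (errW P η' η + errG P η' η * (errH P η' η + errPhi P η' η)) := by
  obtain ⟨M₂, hM₂0, hM₂⟩ := exists_normL2_devW_le hM
  obtain ⟨B, hB0, hB⟩ := exists_dev_le hM.finite_size hM.c_mem.1 hM.C_pos hM.bdd
  have hc := hM.c_mem.1
  have hC := hM.C_pos
  have hcp := inv_pos.2 hc
  refine ⟨C + M₂ * B + M₂ + C * c⁻¹, by positivity, fun η' hη' hb' => ?_⟩
  have hd := hB η' hb'
  have hR : MemLp (fun o : Cluster p => remW η' η (toAXN o)) 2 P :=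
    memLp_comp_toAXN (measurable_remW hη' hM.meas) (remW_nonneg _ _)
      (hd.mono fun o ho => ho.2.2.2.2.1)
  have hW : MemLp (fun o : Cluster p => devW η' η (toAXN o)) 2 P :=
    memLp_comp_toAXN (measurable_devW hη' hM.meas) (devW_nonneg _ _)
      (hd.mono fun o ho => ho.2.2.2.1)
  have hG : MemLp (fun o : Cluster p => devG η' η (toAXN o)) 2 P :=
    memLp_comp_toAXN (measurable_devG hη' hM.meas) (devG_nonneg _ _) (hd.mono fun o ho => ho.2.1)
  have hH : MemLp (fun o : Cluster p => devH η' η (toAXN o)) 2 P :=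
    memLp_comp_toAXN (measurable_devH hη' hM.meas) (devH_nonneg _ _) (hd.mono fun o ho => ho.1)
  have i1 : Integrable (fun o : Cluster p => C * remW η' η (toAXN o)) P :=
    (hR.integrable one_le_two).const_mul C
  have i2 : Integrable (fun o : Cluster p => devG η' η (toAXN o) * devW η' η (toAXN o)) P :=
    hG.integrable_mul hW
  have i3 : Integrable (fun o : Cluster p =>
      C * c⁻¹ * (devG η' η (toAXN o) * devH η' η (toAXN o))) P :=
    (hG.integrable_mul hH).const_mul (C * c⁻¹)
  have i12 : Integrable (fun o : Cluster p =>
      C * remW η' η (toAXN o) + devG η' η (toAXN o) * devW η' η (toAXN o)) P := i1.add i2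
  have h1 : ∫ o, remW η' η (toAXN o) ∂P ≤ errW P η' η :=
    integral_le_normL2 (fun o => remW_nonneg _ _ _) hR
  have h2 : ∫ o, devG η' η (toAXN o) * devW η' η (toAXN o) ∂P
      ≤ errG P η' η * normL2 P (fun o => devW η' η (toAXN o)) :=
    integral_mul_le_normL2 (fun o => devG_nonneg _ _ _) (fun o => devW_nonneg _ _ _) hG hW
  have h3 : ∫ o, devG η' η (toAXN o) * devH η' η (toAXN o) ∂P ≤ errG P η' η * errH P η' η :=
    integral_mul_le_normL2 (fun o => devG_nonneg _ _ _) (fun o => devH_nonneg _ _ _) hG hH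
  have h4 : errG P η' η ≤ B := normL2_le_of_bound hB0 hG (hd.mono fun o ho => by
    have h5 := ho.2.1
    have h6 := devG_nonneg η' η (toAXN o)
    exact (abs_of_nonneg h6).trans_le h5)
  rw [hM.integral_uncenteredEIF_sub_estimand hη' hb']
  have h5 : ∀ᵐ o ∂P, ‖∑ a : Trt (size o),
      inner ℝ (η'.w (size o) a (covar o)) (η'.G (size o) a (covar o))
      + ∑ a' : Trt (size o), η.H (size o) a' (covar o) * treatPart η' η (size o) a' (covar o)
      - ∑ a : Trt (size o), inner ℝ (η.w (size o) a (covar o)) (η.G (size o) a (covar o))‖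
      ≤ C * remW η' η (toAXN o) + devG η' η (toAXN o) * devW η' η (toAXN o)
        + C * c⁻¹ * (devG η' η (toAXN o) * devH η' η (toAXN o)) := by
    filter_upwards [hb'] with o ho
    exact abs_condMean_sub_le hc ho
  refine (norm_integral_le_of_norm_le (i12.add i3) h5).trans ?_
  rw [integral_add' i12 i3, integral_add i1 i2, integral_const_mul, integral_const_mul]
  have h6 := hM₂ η' hη' hb'
  have hW0 : 0 ≤ errW P η' η := normL2_nonneg _
  have hP0 : 0 ≤ errPhi P η' η := normL2_nonneg _
  have hG0 : 0 ≤ errG P η' η := normL2_nonneg _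
  have hH0 : 0 ≤ errH P η' η := normL2_nonneg _
  have hcc : 0 ≤ C * c⁻¹ := by positivity
  calc _ ≤ C * errW P η' η + errG P η' η * (M₂ * (errW P η' η + errPhi P η' η))
        + C * c⁻¹ * (errG P η' η * errH P η' η) := by
        refine add_le_add (add_le_add (mul_le_mul_of_nonneg_left h1 hC.le)
          (h2.trans (mul_le_mul_of_nonneg_left h6 hG0))) (mul_le_mul_of_nonneg_left h3 hcc)
    _ ≤ _ := by
        generalize errW P η' η = x at *
        generalize errPhi P η' η = y at *
        generalize errG P η' η = z at *
        generalize errH P η' η = t at *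
        have e1 : z * (M₂ * (x + y)) = M₂ * (z * x) + M₂ * (z * y) := by ring
        have e2 : M₂ * (z * x) ≤ M₂ * B * x := by
          rw [mul_assoc]
          gcongr
        have e3 : 0 ≤ (C * c⁻¹) * (z * y) := by positivity
        have e4 : 0 ≤ C * (z * (t + y)) := by positivity
        have e5 : 0 ≤ M₂ * B * (z * (t + y)) := by positivity
        have e6 : 0 ≤ M₂ * (z * t) := by positivity
        have e7 : 0 ≤ M₂ * x := by positivity
        have e8 : 0 ≤ C * c⁻¹ * x := by positivity
        nlinarith

/-- The influence function at the true nuisance functions is unbiased for the estimand. -/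
theorem RegularModel.integral_uncenteredEIF (hM : RegularModel P η c C) :
    ∫ o, uncenteredEIF η o ∂P = estimand P η := by
  obtain ⟨M, _, h⟩ := hM.exists_abs_mean_sub_le
  have h1 := h η hM.meas hM.bdd
  have hG : errG P η η = 0 := by simp [errG, normL2]
  have hW : errW P η η = 0 := by
    have e : (fun o => (∑ a : Trt (size o),
        ‖(η.w (size o) a (covar o) - η.w (size o) a (covar o)) + ∑ a' : Trt (size o),
          η.H (size o) a' (covar o) • η.phi (size o) a' (covar o) a‖) ^ 2) =ᵐ[P] fun _ => 0 := by
      filter_upwards [hM.phi_mean_zero] with o ho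
      simp [ho]
    rw [errW, normL2, integral_congr_ae e]
    simp
  rw [hG, hW, zero_mul, add_zero, mul_zero] at h1
  exact sub_eq_zero.1 (abs_nonpos_iff.1 h1)

end Mean

/-! ### Convergence and boundedness in probability -/

section InProbability

variable {Ω : Type*} [MeasurableSpace Ω] {μ : Measure Ω} {X Y : ℕ → Ω → ℝ} {a b : ℝ}

theorem tendstoInMeasure_const_iff :
    TendstoInMeasure μ X atTop (fun _ => a) ↔
      ∀ ε : ℝ, 0 < ε → Tendsto (fun m => μ {ω | ε ≤ |X m ω - a|}) atTop (𝓝 0) := by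
  simp only [tendstoInMeasure_iff_norm, Real.norm_eq_abs]

theorem tendstoInMeasure_of_abs_sub_le (hY : TendstoInMeasure μ Y atTop fun _ => 0)
    (h : ∀ᶠ m in atTop, ∀ᵐ ω ∂μ, |X m ω - a| ≤ |Y m ω|) :
    TendstoInMeasure μ X atTop fun _ => a := by
  rw [tendstoInMeasure_const_iff] at hY ⊢
  intro ε hε
  refine tendsto_of_tendsto_of_tendsto_of_le_of_le' tendsto_const_nhds (hY ε hε)
    (Eventually.of_forall fun _ => zero_le) ?_
  filter_upwards [h] with m hm
  refine measure_mono_ae ?_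
  filter_upwards [hm] with ω hω h1
  change ε ≤ |Y m ω - 0|
  rw [sub_zero]
  exact le_trans h1 hω

/-- Continuous mapping at a constant limit. -/
theorem TendstoInMeasure.comp_continuousAt₂ {g : ℝ × ℝ → ℝ}
    (hX : TendstoInMeasure μ X atTop fun _ => a) (hY : TendstoInMeasure μ Y atTop fun _ => b)
    (hg : ContinuousAt g (a, b)) :
    TendstoInMeasure μ (fun m ω => g (X m ω, Y m ω)) atTop fun _ => g (a, b) := by
  rw [tendstoInMeasure_const_iff] at hX hY ⊢
  intro ε hε
  obtain ⟨δ, hδ, h⟩ := Metric.continuousAt_iff.1 hg ε hε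
  refine tendsto_of_tendsto_of_tendsto_of_le_of_le tendsto_const_nhds
    (by simpa using (hX δ hδ).add (hY δ hδ)) (fun _ => zero_le) fun m => ?_
  refine (measure_mono fun ω hω => ?_).trans (measure_union_le _ _)
  by_contra hn
  simp only [Set.mem_union, Set.mem_ofPred_eq, not_or, not_le] at hn
  have h1 : dist (X m ω, Y m ω) (a, b) < δ := by
    rw [Prod.dist_eq, max_lt_iff]
    exact hn
  exact absurd hω (not_le.2 (h h1))

theorem TendstoInMeasure.comp_continuousAt {g : ℝ → ℝ}
    (hX : TendstoInMeasure μ X atTop fun _ => a) (hg : ContinuousAt g a) :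
    TendstoInMeasure μ (fun m ω => g (X m ω)) atTop fun _ => g a :=
  TendstoInMeasure.comp_continuousAt₂ (g := fun z => g z.1) hX hX
    (ContinuousAt.comp (f := Prod.fst) (x := (a, a)) hg continuousAt_fst)

theorem TendstoInMeasure.add_const_limits (hX : TendstoInMeasure μ X atTop fun _ => a)
    (hY : TendstoInMeasure μ Y atTop fun _ => b) :
    TendstoInMeasure μ (fun m ω => X m ω + Y m ω) atTop fun _ => a + b :=
  TendstoInMeasure.comp_continuousAt₂ (g := fun z => z.1 + z.2) hX hY (by fun_prop)

theorem TendstoInMeasure.mul_const_limits (hX : TendstoInMeasure μ X atTop fun _ => a)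
    (hY : TendstoInMeasure μ Y atTop fun _ => b) :
    TendstoInMeasure μ (fun m ω => X m ω * Y m ω) atTop fun _ => a * b :=
  TendstoInMeasure.comp_continuousAt₂ (g := fun z => z.1 * z.2) hX hY (by fun_prop)

theorem tendstoInMeasure_const (μ : Measure Ω) (a : ℝ) :
    TendstoInMeasure μ (fun (_ : ℕ) _ => a) atTop fun _ => a := by
  rw [tendstoInMeasure_const_iff]
  intro ε hε
  simp [not_le.2 hε]

theorem tendstoInMeasure_sum_zero {ι : Type*} (s : Finset ι) {X : ι → ℕ → Ω → ℝ}
    (hX : ∀ i ∈ s, TendstoInMeasure μ (X i) atTop fun _ => 0) :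
    TendstoInMeasure μ (fun m ω => ∑ i ∈ s, X i m ω) atTop fun _ => 0 := by
  classical
  induction s using Finset.induction_on with
  | empty => simpa using tendstoInMeasure_const μ 0
  | insert i s hi ih =>
    have h := TendstoInMeasure.add_const_limits (hX i (Finset.mem_insert_self i s))
      (ih fun j hj => hX j (Finset.mem_insert_of_mem hj))
    simpa [Finset.sum_insert hi] using h

theorem IsBigOP.exists_nonneg {r : ℕ → ℝ} (hX : IsBigOP μ X r) (hr : ∀ m, 0 ≤ r m) {ε : ℝ}
    (hε : 0 < ε) :
    ∃ M : ℝ, 0 ≤ M ∧ ∀ᶠ m in atTop, μ {ω | M * r m < |X m ω|} ≤ ENNReal.ofReal ε := by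
  obtain ⟨M, hM⟩ := hX ε hε
  refine ⟨max M 0, le_max_right _ _, hM.mono fun m hm => (measure_mono fun ω hω => ?_).trans hm⟩
  exact lt_of_le_of_lt (mul_le_mul_of_nonneg_right (le_max_left _ _) (hr m)) hω

theorem IsBigOP.add {r s : ℕ → ℝ} (hX : IsBigOP μ X r) (hY : IsBigOP μ Y s)
    (hr : ∀ m, 0 ≤ r m) (hs : ∀ m, 0 ≤ s m) :
    IsBigOP μ (fun m ω => X m ω + Y m ω) fun m => r m + s m := by
  intro ε hε
  obtain ⟨M, hM0, hM⟩ := hX.exists_nonneg hr (half_pos hε)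
  obtain ⟨N, hN0, hN⟩ := hY.exists_nonneg hs (half_pos hε)
  refine ⟨M + N, ?_⟩
  filter_upwards [hM, hN] with m hm hn
  calc μ {ω | (M + N) * (r m + s m) < |X m ω + Y m ω|}
      ≤ μ ({ω | M * r m < |X m ω|} ∪ {ω | N * s m < |Y m ω|}) := by
        refine measure_mono fun ω hω => ?_
        by_contra h
        simp only [Set.mem_union, Set.mem_ofPred_eq, not_or, not_lt] at h
        have h1 : (M + N) * (r m + s m) < |X m ω + Y m ω| := hω
        have h2 := abs_add_le (X m ω) (Y m ω)
        have h3 := mul_nonneg hM0 (hs m)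
        have h4 := mul_nonneg hN0 (hr m)
        linarith [h.1, h.2]
    _ ≤ ENNReal.ofReal (ε / 2) + ENNReal.ofReal (ε / 2) :=
        (measure_union_le _ _).trans (add_le_add hm hn)
    _ = ENNReal.ofReal ε := by
        rw [← ENNReal.ofReal_add (half_pos hε).le (half_pos hε).le, add_halves]

theorem IsBigOP.mul {r s : ℕ → ℝ} (hX : IsBigOP μ X r) (hY : IsBigOP μ Y s)
    (hr : ∀ m, 0 ≤ r m) (hs : ∀ m, 0 ≤ s m) :
    IsBigOP μ (fun m ω => X m ω * Y m ω) fun m => r m * s m := by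
  intro ε hε
  obtain ⟨M, hM0, hM⟩ := hX.exists_nonneg hr (half_pos hε)
  obtain ⟨N, hN0, hN⟩ := hY.exists_nonneg hs (half_pos hε)
  refine ⟨M * N, ?_⟩
  filter_upwards [hM, hN] with m hm hn
  calc μ {ω | M * N * (r m * s m) < |X m ω * Y m ω|}
      ≤ μ ({ω | M * r m < |X m ω|} ∪ {ω | N * s m < |Y m ω|}) := by
        refine measure_mono fun ω hω => ?_
        by_contra h
        simp only [Set.mem_union, Set.mem_ofPred_eq, not_or, not_lt] at h
        have h1 : M * N * (r m * s m) < |X m ω * Y m ω| := hω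
        rw [abs_mul] at h1
        have h2 := mul_le_mul h.1 h.2 (abs_nonneg _) (mul_nonneg hM0 (hr m))
        linarith
    _ ≤ ENNReal.ofReal (ε / 2) + ENNReal.ofReal (ε / 2) :=
        (measure_union_le _ _).trans (add_le_add hm hn)
    _ = ENNReal.ofReal ε := by
        rw [← ENNReal.ofReal_add (half_pos hε).le (half_pos hε).le, add_halves]

theorem IsBigOP.tendstoInMeasure {r s : ℕ → ℝ} (hX : IsBigOP μ X r) (hs : ∀ m, 0 ≤ s m)
    (h : Tendsto (fun m => s m * r m) atTop (𝓝 0)) :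
    TendstoInMeasure μ (fun m ω => s m * X m ω) atTop fun _ => 0 := by
  rw [tendstoInMeasure_const_iff]
  intro ε hε
  rw [ENNReal.tendsto_nhds_zero]
  intro δ hδ
  obtain ⟨δ', -, hδ0, hδ'⟩ := ENNReal.lt_iff_exists_real_btwn.1 hδ
  have hδ1 : 0 < δ' := by simpa using hδ0
  obtain ⟨M, hM⟩ := hX δ' hδ1
  have h1 : Tendsto (fun m => M * (s m * r m)) atTop (𝓝 0) := by simpa using h.const_mul M
  filter_upwards [hM, h1.eventually_lt_const hε] with m hm h2
  refine (measure_mono fun ω hω => ?_).trans (hm.trans hδ'.le)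
  have h3 : ε ≤ |s m * X m ω - 0| := hω
  rw [sub_zero, abs_mul, abs_of_nonneg (hs m)] at h3
  by_contra h4
  simp only [Set.mem_ofPred_eq, not_lt] at h4
  have h5 := mul_le_mul_of_nonneg_left h4 (hs m)
  have h6 : s m * (M * r m) = M * (s m * r m) := by ring
  linarith

theorem TendstoInMeasure.mul_isBigOP_one (hX : TendstoInMeasure μ X atTop fun _ => 0)
    (hY : IsBigOP μ Y fun _ => 1) :
    TendstoInMeasure μ (fun m ω => X m ω * Y m ω) atTop fun _ => 0 := by
  rw [tendstoInMeasure_const_iff] at hX ⊢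
  intro ε hε
  rw [ENNReal.tendsto_nhds_zero]
  intro δ hδ
  obtain ⟨δ', -, hδ0, hδ'⟩ := ENNReal.lt_iff_exists_real_btwn.1 hδ
  have hδ1 : 0 < δ' := by simpa using hδ0
  obtain ⟨M, hM0, hM⟩ := hY.exists_nonneg (fun _ => zero_le_one) (half_pos hδ1)
  have h1 := ENNReal.tendsto_nhds_zero.1 (hX (ε / (M + 1)) (by positivity))
    (ENNReal.ofReal (δ' / 2)) (by simpa using half_pos hδ1)
  filter_upwards [hM, h1] with m hm h1
  calc μ {ω | ε ≤ |X m ω * Y m ω - 0|}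
      ≤ μ ({ω | ε / (M + 1) ≤ |X m ω - 0|} ∪ {ω | M * 1 < |Y m ω|}) := by
        refine measure_mono fun ω hω => ?_
        by_contra h
        simp only [Set.mem_union, Set.mem_ofPred_eq, not_or, not_lt, not_le, sub_zero, mul_one] at h
        have h2 : ε ≤ |X m ω * Y m ω - 0| := hω
        rw [sub_zero, abs_mul] at h2
        have h3 : |X m ω| * |Y m ω| ≤ |X m ω| * (M + 1) :=
          mul_le_mul_of_nonneg_left (by linarith [h.2]) (abs_nonneg _)
        have h4 := (lt_div_iff₀ (by positivity)).1 h.1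
        linarith
    _ ≤ ENNReal.ofReal (δ' / 2) + ENNReal.ofReal (δ' / 2) :=
        (measure_union_le _ _).trans (add_le_add h1 hm)
    _ = ENNReal.ofReal δ' := by
        rw [← ENNReal.ofReal_add (half_pos hδ1).le (half_pos hδ1).le, add_halves]
    _ ≤ δ := hδ'.le

/-- A sequence bounded in `L₂` is bounded in probability. -/
theorem isBigOP_one_of_lintegral_sq_le {B : ℝ} (hX : ∀ m, Measurable (X m))
    (h : ∀ m, ∫⁻ ω, ENNReal.ofReal (X m ω ^ 2) ∂μ ≤ ENNReal.ofReal B) :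
    IsBigOP μ X fun _ => 1 := by
  intro ε hε
  have hB : 0 < |B| + 1 := by positivity
  refine ⟨√((|B| + 1) / ε), Eventually.of_forall fun m => ?_⟩
  have hq : 0 < (|B| + 1) / ε := by positivity
  have h1 := mul_meas_ge_le_lintegral₀ (μ := μ)
    (((hX m).pow_const 2).ennreal_ofReal.aemeasurable) (ENNReal.ofReal ((|B| + 1) / ε))
  have h2 : μ {ω | √((|B| + 1) / ε) * 1 < |X m ω|}
      ≤ μ {ω | ENNReal.ofReal ((|B| + 1) / ε) ≤ ENNReal.ofReal (X m ω ^ 2)} := by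
    refine measure_mono fun ω hω => ?_
    have h3 : √((|B| + 1) / ε) * 1 < |X m ω| := hω
    refine ENNReal.ofReal_le_ofReal ?_
    rw [mul_one] at h3
    have h4 := pow_le_pow_left₀ (Real.sqrt_nonneg _) h3.le 2
    rwa [Real.sq_sqrt hq.le, sq_abs] at h4
  have h5 : ENNReal.ofReal ((|B| + 1) / ε) * μ {ω | √((|B| + 1) / ε) * 1 < |X m ω|}
      ≤ ENNReal.ofReal (|B| + 1) :=
    ((mul_le_mul_right h2 _).trans h1).trans
      ((h m).trans (ENNReal.ofReal_le_ofReal (by linarith [le_abs_self B])))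
  have h6 := ENNReal.le_div_iff_mul_le (a := μ {ω | √((|B| + 1) / ε) * 1 < |X m ω|})
    (b := ENNReal.ofReal ((|B| + 1) / ε)) (c := ENNReal.ofReal (|B| + 1))
    (Or.inl (by simpa using hq)) (Or.inl ENNReal.ofReal_ne_top)
  refine (h6.2 (by rwa [mul_comm])).trans_eq ?_
  rw [← ENNReal.ofReal_div_of_pos hq]
  congr 1
  field_simp

/-- If `T_m` has mean at most `δ` on the event `V_m ≤ δ`, for every `δ > 0`, and `V_m → 0` in
probability, then `T_m → 0` in probability. This is how moments given the training data are used
without conditional expectations. -/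
theorem tendsto_measure_of_lintegral_indicator_le {T V : ℕ → Ω → ENNReal}
    (hT : ∀ m, Measurable (T m)) (hVm : ∀ m, Measurable (V m))
    (hV : ∀ δ : ENNReal, 0 < δ → Tendsto (fun m => μ {ω | δ < V m ω}) atTop (𝓝 0))
    (h : ∀ (m : ℕ) (δ : ENNReal), 0 < δ → δ ≠ ⊤ →
      ∫⁻ ω, {ω | V m ω ≤ δ}.indicator (T m) ω ∂μ ≤ δ) {ε : ENNReal} (hε : 0 < ε)
    (hε' : ε ≠ ⊤) :
    Tendsto (fun m => μ {ω | ε ≤ T m ω}) atTop (𝓝 0) := by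
  rw [ENNReal.tendsto_nhds_zero]
  intro τ hτ
  obtain ⟨τ', hτ0, hττ⟩ := exists_between hτ
  have hτt : τ' ≠ ⊤ := (hττ.trans_le le_top).ne
  have hτ2 : 0 < τ' / 2 := ENNReal.half_pos hτ0.ne'
  have hτ2t : τ' / 2 ≠ ⊤ := ENNReal.div_ne_top hτt (by norm_num)
  have hδ : 0 < ε * (τ' / 2) := ENNReal.mul_pos hε.ne' hτ2.ne'
  have hδt : ε * (τ' / 2) ≠ ⊤ := ENNReal.mul_ne_top hε' hτ2t
  filter_upwards [ENNReal.tendsto_nhds_zero.1 (hV _ hδ) _ hτ2] with m hm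
  have h1 := (mul_meas_ge_le_lintegral₀ (μ := μ)
    (((hT m).indicator (measurableSet_le (hVm m) measurable_const)).aemeasurable) ε).trans
    (h m _ hδ hδt)
  have h2 : μ {ω | ε ≤ {ω | V m ω ≤ ε * (τ' / 2)}.indicator (T m) ω} ≤ τ' / 2 :=
    (ENNReal.mul_le_mul_iff_right hε.ne' hε').1 h1
  calc μ {ω | ε ≤ T m ω}
      ≤ μ ({ω | ε * (τ' / 2) < V m ω}
        ∪ {ω | ε ≤ {ω | V m ω ≤ ε * (τ' / 2)}.indicator (T m) ω}) := by
        refine measure_mono fun ω hω => ?_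
        by_cases h3 : ε * (τ' / 2) < V m ω
        · exact Or.inl h3
        · refine Or.inr ?_
          have h4 : ω ∈ {ω | V m ω ≤ ε * (τ' / 2)} := not_lt.1 h3
          simpa [Set.indicator_of_mem h4] using hω
    _ ≤ τ' / 2 + τ' / 2 := (measure_union_le _ _).trans (add_le_add hm h2)
    _ = τ' := ENNReal.add_halves _
    _ ≤ τ := hττ.le

end InProbability

/-! ### One observation independent of the others -/

section Replacement

variable {ι 𝒳 : Type*} [Fintype ι] [DecidableEq ι] [MeasurableSpace 𝒳] {P : Measure 𝒳}
  [IsProbabilityMeasure P]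

/-- Replacing one coordinate of an i.i.d. sample by an independent copy preserves its law. -/
theorem measurePreserving_update (i : ι) :
    MeasurePreserving (fun z : (ι → 𝒳) × 𝒳 => Function.update z.1 i z.2)
      ((Measure.pi fun _ => P).prod P) (Measure.pi fun _ => P) := by
  have hm : Measurable fun z : (ι → 𝒳) × 𝒳 => Function.update z.1 i z.2 := by
    refine measurable_pi_lambda _ fun j => ?_
    by_cases h : j = i
    · subst h
      simpa using measurable_snd
    · simpa [Function.comp_def, Function.update_of_ne h] using
        (measurable_pi_apply j).comp measurable_fst
  refine ⟨hm, (Measure.pi_eq fun s hs => ?_).symm⟩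
  rw [Measure.map_apply hm (MeasurableSet.univ_pi hs)]
  have e : (fun z : (ι → 𝒳) × 𝒳 => Function.update z.1 i z.2) ⁻¹' Set.univ.pi s
      = (Set.univ.pi (Function.update s i Set.univ)) ×ˢ (s i) := by
    ext ⟨d, o⟩
    simp only [Set.mem_preimage, Set.mem_pi, Set.mem_univ, true_implies, Set.mem_prod]
    constructor
    · intro h
      refine ⟨fun j => ?_, by simpa using h i⟩
      by_cases hj : j = i
      · subst hj
        simp
      · simpa [Function.update_of_ne hj] using h j
    · rintro ⟨h, ho⟩ j
      by_cases hj : j = i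
      · subst hj
        simpa using ho
      · simpa [Function.update_of_ne hj] using h j
  rw [e, Measure.prod_prod, Measure.pi_pi, ← Finset.prod_erase_mul _ _ (Finset.mem_univ i),
    ← Finset.prod_erase_mul (s := Finset.univ) (fun j => P (s j)) (Finset.mem_univ i)]
  simp only [Function.update_self, measure_univ, mul_one]
  congr 1
  refine Finset.prod_congr rfl fun j hj => ?_
  rw [Function.update_of_ne (Finset.ne_of_mem_erase hj)]

theorem lintegral_apply_eq_lintegral_lintegral (i : ι) {F : (ι → 𝒳) × 𝒳 → ENNReal}
    (hF : Measurable F) (hi : ∀ d o x, F (Function.update d i o, x) = F (d, x)) :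
    ∫⁻ d, F (d, d i) ∂(Measure.pi fun _ => P)
      = ∫⁻ d, ∫⁻ o, F (d, o) ∂P ∂(Measure.pi fun _ => P) := by
  have hg : Measurable fun d : ι → 𝒳 => F (d, d i) := by fun_prop
  rw [← (measurePreserving_update (P := P) i).lintegral_comp hg, ← lintegral_prod _ hF.aemeasurable]
  simp [hi]

theorem integral_apply_eq_integral_integral (i : ι) {F : (ι → 𝒳) × 𝒳 → ℝ}
    (hF : Measurable F) (hi : ∀ d o x, F (Function.update d i o, x) = F (d, x))
    (hint : Integrable (fun d => F (d, d i)) (Measure.pi fun _ => P)) :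
    ∫ d, F (d, d i) ∂(Measure.pi fun _ => P)
      = ∫ d, ∫ o, F (d, o) ∂P ∂(Measure.pi fun _ => P) := by
  have hmp := measurePreserving_update (P := P) i
  have hg : Measurable fun d : ι → 𝒳 => F (d, d i) := by fun_prop
  have h1 : Integrable F ((Measure.pi fun _ : ι => P).prod P) := by
    have h := hmp.integrable_comp_of_integrable hint
    simpa [Function.comp_def, hi] using h
  rw [← integral_prod _ h1]
  conv_lhs => rw [← hmp.map_eq]
  rw [integral_map hmp.measurable.aemeasurable hg.aestronglyMeasurable]
  simp [hi]

/-- The sum over `i ∈ I` of centred functions of `d i`, which may depend on the observations outside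
`I`, has second moment at most `|I| δ`: the cross terms vanish. -/
theorem lintegral_sq_sum_le {I : Finset ι} {D : (ι → 𝒳) × 𝒳 → ℝ} (hD : Measurable D)
    (hoff : ∀ i ∈ I, ∀ d o x, D (Function.update d i o, x) = D (d, x)) {δ : ENNReal} (hδ : δ ≠ ⊤)
    (hsq : ∀ d, ∫⁻ o, ENNReal.ofReal (D (d, o) ^ 2) ∂P ≤ δ) (h0 : ∀ d, ∫ o, D (d, o) ∂P = 0) :
    ∫⁻ d, ENNReal.ofReal ((∑ i ∈ I, D (d, d i)) ^ 2) ∂(Measure.pi fun _ => P)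
      ≤ I.card * δ := by
  have hm : ∀ i, Measurable fun d : ι → 𝒳 => D (d, d i) := fun i => by fun_prop
  have h2 : ∀ i ∈ I, ∫⁻ d, ENNReal.ofReal (D (d, d i) ^ 2) ∂(Measure.pi fun _ => P) ≤ δ := by
    intro i hi
    rw [lintegral_apply_eq_lintegral_lintegral (P := P) i
      (F := fun z => ENNReal.ofReal (D z ^ 2)) (hD.pow_const 2).ennreal_ofReal
      (fun d o x => by rw [hoff i hi])]
    refine (lintegral_mono fun d => hsq d).trans ?_
    simp
  have hL : ∀ i ∈ I, MemLp (fun d : ι → 𝒳 => D (d, d i)) 2 (Measure.pi fun _ => P) := by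
    intro i hi
    rw [memLp_two_iff_integrable_sq (hm i).aestronglyMeasurable]
    refine ⟨((hm i).pow_const 2).aestronglyMeasurable, ?_⟩
    rw [hasFiniteIntegral_iff_ofReal (Eventually.of_forall fun d => sq_nonneg _)]
    exact (h2 i hi).trans_lt hδ.lt_top
  have hij : ∀ i ∈ I, ∀ j ∈ I, Integrable (fun d : ι → 𝒳 => D (d, d i) * D (d, d j))
      (Measure.pi fun _ => P) := fun i hi j hj => (hL i hi).integrable_mul (hL j hj)
  have hcross : ∀ i ∈ I, ∀ j ∈ I, j ≠ i →
      ∫ d, D (d, d i) * D (d, d j) ∂(Measure.pi fun _ => P) = 0 := by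
    intro i hi j hj hne
    have h := integral_apply_eq_integral_integral (P := P) i
      (F := fun z => D z * D (z.1, z.1 j)) (by fun_prop)
      (fun d o x => by
        simp only [Function.update_of_ne hne, hoff i hi]) (hij i hi j hj)
    rw [h]
    simp [integral_mul_const, h0]
  have hsum : ∫ d, (∑ i ∈ I, D (d, d i)) ^ 2 ∂(Measure.pi fun _ => P)
      = ∑ i ∈ I, ∫ d, D (d, d i) ^ 2 ∂(Measure.pi fun _ => P) := by
    simp only [sq (∑ i ∈ I, _), Finset.sum_mul_sum]
    rw [integral_finsetSum _ fun i hi => integrable_finsetSum _ fun j hj => hij i hi j hj]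
    refine Finset.sum_congr rfl fun i hi => ?_
    rw [integral_finsetSum _ fun j hj => hij i hi j hj,
      Finset.sum_eq_single_of_mem i hi fun j hj hne => hcross i hi j hj hne]
    simp only [sq]
  have hLs : MemLp (fun d : ι → 𝒳 => ∑ i ∈ I, D (d, d i)) 2 (Measure.pi fun _ => P) :=
    memLp_finsetSum _ hL
  rw [← ofReal_integral_eq_lintegral_ofReal hLs.integrable_sq
    (Eventually.of_forall fun d => sq_nonneg _), hsum,
    ENNReal.ofReal_sum_of_nonneg fun i _ => integral_nonneg fun d => sq_nonneg _]
  refine (Finset.sum_le_card_nsmul _ _ δ fun i hi => ?_).trans_eq (by simp)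
  rw [ofReal_integral_eq_lintegral_ofReal (hL i hi).integrable_sq
    (Eventually.of_forall fun d => sq_nonneg _)]
  exact h2 i hi

/-- On the event that the conditional second moment is at most `δ`, the sum over `i ∈ I` of the
squares has mean at most `|I| δ`. -/
theorem lintegral_indicator_sum_sq_le {I : Finset ι} {D : (ι → 𝒳) × 𝒳 → ℝ} (hD : Measurable D)
    (hoff : ∀ i ∈ I, ∀ d o x, D (Function.update d i o, x) = D (d, x)) (δ : ENNReal) :
    ∫⁻ d, {d | ∫⁻ o, ENNReal.ofReal (D (d, o) ^ 2) ∂P ≤ δ}.indicator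
      (fun d => ∑ i ∈ I, ENNReal.ofReal (D (d, d i) ^ 2)) d ∂(Measure.pi fun _ => P)
      ≤ I.card * δ := by
  classical
  set V : (ι → 𝒳) → ENNReal := fun d => ∫⁻ o, ENNReal.ofReal (D (d, o) ^ 2) ∂P with hV
  have hVm : Measurable V := (hD.pow_const 2).ennreal_ofReal.lintegral_prod_right'
  have hs : MeasurableSet {d | V d ≤ δ} := measurableSet_le hVm measurable_const
  let F : (ι → 𝒳) × 𝒳 → ENNReal := fun z => if V z.1 ≤ δ then ENNReal.ofReal (D z ^ 2) else 0
  have hF : Measurable F := Measurable.ite (measurableSet_le (hVm.comp measurable_fst)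
    measurable_const) (hD.pow_const 2).ennreal_ofReal measurable_const
  have e : ∀ d, {d | V d ≤ δ}.indicator
      (fun d => ∑ i ∈ I, ENNReal.ofReal (D (d, d i) ^ 2)) d = ∑ i ∈ I, F (d, d i) := by
    intro d
    by_cases h : V d ≤ δ
    · rw [Set.indicator_of_mem (show d ∈ {d | V d ≤ δ} from h)]
      simp [F, h]
    · rw [Set.indicator_of_notMem (show d ∉ {d | V d ≤ δ} from h)]
      simp [F, h]
  rw [lintegral_congr e]
  rw [lintegral_finsetSum _ fun i _ => by fun_prop]
  refine (Finset.sum_le_card_nsmul _ _ δ fun i hi => ?_).trans_eq (by simp)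
  rw [lintegral_apply_eq_lintegral_lintegral (P := P) i hF fun d o x => by
    simp only [F, hV, hoff i hi]]
  refine (lintegral_mono (g := fun _ => δ) fun d => ?_).trans (by simp)
  by_cases h : V d ≤ δ
  · simp only [F, h, if_true]
    exact h
  · simp [F, h]

/-- On the event that the conditional second moment is at most `δ`, the sum over `i ∈ I` of the
conditionally centred terms has second moment at most `|I| δ`. -/
theorem lintegral_indicator_sq_sum_centred_le {I : Finset ι} {D : (ι → 𝒳) × 𝒳 → ℝ}
    (hD : Measurable D) (hoff : ∀ i ∈ I, ∀ d o x, D (Function.update d i o, x) = D (d, x))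
    {δ : ENNReal} (hδ : δ ≠ ⊤) :
    ∫⁻ d, {d | ∫⁻ o, ENNReal.ofReal (D (d, o) ^ 2) ∂P ≤ δ}.indicator
      (fun d => ENNReal.ofReal ((∑ i ∈ I, (D (d, d i) - ∫ o, D (d, o) ∂P)) ^ 2)) d
      ∂(Measure.pi fun _ => P) ≤ I.card * δ := by
  classical
  set V : (ι → 𝒳) → ENNReal := fun d => ∫⁻ o, ENNReal.ofReal (D (d, o) ^ 2) ∂P with hV
  have hVm : Measurable V := (hD.pow_const 2).ennreal_ofReal.lintegral_prod_right'
  have hs : MeasurableSet {d | V d ≤ δ} := measurableSet_le hVm measurable_const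
  have hI : Measurable fun d => ∫ o, D (d, o) ∂P :=
    (hD.stronglyMeasurable.integral_prod_right' (ν := P)).measurable
  let F : (ι → 𝒳) × 𝒳 → ℝ := fun z => if V z.1 ≤ δ then D z - ∫ o, D (z.1, o) ∂P else 0
  have hF : Measurable F := Measurable.ite (measurableSet_le (hVm.comp measurable_fst)
    measurable_const) (hD.sub (hI.comp measurable_fst)) measurable_const
  have e : ∀ d, {d | V d ≤ δ}.indicator
      (fun d => ENNReal.ofReal ((∑ i ∈ I, (D (d, d i) - ∫ o, D (d, o) ∂P)) ^ 2)) d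
      = ENNReal.ofReal ((∑ i ∈ I, F (d, d i)) ^ 2) := by
    intro d
    by_cases h : V d ≤ δ
    · rw [Set.indicator_of_mem (show d ∈ {d | V d ≤ δ} from h)]
      simp [F, h]
    · rw [Set.indicator_of_notMem (show d ∉ {d | V d ≤ δ} from h)]
      simp [F, h]
  rw [lintegral_congr e]
  have hL : ∀ d, V d ≤ δ → MemLp (fun o => D (d, o)) 2 P := by
    intro d hd
    have hm : Measurable fun o => D (d, o) := hD.comp measurable_prodMk_left
    rw [memLp_two_iff_integrable_sq hm.aestronglyMeasurable]
    refine ⟨(hm.pow_const 2).aestronglyMeasurable, ?_⟩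
    rw [hasFiniteIntegral_iff_ofReal (Eventually.of_forall fun d => sq_nonneg _)]
    exact hd.trans_lt hδ.lt_top
  refine lintegral_sq_sum_le hF (fun i hi d o x => by simp only [F, hV, hoff i hi]) hδ
    (fun d => ?_) fun d => ?_
  · by_cases h : V d ≤ δ
    · have hLd := hL d h
      have h1 : ∫⁻ o, ENNReal.ofReal (F (d, o) ^ 2) ∂P
          = ENNReal.ofReal (∫ o, (D (d, o) - ∫ o, D (d, o) ∂P) ^ 2 ∂P) := by
        have hc : Integrable (fun o => (D (d, o) - ∫ o, D (d, o) ∂P) ^ 2) P :=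
          (hLd.sub (memLp_const (∫ o, D (d, o) ∂P))).integrable_sq
        rw [ofReal_integral_eq_lintegral_ofReal hc
          (Eventually.of_forall fun d => sq_nonneg _)]
        simp [F, h]
      have h2 := variance_le_expectation_sq (μ := P) hLd.1
      rw [variance_eq_integral hLd.1.aemeasurable] at h2
      rw [h1]
      refine (ENNReal.ofReal_le_ofReal h2).trans ?_
      change ENNReal.ofReal (∫ o, D (d, o) ^ 2 ∂P) ≤ δ
      rw [ofReal_integral_eq_lintegral_ofReal hLd.integrable_sq
        (Eventually.of_forall fun d => sq_nonneg _)]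
      exact h
    · simp [F, h]
  · by_cases h : V d ≤ δ
    · have hLd := (hL d h).integrable one_le_two
      simp only [F, h, if_true]
      rw [integral_sub hLd (integrable_const _)]
      simp
    · simp [F, h]

end Replacement

/-! ### Sample splitting -/

/-- The sampling assumptions: i.i.d. clusters with law `P`, and a source of randomness independent
of the clusters. -/
structure IsSampling {Ω 𝒰 : Type*} [MeasurableSpace Ω] [MeasurableSpace 𝒰] (μ : Measure Ω)
    (P : Measure (Cluster p)) (O : ℕ → Ω → Cluster p) (U : Ω → 𝒰) : Prop where
  meas : ∀ i, Measurable (O i)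
  law : ∀ i, μ.map (O i) = P
  indep : iIndepFun O μ
  meas_split : Measurable U
  indep_split : IndepFun U (fun ω i => O i ω) μ

section Splitting

variable {K : ℕ} {Ω 𝒰 : Type*} [MeasurableSpace Ω] [MeasurableSpace 𝒰] {μ : Measure Ω}
  {P : Measure (Cluster p)} {O : ℕ → Ω → Cluster p} {U : Ω → 𝒰} {S : Scheme p K 𝒰}

theorem IsSampling.measurable_sample (h : IsSampling μ P O U) (m : ℕ) :
    Measurable fun ω => (U ω, sample O m ω) :=
  h.meas_split.prodMk (measurable_pi_lambda _ fun i => h.meas i)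

theorem measurable_sum_group {m : ℕ} (k : Fin K) {g : Fin m → 𝒰 × (Fin m → Cluster p) → ℝ}
    (hg : ∀ i, Measurable (g i)) :
    Measurable fun z : 𝒰 × (Fin m → Cluster p) => ∑ i ∈ S.group m z.1 k, g i z := by
  simp only [Scheme.group, Finset.sum_filter]
  refine Finset.measurable_fun_sum _ fun i _ => Measurable.ite ?_ (hg i) measurable_const
  have h : Measurable fun z : 𝒰 × (Fin m → Cluster p) => S.split m z.1 i :=
    (measurable_pi_apply i).comp ((S.measurable_split m).comp measurable_fst)
  exact h (measurableSet_singleton k)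

theorem measurable_groupAverage {m : ℕ}
    {f : Fin K → 𝒰 × (Fin m → Cluster p) → Cluster p → ℝ}
    (hf : ∀ k, Measurable fun z : (𝒰 × (Fin m → Cluster p)) × Cluster p => f k z.1 z.2) :
    Measurable fun z : 𝒰 × (Fin m → Cluster p) => S.groupAverage m z.1 z.2 fun k => f k z := by
  refine measurable_const.mul (Finset.measurable_fun_sum _ fun k _ => Measurable.mul ?_ ?_)
  · have h := measurable_sum_group (S := S) k (g := fun (_ : Fin m) _ => 1)
      fun _ => measurable_const
    have h' : Measurable fun z : 𝒰 × (Fin m → Cluster p) => ((S.group m z.1 k).card : ℝ) := by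
      simpa using h
    exact h'.inv
  · refine measurable_sum_group k fun i => ?_
    have hz : Measurable fun z : 𝒰 × (Fin m → Cluster p) => (z, z.2 i) := by fun_prop
    exact (hf k).comp hz

theorem measurable_uncenteredEIF_est (m : ℕ) (k : Fin K) :
    Measurable fun z : (𝒰 × (Fin m → Cluster p)) × Cluster p =>
      uncenteredEIF (S.est m k z.1.1 z.1.2) z.2 := by
  have h := measurable_uncenteredEIF_family (S.isMeasurableFamily_est m k)
  exact h

theorem measurable_psiHat (m : ℕ) :
    Measurable fun z : 𝒰 × (Fin m → Cluster p) => S.psiHat m z.1 z.2 := by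
  have h := measurable_groupAverage (S := S)
    (f := fun k (z : 𝒰 × (Fin m → Cluster p)) o => uncenteredEIF (S.est m k z.1 z.2) o)
    (measurable_uncenteredEIF_est m)
  exact h

theorem measurable_varHat (m : ℕ) :
    Measurable fun z : 𝒰 × (Fin m → Cluster p) => S.varHat m z.1 z.2 := by
  have h := measurable_groupAverage (S := S)
    (f := fun k (z : 𝒰 × (Fin m → Cluster p)) o =>
      (uncenteredEIF (S.est m k z.1 z.2) o - S.psiHat m z.1 z.2) ^ 2)
    fun k => ((measurable_uncenteredEIF_est m k).sub
      ((measurable_psiHat m).comp measurable_fst)).pow_const 2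
  exact h

theorem card_group_le (m : ℕ) (u : 𝒰) (k : Fin K) : (S.group m u k).card ≤ m :=
  (Finset.card_le_univ _).trans_eq (Fintype.card_fin m)

/-- A group average as a combination of sums normalized by `m`; the weights tend to `1` when the
groups are balanced. -/
theorem groupAverage_eq (m : ℕ) (u : 𝒰) (d : Fin m → Cluster p) (f : Fin K → Cluster p → ℝ) :
    S.groupAverage m u d f = ∑ k : Fin K, (K * ((S.group m u k).card / m : ℝ))⁻¹ *
      ((m : ℝ)⁻¹ * ∑ i ∈ S.group m u k, f k (d i)) := by
  rw [Scheme.groupAverage, Finset.mul_sum]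
  refine Finset.sum_congr rfl fun k _ => ?_
  rcases Nat.eq_zero_or_pos m with rfl | hm
  · simp [Finset.eq_empty_of_isEmpty (S.group 0 u k)]
  · have hm' : (m : ℝ) ≠ 0 := by positivity
    rw [mul_inv, inv_div, div_eq_mul_inv]
    field_simp

theorem sum_group_eq_sum (m : ℕ) (u : 𝒰) (g : Fin m → ℝ) :
    ∑ k : Fin K, ∑ i ∈ S.group m u k, g i = ∑ i, g i := by
  simp only [Scheme.group]
  exact Finset.sum_fiberwise _ _ _

theorem IsSampling.identDistrib (h : IsSampling μ P O U) {g : Cluster p → ℝ} (hg : Measurable g)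
    (i : ℕ) : IdentDistrib (fun ω => g (O i ω)) (fun ω => g (O 0 ω)) μ μ :=
  (IdentDistrib.mk (h.meas i).aemeasurable (h.meas 0).aemeasurable
    (by rw [h.law, h.law])).comp hg

theorem IsSampling.measurePreserving (h : IsSampling μ P O U) (i : ℕ) :
    MeasurePreserving (O i) μ P := ⟨h.meas i, h.law i⟩

theorem IsSampling.integral_comp (h : IsSampling μ P O U) {g : Cluster p → ℝ}
    (hg : Measurable g) (i : ℕ) : ∫ ω, g (O i ω) ∂μ = ∫ o, g o ∂P := by
  rw [← h.law i, integral_map (h.meas i).aemeasurable hg.aestronglyMeasurable]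

theorem ofReal_inv_mul_card_mul_le (m : ℕ) (u : 𝒰) (k : Fin K) (δ : ENNReal) :
    ENNReal.ofReal (m : ℝ)⁻¹ * ((S.group m u k).card * δ) ≤ δ := by
  rw [← mul_assoc]
  refine (mul_le_mul_left ?_ δ).trans_eq (one_mul δ)
  rw [← ENNReal.ofReal_natCast, ← ENNReal.ofReal_mul (by positivity)]
  refine ENNReal.ofReal_le_one.2 ?_
  rcases Nat.eq_zero_or_pos m with rfl | hm
  · simp
  · rw [inv_mul_le_iff₀ (by positivity), mul_one]
    exact_mod_cast card_group_le m u k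

/-- A function which depends on the data outside group `k` only. -/
def OffGroup (S : Scheme p K 𝒰) (m : ℕ) (k : Fin K)
    (D : (𝒰 × (Fin m → Cluster p)) × Cluster p → ℝ) : Prop :=
  ∀ u d d' x, (∀ i, S.split m u i ≠ k → d i = d' i) → D ((u, d), x) = D ((u, d'), x)

theorem OffGroup.update {m : ℕ} {k : Fin K} {D : (𝒰 × (Fin m → Cluster p)) × Cluster p → ℝ}
    (hD : OffGroup S m k D) (u : 𝒰) :
    ∀ i ∈ S.group m u k, ∀ d o x, D ((u, Function.update d i o), x) = D ((u, d), x) := by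
  intro i hi d o x
  refine hD u _ _ x fun j hj => ?_
  have hne : j ≠ i := by
    rintro rfl
    exact hj (by simpa [Scheme.group] using hi)
  rw [Function.update_of_ne hne]

theorem tendsto_group_weight (hbal : ∀ k : Fin K, TendstoInMeasure μ
      (fun (m : ℕ) ω => ((S.group m (U ω) k).card : ℝ) / (m : ℝ)) atTop (fun _ => (K : ℝ)⁻¹))
    (hK : 0 < K) (k : Fin K) :
    TendstoInMeasure μ (fun (m : ℕ) ω => (K * ((S.group m (U ω) k).card / m : ℝ))⁻¹) atTop
      fun _ => 1 := by
  have hK' : (K : ℝ) ≠ 0 := by positivity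
  have h := TendstoInMeasure.comp_continuousAt (g := fun x : ℝ => (K * x)⁻¹) (hbal k)
    (ContinuousAt.inv₀ (by fun_prop) (by simp [hK']))
  simpa [hK'] using h

variable [IsProbabilityMeasure μ]

theorem IsSampling.map_sample (h : IsSampling μ P O U) (m : ℕ) :
    μ.map (fun ω => (U ω, sample O m ω)) = (μ.map U).prod (Measure.pi fun _ : Fin m => P) := by
  have h1 : IndepFun U (sample O m) μ :=
    h.indep_split.comp (φ := id) (ψ := fun (x : ℕ → Cluster p) (i : Fin m) => x i) measurable_id
      (measurable_pi_lambda _ fun i => measurable_pi_apply _)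
  have hs : Measurable (sample O m) := measurable_pi_lambda _ fun i => h.meas i
  rw [(indepFun_iff_map_prod_eq_prod_map_map h.meas_split.aemeasurable hs.aemeasurable).1 h1]
  congr 1
  have h2 : iIndepFun (fun (i : Fin m) => O i) μ := h.indep.precomp Fin.val_injective
  have h3 := (iIndepFun_iff_map_fun_eq_pi_map fun i : Fin m => (h.meas i).aemeasurable).1 h2
  simp only [h.law] at h3
  exact h3

theorem IsSampling.tendsto_mean (h : IsSampling μ P O U) {g : Cluster p → ℝ} (hg : Measurable g)
    (hgi : Integrable g P) :
    TendstoInMeasure μ (fun (m : ℕ) ω => (m : ℝ)⁻¹ * ∑ i : Fin m, g (sample O m ω i)) atTop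
      fun _ => ∫ o, g o ∂P := by
  have hm : ∀ i, Measurable fun ω => g (O i ω) := fun i => hg.comp (h.meas i)
  have h1 := strong_law_ae_real (μ := μ) (fun i ω => g (O i ω))
    ((h.measurePreserving 0).integrable_comp_of_integrable hgi)
    (fun i j hij => (h.indep.indepFun hij).comp hg hg) (h.identDistrib hg)
  rw [h.integral_comp hg] at h1
  refine tendstoInMeasure_of_tendsto_ae (fun m => Measurable.aestronglyMeasurable ?_) ?_
  · exact (Finset.measurable_fun_sum Finset.univ fun (i : Fin m) _ => hm i).const_mul (m : ℝ)⁻¹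
  · filter_upwards [h1] with ω hω
    refine hω.congr fun m => ?_
    rw [Finset.sum_range, div_eq_inv_mul]
    rfl

variable [IsProbabilityMeasure P]

/-- Fubini: a bound which holds for every fixed partition holds for the random one. -/
theorem IsSampling.lintegral_sample_le (h : IsSampling μ P O U) {m : ℕ}
    {T : 𝒰 × (Fin m → Cluster p) → ENNReal} (hT : Measurable T) {B : ENNReal}
    (hB : ∀ u, ∫⁻ d, T (u, d) ∂(Measure.pi fun _ => P) ≤ B) :
    ∫⁻ ω, T (U ω, sample O m ω) ∂μ ≤ B := by
  have : IsProbabilityMeasure (μ.map U) :=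
    Measure.isProbabilityMeasure_map h.meas_split.aemeasurable
  rw [← lintegral_map (f := T) (g := fun ω => (U ω, sample O m ω)) hT (h.measurable_sample m),
    h.map_sample, lintegral_prod _ hT.aemeasurable]
  exact (lintegral_mono fun u => hB u).trans (by simp)

/-- Cross-fitting on the scale of averages: if `D` is trained off group `k` and its conditional mean
square tends to zero, then so does the mean of its squares over group `k`. -/
theorem IsSampling.tendsto_sum_sq (h : IsSampling μ P O U) (k : Fin K)
    {D : ∀ m : ℕ, (𝒰 × (Fin m → Cluster p)) × Cluster p → ℝ} (hD : ∀ m, Measurable (D m))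
    (hoff : ∀ m, OffGroup S m k (D m))
    (hV : ∀ δ : ENNReal, 0 < δ → Tendsto (fun m => μ {ω |
      δ < ∫⁻ o, ENNReal.ofReal (D m ((U ω, sample O m ω), o) ^ 2) ∂P}) atTop (𝓝 0)) :
    TendstoInMeasure μ (fun (m : ℕ) ω => (m : ℝ)⁻¹ *
      ∑ i ∈ S.group m (U ω) k, D m ((U ω, sample O m ω), sample O m ω i) ^ 2) atTop
      fun _ => 0 := by
  let V : ∀ m : ℕ, 𝒰 × (Fin m → Cluster p) → ENNReal := fun m z =>
    ∫⁻ o, ENNReal.ofReal (D m (z, o) ^ 2) ∂P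
  have hVm : ∀ m, Measurable (V m) := fun m =>
    ((hD m).pow_const 2).ennreal_ofReal.lintegral_prod_right'
  let T : ∀ m : ℕ, 𝒰 × (Fin m → Cluster p) → ℝ := fun m z =>
    (m : ℝ)⁻¹ * ∑ i ∈ S.group m z.1 k, D m (z, z.2 i) ^ 2
  have hTm : ∀ m, Measurable (T m) := fun m =>
    (measurable_sum_group k fun i => ((hD m).comp (by fun_prop)).pow_const 2).const_mul _
  rw [tendstoInMeasure_const_iff]
  intro ε hε
  have key := tendsto_measure_of_lintegral_indicator_le (μ := μ)
    (T := fun m ω => ENNReal.ofReal (T m (U ω, sample O m ω)))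
    (V := fun m ω => V m (U ω, sample O m ω))
    (fun m => ((hTm m).comp (h.measurable_sample m)).ennreal_ofReal)
    (fun m => (hVm m).comp (h.measurable_sample m)) hV (fun m δ _ _ => by
      refine h.lintegral_sample_le (T := {z | V m z ≤ δ}.indicator fun z => ENNReal.ofReal (T m z))
        ((hTm m).ennreal_ofReal.indicator (measurableSet_le (hVm m) measurable_const))
        fun u => ?_
      have h1 := lintegral_indicator_sum_sq_le (P := P) (I := S.group m u k)
        (D := fun z => D m ((u, z.1), z.2)) ((hD m).comp (by fun_prop))
        ((hoff m).update u) δ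
      refine le_trans ?_ (ofReal_inv_mul_card_mul_le (S := S) m u k δ)
      refine le_trans (le_of_eq ?_) (mul_le_mul_right h1 _)
      rw [← lintegral_const_mul' _ _ ENNReal.ofReal_ne_top]
      refine lintegral_congr fun d => ?_
      simp only [Set.indicator, Set.mem_ofPred_eq, V, T]
      split_ifs
      · rw [ENNReal.ofReal_mul (by positivity),
          ENNReal.ofReal_sum_of_nonneg fun i _ => sq_nonneg _]
      · simp) (ε := ENNReal.ofReal ε) (by simpa using hε) ENNReal.ofReal_ne_top
  refine tendsto_of_tendsto_of_tendsto_of_le_of_le tendsto_const_nhds key (fun _ => zero_le)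
    fun m => measure_mono fun ω hω => ?_
  have h2 : ε ≤ |T m (U ω, sample O m ω) - 0| := hω
  have h3 : 0 ≤ T m (U ω, sample O m ω) := by positivity
  rw [sub_zero, abs_of_nonneg h3] at h2
  exact ENNReal.ofReal_le_ofReal h2

/-- Cross-fitting on the scale `√m`: if `D` is trained off group `k` and its conditional mean square
tends to zero, then its empirical process over group `k` tends to zero. -/
theorem IsSampling.tendsto_sum_centred (h : IsSampling μ P O U) (k : Fin K)
    {D : ∀ m : ℕ, (𝒰 × (Fin m → Cluster p)) × Cluster p → ℝ} (hD : ∀ m, Measurable (D m))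
    (hoff : ∀ m, OffGroup S m k (D m))
    (hV : ∀ δ : ENNReal, 0 < δ → Tendsto (fun m => μ {ω |
      δ < ∫⁻ o, ENNReal.ofReal (D m ((U ω, sample O m ω), o) ^ 2) ∂P}) atTop (𝓝 0)) :
    TendstoInMeasure μ (fun (m : ℕ) ω => (√(m : ℝ))⁻¹ *
      ∑ i ∈ S.group m (U ω) k, (D m ((U ω, sample O m ω), sample O m ω i)
        - ∫ o, D m ((U ω, sample O m ω), o) ∂P)) atTop fun _ => 0 := by
  let V : ∀ m : ℕ, 𝒰 × (Fin m → Cluster p) → ENNReal := fun m z =>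
    ∫⁻ o, ENNReal.ofReal (D m (z, o) ^ 2) ∂P
  have hVm : ∀ m, Measurable (V m) := fun m =>
    ((hD m).pow_const 2).ennreal_ofReal.lintegral_prod_right'
  let T : ∀ m : ℕ, 𝒰 × (Fin m → Cluster p) → ℝ := fun m z =>
    (√(m : ℝ))⁻¹ * ∑ i ∈ S.group m z.1 k, (D m (z, z.2 i) - ∫ o, D m (z, o) ∂P)
  have hTm : ∀ m, Measurable (T m) := fun m => by
    have hI : Measurable fun z => ∫ o, D m (z, o) ∂P :=
      ((hD m).stronglyMeasurable.integral_prod_right' (ν := P)).measurable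
    exact (measurable_sum_group k fun i => ((hD m).comp (by fun_prop)).sub hI).const_mul _
  rw [tendstoInMeasure_const_iff]
  intro ε hε
  have key := tendsto_measure_of_lintegral_indicator_le (μ := μ)
    (T := fun m ω => ENNReal.ofReal (T m (U ω, sample O m ω) ^ 2))
    (V := fun m ω => V m (U ω, sample O m ω))
    (fun m => (((hTm m).comp (h.measurable_sample m)).pow_const 2).ennreal_ofReal)
    (fun m => (hVm m).comp (h.measurable_sample m)) hV (fun m δ _ hδ => by
      refine h.lintegral_sample_le
        (T := {z | V m z ≤ δ}.indicator fun z => ENNReal.ofReal (T m z ^ 2))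
        (((hTm m).pow_const 2).ennreal_ofReal.indicator
          (measurableSet_le (hVm m) measurable_const)) fun u => ?_
      have h1 := lintegral_indicator_sq_sum_centred_le (P := P) (I := S.group m u k)
        (D := fun z => D m ((u, z.1), z.2)) ((hD m).comp (by fun_prop))
        ((hoff m).update u) hδ
      refine le_trans ?_ (ofReal_inv_mul_card_mul_le (S := S) m u k δ)
      refine le_trans (le_of_eq ?_) (mul_le_mul_right h1 _)
      rw [← lintegral_const_mul' _ _ ENNReal.ofReal_ne_top]
      refine lintegral_congr fun d => ?_
      simp only [Set.indicator, Set.mem_ofPred_eq, V, T]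
      split_ifs
      · rw [mul_pow, inv_pow, Real.sq_sqrt (Nat.cast_nonneg m),
          ENNReal.ofReal_mul (by positivity)]
      · simp) (ε := ENNReal.ofReal (ε ^ 2)) (by simpa using pow_pos hε 2) ENNReal.ofReal_ne_top
  refine tendsto_of_tendsto_of_tendsto_of_le_of_le tendsto_const_nhds key (fun _ => zero_le)
    fun m => measure_mono fun ω hω => ?_
  have h2 : ε ≤ |T m (U ω, sample O m ω) - 0| := hω
  rw [sub_zero] at h2
  have h3 := pow_le_pow_left₀ hε.le h2 2
  rw [sq_abs] at h3
  exact ENNReal.ofReal_le_ofReal h3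

/-- The normalized sum of a centred function over a group is bounded in probability. -/
theorem IsSampling.isBigOP_sum (h : IsSampling μ P O U) (k : Fin K) {g : Cluster p → ℝ}
    (hg : Measurable g) (hg2 : MemLp g 2 P) (hg0 : ∫ o, g o ∂P = 0) :
    IsBigOP μ (fun (m : ℕ) ω => (√(m : ℝ))⁻¹ * ∑ i ∈ S.group m (U ω) k, g (sample O m ω i))
      fun _ => 1 := by
  let T : ∀ m : ℕ, 𝒰 × (Fin m → Cluster p) → ℝ := fun m z =>
    (√(m : ℝ))⁻¹ * ∑ i ∈ S.group m z.1 k, g (z.2 i)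
  have hTm : ∀ m, Measurable (T m) := fun m =>
    (measurable_sum_group k fun i => hg.comp (by fun_prop)).const_mul _
  refine isBigOP_one_of_lintegral_sq_le (B := ∫ o, g o ^ 2 ∂P)
    (fun m => (hTm m).comp (h.measurable_sample m)) fun m => ?_
  refine h.lintegral_sample_le (T := fun z => ENNReal.ofReal (T m z ^ 2))
    ((hTm m).pow_const 2).ennreal_ofReal fun u => ?_
  have h1 := lintegral_sq_sum_le (P := P) (I := S.group m u k) (D := fun z => g z.2)
    (hg.comp measurable_snd) (fun _ _ _ _ _ => rfl) (δ := ENNReal.ofReal (∫ o, g o ^ 2 ∂P))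
    ENNReal.ofReal_ne_top (fun _ => by
      rw [ofReal_integral_eq_lintegral_ofReal hg2.integrable_sq
        (Eventually.of_forall fun d => sq_nonneg _)]) fun _ => hg0
  refine le_trans ?_ (ofReal_inv_mul_card_mul_le (S := S) m u k _)
  refine le_trans (le_of_eq ?_) (mul_le_mul_right h1 _)
  rw [← lintegral_const_mul' _ _ ENNReal.ofReal_ne_top]
  refine lintegral_congr fun d => ?_
  simp only [T]
  rw [mul_pow, inv_pow, Real.sq_sqrt (Nat.cast_nonneg m), ENNReal.ofReal_mul (by positivity)]

end Splitting

/-! ### Algebra of group averages -/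

section GroupAverage

variable {K : ℕ} {𝒰 : Type*} [MeasurableSpace 𝒰] (S : Scheme p K 𝒰) (m : ℕ) (u : 𝒰)
  (d : Fin m → Cluster p)

/-- The weight of cluster `i` in a group average: `1 / (K m_k)` when `i` is in group `k`. -/
def groupWeight (i : Fin m) : ℝ := (K : ℝ)⁻¹ * ((S.group m u (S.split m u i)).card : ℝ)⁻¹

theorem groupWeight_nonneg (i : Fin m) : 0 ≤ groupWeight S m u i := by
  unfold groupWeight
  positivity

theorem groupAverage_eq_sum (f : Fin K → Cluster p → ℝ) :
    S.groupAverage m u d f = ∑ i, groupWeight S m u i * f (S.split m u i) (d i) := by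
  rw [← sum_group_eq_sum (S := S) m u, Scheme.groupAverage, Finset.mul_sum]
  refine Finset.sum_congr rfl fun k _ => ?_
  rw [Finset.mul_sum, Finset.mul_sum]
  refine Finset.sum_congr rfl fun i hi => ?_
  have h : S.split m u i = k := by simpa [Scheme.group] using hi
  rw [groupWeight, h, mul_assoc]

theorem groupAverage_add (f g : Fin K → Cluster p → ℝ) :
    S.groupAverage m u d (fun k o => f k o + g k o)
      = S.groupAverage m u d f + S.groupAverage m u d g := by
  simp only [groupAverage_eq_sum, mul_add, Finset.sum_add_distrib]

theorem groupAverage_const_mul (r : ℝ) (f : Fin K → Cluster p → ℝ) :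
    S.groupAverage m u d (fun k o => r * f k o) = r * S.groupAverage m u d f := by
  simp only [groupAverage_eq_sum, Finset.mul_sum]
  exact Finset.sum_congr rfl fun i _ => by ring

theorem groupAverage_mono {f g : Fin K → Cluster p → ℝ} (h : ∀ k o, f k o ≤ g k o) :
    S.groupAverage m u d f ≤ S.groupAverage m u d g := by
  simp only [groupAverage_eq_sum]
  exact Finset.sum_le_sum fun i _ =>
    mul_le_mul_of_nonneg_left (h _ _) (groupWeight_nonneg S m u i)

theorem groupAverage_nonneg {f : Fin K → Cluster p → ℝ} (h : ∀ k o, 0 ≤ f k o) :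
    0 ≤ S.groupAverage m u d f := by
  simp only [groupAverage_eq_sum]
  exact Finset.sum_nonneg fun i _ => mul_nonneg (groupWeight_nonneg S m u i) (h _ _)

theorem abs_groupAverage_mul_le (f g : Fin K → Cluster p → ℝ) :
    |S.groupAverage m u d fun k o => f k o * g k o|
      ≤ √(S.groupAverage m u d fun k o => f k o ^ 2)
        * √(S.groupAverage m u d fun k o => g k o ^ 2) := by
  rw [← Real.sqrt_mul (groupAverage_nonneg S m u d fun _ _ => sq_nonneg _)]
  refine Real.abs_le_sqrt ?_
  simp only [groupAverage_eq_sum]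
  refine Finset.sum_sq_le_sum_mul_sum_of_sq_le_mul _
    (fun i _ => mul_nonneg (groupWeight_nonneg S m u i) (sq_nonneg _))
    (fun i _ => mul_nonneg (groupWeight_nonneg S m u i) (sq_nonneg _)) fun i _ => ?_
  exact le_of_eq (by ring)

theorem groupAverage_const_eq (b : Fin K → ℝ) :
    (S.groupAverage m u d fun k _ => b k)
      = (K : ℝ)⁻¹ * ∑ k, ((S.group m u k).card : ℝ)⁻¹ * (S.group m u k).card * b k := by
  simp only [Scheme.groupAverage, Finset.sum_const, nsmul_eq_mul, mul_assoc]

/-- The inequality is strict when a group is empty, because `0⁻¹ = 0`. -/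
theorem groupAverage_one_le (hK : 0 < K) : (S.groupAverage m u d fun _ _ => 1) ≤ 1 := by
  have hK' : (0 : ℝ) < K := by positivity
  rw [groupAverage_const_eq, inv_mul_le_iff₀ hK']
  refine (Finset.sum_le_sum (g := fun _ => (1 : ℝ)) fun k _ => ?_).trans_eq (by simp)
  rw [mul_one]
  exact inv_mul_le_one

theorem groupAverage_one_eq (hK : 0 < K) (h : ∀ k, (S.group m u k).card ≠ 0) :
    (S.groupAverage m u d fun _ _ => 1) = 1 := by
  have hK' : (K : ℝ) ≠ 0 := by positivity
  have h1 : ∀ k, ((S.group m u k).card : ℝ)⁻¹ * (S.group m u k).card * 1 = 1 := fun k => by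
    rw [mul_one, inv_mul_cancel₀ (Nat.cast_ne_zero.2 (h k))]
  rw [groupAverage_const_eq, Finset.sum_congr rfl fun k _ => h1 k]
  simp [hK']

theorem abs_groupAverage_const_le (hK : 0 < K) (b : Fin K → ℝ) :
    |S.groupAverage m u d fun k _ => b k| ≤ ∑ k, |b k| := by
  have hK1 : (K : ℝ)⁻¹ ≤ 1 := inv_le_one_of_one_le₀ (by exact_mod_cast hK)
  rw [groupAverage_const_eq, abs_mul, abs_of_nonneg (by positivity)]
  refine (mul_le_of_le_one_left (abs_nonneg _) hK1).trans
    ((Finset.abs_sum_le_sum_abs _ _).trans (Finset.sum_le_sum fun k _ => ?_))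
  rw [abs_mul, abs_of_nonneg (by positivity)]
  exact mul_le_of_le_one_left (abs_nonneg _) inv_mul_le_one

/-- The group average of the squared errors of the estimated influence functions. -/
def meanSqError (η : Nuisance p) : ℝ :=
  S.groupAverage m u d fun k o => (uncenteredEIF (S.est m k u d) o - uncenteredEIF η o) ^ 2

theorem psiHat_eq (η : Nuisance p) :
    S.psiHat m u d = S.groupAverage m u d (fun _ o => uncenteredEIF η o)
      + S.groupAverage m u d
        (fun k o => uncenteredEIF (S.est m k u d) o - uncenteredEIF η o) := by
  rw [← groupAverage_add, Scheme.psiHat]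
  congr 1
  funext k o
  ring

theorem abs_psiHat_sub_le (hK : 0 < K) (η : Nuisance p) :
    |S.psiHat m u d - S.groupAverage m u d fun _ o => uncenteredEIF η o|
      ≤ √(meanSqError S m u d η) := by
  rw [psiHat_eq S m u d η, add_sub_cancel_left]
  have h := abs_groupAverage_mul_le S m u d
    (fun k o => uncenteredEIF (S.est m k u d) o - uncenteredEIF η o) fun _ _ => 1
  simp only [mul_one, one_pow] at h
  exact h.trans (mul_le_of_le_one_right (Real.sqrt_nonneg _)
    (Real.sqrt_le_one.2 (groupAverage_one_le S m u d hK)))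

/-- The variance estimator against the average of the true squared influence function. The bound is
the Cauchy-Schwarz inequality for the cross term of `f - ψ` and `(f̂ - f) + (ψ - Ψ̂)`. -/
theorem abs_varHat_sub_le (hK : 0 < K) (η : Nuisance p) (ψ : ℝ) :
    |S.varHat m u d - S.groupAverage m u d fun _ o => (uncenteredEIF η o - ψ) ^ 2|
      ≤ 2 * (√(S.groupAverage m u d fun _ o => (uncenteredEIF η o - ψ) ^ 2)
          * √(2 * meanSqError S m u d η + 2 * (S.psiHat m u d - ψ) ^ 2))
        + (2 * meanSqError S m u d η + 2 * (S.psiHat m u d - ψ) ^ 2) := by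
  set R : ℝ := 2 * meanSqError S m u d η + 2 * (S.psiHat m u d - ψ) ^ 2 with hR
  let e : Fin K → Cluster p → ℝ := fun k o =>
    (uncenteredEIF (S.est m k u d) o - uncenteredEIF η o) + (ψ - S.psiHat m u d)
  have h1 : (S.groupAverage m u d fun k o => e k o ^ 2) ≤ R := by
    have h2 : (S.groupAverage m u d fun k o => e k o ^ 2)
        ≤ S.groupAverage m u d fun k o =>
          2 * (uncenteredEIF (S.est m k u d) o - uncenteredEIF η o) ^ 2
            + 2 * (S.psiHat m u d - ψ) ^ 2 * 1 := by
      refine groupAverage_mono S m u d fun k o => ?_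
      have h3 := add_sq_le (a := uncenteredEIF (S.est m k u d) o - uncenteredEIF η o)
        (b := ψ - S.psiHat m u d)
      have h4 : (ψ - S.psiHat m u d) ^ 2 = (S.psiHat m u d - ψ) ^ 2 := by ring
      simp only [e]
      linarith
    rw [groupAverage_add, groupAverage_const_mul, groupAverage_const_mul] at h2
    refine h2.trans (add_le_add le_rfl ?_)
    exact mul_le_of_le_one_right (by positivity) (groupAverage_one_le S m u d hK)
  have h5 : S.varHat m u d = (S.groupAverage m u d fun _ o => (uncenteredEIF η o - ψ) ^ 2)
      + (2 * (S.groupAverage m u d fun k o => (uncenteredEIF η o - ψ) * e k o)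
        + S.groupAverage m u d fun k o => e k o ^ 2) := by
    rw [← groupAverage_const_mul, ← groupAverage_add, ← groupAverage_add, Scheme.varHat]
    congr 1
    funext k o
    simp only [e]
    ring
  rw [h5, add_sub_cancel_left]
  have h6 := abs_groupAverage_mul_le S m u d (fun _ o => uncenteredEIF η o - ψ) e
  have h7 := Real.sqrt_le_sqrt h1
  have h8 : (0 : ℝ) ≤ S.groupAverage m u d fun k o => e k o ^ 2 :=
    groupAverage_nonneg S m u d fun _ _ => sq_nonneg _
  refine (abs_add_le _ _).trans (add_le_add ?_ (by rwa [abs_of_nonneg h8]))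
  rw [abs_mul, abs_two]
  exact mul_le_mul_of_nonneg_left
    (h6.trans (mul_le_mul_of_nonneg_left h7 (Real.sqrt_nonneg _))) zero_le_two

end GroupAverage

/-! ### Consistency -/

section Consistency

variable {K : ℕ} {Ω 𝒰 : Type*} [MeasurableSpace Ω] [MeasurableSpace 𝒰] {μ : Measure Ω}
  {P : Measure (Cluster p)} {O : ℕ → Ω → Cluster p}
  {U : Ω → 𝒰} {S : Scheme p K 𝒰} {η : Nuisance p} {c C : ℝ}

/-- The groups are asymptotically balanced. -/
def IsBalanced (μ : Measure Ω) (S : Scheme p K 𝒰) (U : Ω → 𝒰) : Prop :=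
  ∀ k : Fin K, TendstoInMeasure μ
    (fun (m : ℕ) ω => ((S.group m (U ω) k).card : ℝ) / (m : ℝ)) atTop (fun _ => (K : ℝ)⁻¹)

/-- A group average of a fixed function obeys the law of large numbers. -/
theorem IsSampling.tendsto_groupAverage [IsProbabilityMeasure μ]
    (h : IsSampling μ P O U) (hbal : IsBalanced μ S U) (hK : 0 < K)
    {g : Cluster p → ℝ} (hg : Measurable g) (hgi : Integrable g P) :
    TendstoInMeasure μ (fun (m : ℕ) ω => S.groupAverage m (U ω) (sample O m ω) fun _ => g) atTop
      fun _ => ∫ o, g o ∂P := by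
  have h1 := h.tendsto_mean hg hgi
  have h2 := h.tendsto_mean (g := fun o => |g o|) hg.abs hgi.abs
  have h3 : ∀ k : Fin K, TendstoInMeasure μ (fun (m : ℕ) ω =>
      ((K * ((S.group m (U ω) k).card / m : ℝ))⁻¹ - 1) *
        ((m : ℝ)⁻¹ * ∑ i ∈ S.group m (U ω) k, g (sample O m ω i))) atTop fun _ => 0 := by
    intro k
    have h4 := TendstoInMeasure.comp_continuousAt₂ (g := fun z => (z.1 - 1) * z.2)
      (tendsto_group_weight hbal hK k) h2 (by fun_prop)
    simp only [sub_self, zero_mul] at h4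
    refine tendstoInMeasure_of_abs_sub_le h4 (Eventually.of_forall fun (m : ℕ) =>
      Eventually.of_forall fun ω => ?_)
    simp only [sub_zero, abs_mul]
    gcongr ?_ * (?_ * ?_)
    calc |∑ i ∈ S.group m (U ω) k, g (sample O m ω i)|
        ≤ ∑ i ∈ S.group m (U ω) k, |g (sample O m ω i)| := Finset.abs_sum_le_sum_abs _ _
      _ ≤ ∑ i, |g (sample O m ω i)| := Finset.sum_le_sum_of_subset_of_nonneg
          (Finset.subset_univ _) fun i _ _ => abs_nonneg _
      _ ≤ |(∑ i, |g (sample O m ω i)|)| := le_abs_self _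
  have h4 := TendstoInMeasure.add_const_limits h1
    (tendstoInMeasure_sum_zero Finset.univ fun k _ => h3 k)
  rw [add_zero] at h4
  refine TendstoInMeasure.congr_left (fun m => Eventually.of_forall fun ω => ?_) h4
  simp only [groupAverage_eq, sub_mul, one_mul, Finset.sum_sub_distrib]
  rw [← Finset.mul_sum, sum_group_eq_sum]
  ring

/-- The difference between the estimated and the true influence function. -/
def eifError (S : Scheme p K 𝒰) (η : Nuisance p) (m : ℕ) (k : Fin K)
    (z : (𝒰 × (Fin m → Cluster p)) × Cluster p) : ℝ :=
  uncenteredEIF (S.est m k z.1.1 z.1.2) z.2 - uncenteredEIF η z.2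

theorem measurable_eifError (hη : η.IsMeasurable) (m : ℕ) (k : Fin K) :
    Measurable (eifError S η m k) :=
  (measurable_uncenteredEIF_est m k).sub ((measurable_uncenteredEIF hη).comp measurable_snd)

theorem offGroup_eifError (m : ℕ) (k : Fin K) : OffGroup S m k (eifError S η m k) := by
  intro u d d' x h
  simp only [eifError, S.trained_off m k u d d' h]

/-- If the nuisance estimates are consistent, then so are the estimated influence functions, in
conditional mean square given the training data. -/
theorem RegularModel.tendsto_condMeanSq [IsProbabilityMeasure P] (hM : RegularModel P η c C)
    (hbddHat : ∀ (m : ℕ) (k : Fin K), ∀ᵐ ω ∂μ,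
      IsBoundedBy P c C (S.est m k (U ω) (sample O m ω))) (k : Fin K)
    (hW : TendstoInMeasure μ (fun (m : ℕ) ω => errW P (S.est m k (U ω) (sample O m ω)) η) atTop
      fun _ => 0)
    (hPhi : TendstoInMeasure μ (fun (m : ℕ) ω => errPhi P (S.est m k (U ω) (sample O m ω)) η)
      atTop fun _ => 0)
    (hG : TendstoInMeasure μ (fun (m : ℕ) ω => errG P (S.est m k (U ω) (sample O m ω)) η) atTop
      fun _ => 0)
    (hH : TendstoInMeasure μ (fun (m : ℕ) ω => errH P (S.est m k (U ω) (sample O m ω)) η) atTop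
      fun _ => 0) (δ : ENNReal) (hδ : 0 < δ) :
    Tendsto (fun m => μ {ω |
      δ < ∫⁻ o, ENNReal.ofReal (eifError S η m k ((U ω, sample O m ω), o) ^ 2) ∂P})
      atTop (𝓝 0) := by
  obtain ⟨M, _, hle⟩ := hM.exists_integral_sub_sq_le
  have h1 := TendstoInMeasure.comp_continuousAt (g := fun x => M * x ^ 2)
    (TendstoInMeasure.add_const_limits (TendstoInMeasure.add_const_limits
      (TendstoInMeasure.add_const_limits hW hPhi) hG) hH) (by fun_prop)
  simp only [add_zero, zero_pow two_ne_zero, mul_zero] at h1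
  rw [tendstoInMeasure_const_iff] at h1
  obtain ⟨ε, -, hε0, hεδ⟩ := ENNReal.lt_iff_exists_real_btwn.1 hδ
  have hε : 0 < ε := by simpa using hε0
  refine tendsto_of_tendsto_of_tendsto_of_le_of_le tendsto_const_nhds (h1 ε hε)
    (fun _ => zero_le) fun m => measure_mono_ae ?_
  filter_upwards [hbddHat m k] with ω hω h2
  have hm := (S.isMeasurableFamily_est m k).isMeasurable (U ω, sample O m ω)
  have h3 := hle _ hm hω
  have hL : MemLp (fun o => eifError S η m k ((U ω, sample O m ω), o)) 2 P :=
    (hM.memLp_uncenteredEIF hm hω).sub (hM.memLp_uncenteredEIF hM.meas hM.bdd)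
  have h4 : δ < ∫⁻ o, ENNReal.ofReal (eifError S η m k ((U ω, sample O m ω), o) ^ 2) ∂P := h2
  rw [← ofReal_integral_eq_lintegral_ofReal hL.integrable_sq
    (Eventually.of_forall fun d => sq_nonneg _)] at h4
  have h5 := (ENNReal.ofReal_lt_ofReal_iff_of_nonneg hε.le).1 (hεδ.trans h4)
  change ε ≤ |_ - 0|
  rw [sub_zero]
  exact h5.le.trans (h3.trans (le_abs_self _))

theorem IsSampling.tendsto_meanSqError [IsProbabilityMeasure μ] [IsProbabilityMeasure P]
    (h : IsSampling μ P O U) (hbal : IsBalanced μ S U) (hK : 0 < K) (hη : η.IsMeasurable)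
    (hV : ∀ k : Fin K, ∀ δ : ENNReal, 0 < δ → Tendsto (fun m => μ {ω |
      δ < ∫⁻ o, ENNReal.ofReal (eifError S η m k ((U ω, sample O m ω), o) ^ 2) ∂P})
      atTop (𝓝 0)) :
    TendstoInMeasure μ (fun (m : ℕ) ω => meanSqError S m (U ω) (sample O m ω) η) atTop
      fun _ => 0 := by
  have h1 : ∀ k : Fin K, TendstoInMeasure μ (fun (m : ℕ) ω =>
      (K * ((S.group m (U ω) k).card / m : ℝ))⁻¹ * ((m : ℝ)⁻¹ * ∑ i ∈ S.group m (U ω) k,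
        eifError S η m k ((U ω, sample O m ω), sample O m ω i) ^ 2)) atTop fun _ => 0 := by
    intro k
    have h2 := TendstoInMeasure.mul_const_limits (tendsto_group_weight hbal hK k)
      (h.tendsto_sum_sq k (measurable_eifError hη · k) (offGroup_eifError · k) (hV k))
    simpa using h2
  refine TendstoInMeasure.congr_left (fun m => Eventually.of_forall fun ω => ?_)
    (tendstoInMeasure_sum_zero Finset.univ fun k _ => h1 k)
  simp only [meanSqError, groupAverage_eq, eifError]

theorem tendsto_psiHat [IsProbabilityMeasure μ] [IsProbabilityMeasure P] (h : IsSampling μ P O U)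
    (hbal : IsBalanced μ S U) (hK : 0 < K) (hM : RegularModel P η c C)
    (hQ : TendstoInMeasure μ (fun (m : ℕ) ω => meanSqError S m (U ω) (sample O m ω) η) atTop
      fun _ => 0) :
    TendstoInMeasure μ (fun (m : ℕ) ω => S.psiHat m (U ω) (sample O m ω)) atTop
      fun _ => estimand P η := by
  have hL := hM.memLp_uncenteredEIF hM.meas hM.bdd
  have h1 := h.tendsto_groupAverage hbal hK (measurable_uncenteredEIF hM.meas)
    (hL.integrable one_le_two)
  rw [hM.integral_uncenteredEIF] at h1
  have h2 := TendstoInMeasure.comp_continuousAt₂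
    (g := fun z => |z.1 - estimand P η| + √z.2) h1 hQ (by fun_prop)
  simp only [sub_self, abs_zero, Real.sqrt_zero, add_zero] at h2
  refine tendstoInMeasure_of_abs_sub_le h2 (Eventually.of_forall fun m =>
    Eventually.of_forall fun ω => ?_)
  have h3 := abs_psiHat_sub_le S m (U ω) (sample O m ω) hK η
  refine le_trans ?_ (le_abs_self _)
  refine (abs_sub_le _ (S.groupAverage m (U ω) (sample O m ω) fun _ => uncenteredEIF η) _).trans ?_
  rw [add_comm]
  exact add_le_add le_rfl h3

theorem tendsto_varHat [IsProbabilityMeasure μ] [IsProbabilityMeasure P] (h : IsSampling μ P O U)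
    (hbal : IsBalanced μ S U) (hK : 0 < K) (hM : RegularModel P η c C)
    (hQ : TendstoInMeasure μ (fun (m : ℕ) ω => meanSqError S m (U ω) (sample O m ω) η) atTop
      fun _ => 0) :
    TendstoInMeasure μ (fun (m : ℕ) ω => S.varHat m (U ω) (sample O m ω)) atTop
      fun _ => asympVar P η := by
  have hL := (hM.memLp_uncenteredEIF hM.meas hM.bdd).sub (memLp_const (estimand P η))
  have h1 := h.tendsto_groupAverage hbal hK
    (((measurable_uncenteredEIF hM.meas).sub_const (estimand P η)).pow_const 2)
    hL.integrable_sq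
  have hR := TendstoInMeasure.comp_continuousAt₂
    (g := fun z => 2 * z.1 + 2 * (z.2 - estimand P η) ^ 2) hQ (tendsto_psiHat h hbal hK hM hQ)
    (by fun_prop)
  simp only [sub_self, mul_zero, add_zero, zero_pow two_ne_zero] at hR
  have h2 := TendstoInMeasure.comp_continuousAt₂
    (g := fun z => |z.1 - asympVar P η| + (2 * (√z.1 * √z.2) + z.2)) h1 hR (by fun_prop)
  change TendstoInMeasure μ _ atTop fun _ =>
    |asympVar P η - asympVar P η| + (2 * (√(asympVar P η) * √0) + 0) at h2
  simp only [sub_self, abs_zero, Real.sqrt_zero, mul_zero, add_zero] at h2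
  refine tendstoInMeasure_of_abs_sub_le h2 (Eventually.of_forall fun m =>
    Eventually.of_forall fun ω => ?_)
  have h3 := abs_varHat_sub_le S m (U ω) (sample O m ω) hK η (estimand P η)
  refine le_trans ?_ (le_abs_self _)
  refine (abs_sub_le _ (S.groupAverage m (U ω) (sample O m ω)
    fun _ o => (uncenteredEIF η o - estimand P η) ^ 2) _).trans ?_
  rw [add_comm]
  exact add_le_add le_rfl h3

end Consistency

/-! ### Asymptotic normality -/

section Normality

variable {K : ℕ} {Ω 𝒰 : Type*} [MeasurableSpace Ω] [MeasurableSpace 𝒰] {μ : Measure Ω}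
  {P : Measure (Cluster p)} {O : ℕ → Ω → Cluster p}
  {U : Ω → 𝒰} {S : Scheme p K 𝒰} {η : Nuisance p} {c C : ℝ}

theorem sqrt_mul_groupAverage (m : ℕ) (u : 𝒰) (d : Fin m → Cluster p)
    (f : Fin K → Cluster p → ℝ) :
    √(m : ℝ) * S.groupAverage m u d f = ∑ k : Fin K, (K * ((S.group m u k).card / m : ℝ))⁻¹ *
      ((√(m : ℝ))⁻¹ * ∑ i ∈ S.group m u k, f k (d i)) := by
  rw [groupAverage_eq, Finset.mul_sum]
  refine Finset.sum_congr rfl fun k _ => ?_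
  rw [← Real.sqrt_div_self (x := (m : ℝ))]
  ring

/-- The group average of the constant `1` differs from `1` only when a group is empty; balanced
groups are eventually nonempty with high probability. -/
theorem tendsto_sqrt_mul_groupAverage_one (hbal : IsBalanced μ S U) (hK : 0 < K) :
    TendstoInMeasure μ (fun (m : ℕ) ω =>
      √(m : ℝ) * ((S.groupAverage m (U ω) (sample O m ω) fun _ _ => 1) - 1)) atTop
      fun _ => 0 := by
  have hK' : (0 : ℝ) < (K : ℝ)⁻¹ := by positivity
  rw [tendstoInMeasure_const_iff]
  intro ε hε
  have h1 := tendsto_finsetSum Finset.univ fun k _ =>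
    (tendstoInMeasure_const_iff.1 (hbal k)) _ hK'
  rw [Finset.sum_const_zero] at h1
  refine tendsto_of_tendsto_of_tendsto_of_le_of_le tendsto_const_nhds h1
    (fun _ => zero_le) fun m => ?_
  refine (measure_mono fun ω hω => ?_).trans
    (measure_biUnion_finset_le Finset.univ fun k : Fin K =>
      {ω | (K : ℝ)⁻¹ ≤ |((S.group m (U ω) k).card : ℝ) / m - (K : ℝ)⁻¹|})
  by_contra hne
  have h2 : ∀ k, (S.group m (U ω) k).card ≠ 0 := by
    intro k hk
    refine hne (Set.mem_iUnion₂.2 ⟨k, Finset.mem_univ k, ?_⟩)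
    change (K : ℝ)⁻¹ ≤ _
    rw [hk, Nat.cast_zero, zero_div, zero_sub, abs_neg, abs_of_pos hK']
  have h3 : ε ≤ |√(m : ℝ) * ((S.groupAverage m (U ω) (sample O m ω) fun _ _ => 1) - 1) - 0| := hω
  rw [groupAverage_one_eq S m (U ω) (sample O m ω) hK h2, sub_self, mul_zero, sub_zero,
    abs_zero] at h3
  exact absurd h3 (not_le.2 hε)

/-- For a centred function, a group average may be replaced by the average over all clusters, even
on the scale `√m`. -/
theorem IsSampling.tendsto_sqrt_mul_groupAverage_sub [IsProbabilityMeasure μ]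
    [IsProbabilityMeasure P] (h : IsSampling μ P O U)
    (hbal : IsBalanced μ S U) (hK : 0 < K) {g : Cluster p → ℝ} (hg : Measurable g)
    (hg2 : MemLp g 2 P) (hg0 : ∫ o, g o ∂P = 0) :
    TendstoInMeasure μ (fun (m : ℕ) ω =>
      √(m : ℝ) * (S.groupAverage m (U ω) (sample O m ω) fun _ => g)
        - (√(m : ℝ))⁻¹ * ∑ i, g (sample O m ω i)) atTop fun _ => 0 := by
  have h1 : ∀ k : Fin K, TendstoInMeasure μ (fun (m : ℕ) ω =>
      ((K * ((S.group m (U ω) k).card / m : ℝ))⁻¹ + -1) *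
        ((√(m : ℝ))⁻¹ * ∑ i ∈ S.group m (U ω) k, g (sample O m ω i))) atTop fun _ => 0 := by
    intro k
    have h2 := TendstoInMeasure.add_const_limits (tendsto_group_weight hbal hK k)
      (tendstoInMeasure_const μ (-1))
    rw [add_neg_cancel] at h2
    exact TendstoInMeasure.mul_isBigOP_one h2 (h.isBigOP_sum k hg hg2 hg0)
  refine TendstoInMeasure.congr_left (fun m => Eventually.of_forall fun ω => ?_)
    (tendstoInMeasure_sum_zero Finset.univ fun k _ => h1 k)
  simp only [sqrt_mul_groupAverage, add_mul, Finset.sum_add_distrib, neg_mul, one_mul,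
    Finset.sum_neg_distrib]
  rw [← Finset.mul_sum, sum_group_eq_sum]
  ring

/-- The bias of an estimated influence function, given the training data, is of second order. -/
theorem RegularModel.tendsto_sqrt_mul_bias [IsProbabilityMeasure P] (hM : RegularModel P η c C)
    (hbddHat : ∀ (m : ℕ) (k : Fin K), ∀ᵐ ω ∂μ,
      IsBoundedBy P c C (S.est m k (U ω) (sample O m ω))) (k : Fin K)
    {rG rH rPhi rW : ℕ → ℝ} (hr : ∀ m, 0 < rG m ∧ 0 < rH m ∧ 0 < rPhi m ∧ 0 < rW m)
    (hH : IsBigOP μ (fun m ω => errH P (S.est m k (U ω) (sample O m ω)) η) rH)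
    (hG : IsBigOP μ (fun m ω => errG P (S.est m k (U ω) (sample O m ω)) η) rG)
    (hPhi : IsBigOP μ (fun m ω => errPhi P (S.est m k (U ω) (sample O m ω)) η) rPhi)
    (hW : IsBigOP μ (fun m ω => errW P (S.est m k (U ω) (sample O m ω)) η) fun m => rW m ^ 2)
    (hrate : Tendsto (fun m : ℕ => √(m : ℝ) * (rW m ^ 2 + rG m * (rH m + rPhi m))) atTop (𝓝 0)) :
    TendstoInMeasure μ (fun (m : ℕ) ω =>
      √(m : ℝ) * ∫ o, eifError S η m k ((U ω, sample O m ω), o) ∂P) atTop fun _ => 0 := by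
  obtain ⟨M, _, hle⟩ := hM.exists_abs_mean_sub_le
  have h1 := (hW.add (hG.mul (hH.add hPhi (fun m => (hr m).2.1.le) fun m => (hr m).2.2.1.le)
    (fun m => (hr m).1.le) fun m => (add_pos (hr m).2.1 (hr m).2.2.1).le)
    (fun m => sq_nonneg _) fun m =>
      (mul_pos (hr m).1 (add_pos (hr m).2.1 (hr m).2.2.1)).le).tendstoInMeasure
    (fun m : ℕ => Real.sqrt_nonneg (m : ℝ)) hrate
  have h2 := TendstoInMeasure.comp_continuousAt (g := fun x => M * x) h1 (by fun_prop)
  simp only [mul_zero] at h2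
  refine tendstoInMeasure_of_abs_sub_le h2 (Eventually.of_forall fun m => ?_)
  filter_upwards [hbddHat m k] with ω hω
  have hm := (S.isMeasurableFamily_est m k).isMeasurable (U ω, sample O m ω)
  have h3 := hle _ hm hω
  have h4 : ∫ o, eifError S η m k ((U ω, sample O m ω), o) ∂P
      = ∫ o, uncenteredEIF (S.est m k (U ω) (sample O m ω)) o ∂P - estimand P η := by
    rw [← hM.integral_uncenteredEIF]
    exact integral_sub ((hM.memLp_uncenteredEIF hm hω).integrable one_le_two)
      ((hM.memLp_uncenteredEIF hM.meas hM.bdd).integrable one_le_two)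
  rw [sub_zero, abs_mul, abs_of_nonneg (Real.sqrt_nonneg _), h4]
  refine le_trans ?_ (le_abs_self _)
  refine (mul_le_mul_of_nonneg_left h3 (Real.sqrt_nonneg _)).trans_eq ?_
  ring

/-- The empirical process part of the error from estimating the influence function is negligible
because of cross-fitting, and the remaining part is the bias. -/
theorem IsSampling.tendsto_sqrt_mul_groupAverage_eifError [IsProbabilityMeasure μ]
    [IsProbabilityMeasure P] (h : IsSampling μ P O U)
    (hbal : IsBalanced μ S U) (hK : 0 < K) (hη : η.IsMeasurable)
    (hV : ∀ k : Fin K, ∀ δ : ENNReal, 0 < δ → Tendsto (fun m => μ {ω |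
      δ < ∫⁻ o, ENNReal.ofReal (eifError S η m k ((U ω, sample O m ω), o) ^ 2) ∂P})
      atTop (𝓝 0))
    (hbias : ∀ k : Fin K, TendstoInMeasure μ (fun (m : ℕ) ω =>
      √(m : ℝ) * ∫ o, eifError S η m k ((U ω, sample O m ω), o) ∂P) atTop fun _ => 0) :
    TendstoInMeasure μ (fun (m : ℕ) ω => √(m : ℝ) * S.groupAverage m (U ω) (sample O m ω)
      fun k o => uncenteredEIF (S.est m k (U ω) (sample O m ω)) o - uncenteredEIF η o) atTop
      fun _ => 0 := by
  have h1 : ∀ k : Fin K, TendstoInMeasure μ (fun (m : ℕ) ω =>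
      (K * ((S.group m (U ω) k).card / m : ℝ))⁻¹ * ((√(m : ℝ))⁻¹ *
        ∑ i ∈ S.group m (U ω) k, (eifError S η m k ((U ω, sample O m ω), sample O m ω i)
          - ∫ o, eifError S η m k ((U ω, sample O m ω), o) ∂P))) atTop fun _ => 0 := by
    intro k
    have h2 := TendstoInMeasure.mul_const_limits (tendsto_group_weight hbal hK k)
      (h.tendsto_sum_centred k (measurable_eifError hη · k) (offGroup_eifError · k) (hV k))
    simpa using h2
  have h3 : TendstoInMeasure μ (fun (m : ℕ) ω => √(m : ℝ) *
      S.groupAverage m (U ω) (sample O m ω)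
        fun k _ => ∫ o, eifError S η m k ((U ω, sample O m ω), o) ∂P) atTop fun _ => 0 := by
    have h4 : ∀ k : Fin K, TendstoInMeasure μ (fun (m : ℕ) ω =>
        |√(m : ℝ) * ∫ o, eifError S η m k ((U ω, sample O m ω), o) ∂P|) atTop fun _ => 0 := by
      intro k
      have h5 := TendstoInMeasure.comp_continuousAt (g := fun x => |x|) (hbias k) (by fun_prop)
      simpa using h5
    refine tendstoInMeasure_of_abs_sub_le
      (tendstoInMeasure_sum_zero Finset.univ fun k _ => h4 k)
      (Eventually.of_forall fun m => Eventually.of_forall fun ω => ?_)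
    refine le_trans ?_ (le_abs_self _)
    simp only [sub_zero, abs_mul, abs_of_nonneg (Real.sqrt_nonneg _), ← Finset.mul_sum]
    exact mul_le_mul_of_nonneg_left
      (abs_groupAverage_const_le S m (U ω) (sample O m ω) hK _) (Real.sqrt_nonneg _)
  have h6 := TendstoInMeasure.add_const_limits
    (tendstoInMeasure_sum_zero Finset.univ fun k _ => h1 k) h3
  rw [add_zero] at h6
  refine TendstoInMeasure.congr_left (fun m => Eventually.of_forall fun ω => ?_) h6
  have h7 := sqrt_mul_groupAverage (S := S) m (U ω) (sample O m ω)
    fun k o => eifError S η m k ((U ω, sample O m ω), o)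
      - ∫ o, eifError S η m k ((U ω, sample O m ω), o) ∂P
  change (∑ k : Fin K, _) + _ = _
  rw [← h7, ← mul_add, ← groupAverage_add]
  simp only [sub_add_cancel, eifError]

theorem RegularModel.integral_uncenteredEIF_sub [IsProbabilityMeasure P]
    (hM : RegularModel P η c C) : ∫ o, (uncenteredEIF η o - estimand P η) ∂P = 0 := by
  have h := integral_sub ((hM.memLp_uncenteredEIF hM.meas hM.bdd).integrable one_le_two)
    (integrable_const (μ := P) (estimand P η))
  refine h.trans ?_
  rw [hM.integral_uncenteredEIF]
  simp

/-- The estimator is asymptotically linear, with the efficient influence function as its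
influence function. -/
theorem tendsto_sqrt_mul_psiHat_sub [IsProbabilityMeasure μ] [IsProbabilityMeasure P]
    (h : IsSampling μ P O U) (hbal : IsBalanced μ S U) (hK : 0 < K) (hM : RegularModel P η c C)
    (hE : TendstoInMeasure μ (fun (m : ℕ) ω => √(m : ℝ) *
      S.groupAverage m (U ω) (sample O m ω)
        fun k o => uncenteredEIF (S.est m k (U ω) (sample O m ω)) o - uncenteredEIF η o) atTop
      fun _ => 0) :
    TendstoInMeasure μ (fun (m : ℕ) ω =>
      √(m : ℝ) * (S.psiHat m (U ω) (sample O m ω) - estimand P η)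
        - (√(m : ℝ))⁻¹ * ∑ i, (uncenteredEIF η (sample O m ω i) - estimand P η)) atTop
      fun _ => 0 := by
  have hL := hM.memLp_uncenteredEIF hM.meas hM.bdd
  have h1 := h.tendsto_sqrt_mul_groupAverage_sub hbal hK
    ((measurable_uncenteredEIF hM.meas).sub_const (estimand P η))
    (hL.sub (memLp_const (estimand P η))) hM.integral_uncenteredEIF_sub
  have h2 := TendstoInMeasure.comp_continuousAt (g := fun x => estimand P η * x)
    (tendsto_sqrt_mul_groupAverage_one (O := O) hbal hK) (by fun_prop)
  simp only [mul_zero] at h2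
  have h3 := TendstoInMeasure.add_const_limits (TendstoInMeasure.add_const_limits h1 h2) hE
  simp only [add_zero] at h3
  refine TendstoInMeasure.congr_left (fun m => Eventually.of_forall fun ω => ?_) h3
  have h4 : (S.groupAverage m (U ω) (sample O m ω) fun _ o => uncenteredEIF η o)
      = (S.groupAverage m (U ω) (sample O m ω) fun _ o => uncenteredEIF η o - estimand P η)
        + estimand P η * S.groupAverage m (U ω) (sample O m ω) fun _ _ => 1 := by
    rw [← groupAverage_const_mul, ← groupAverage_add]
    simp only [mul_one, sub_add_cancel]
  change _ = √(m : ℝ) * (S.psiHat m (U ω) (sample O m ω) - estimand P η)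
    - (√(m : ℝ))⁻¹ * ∑ i, (uncenteredEIF η (sample O m ω i) - estimand P η)
  rw [psiHat_eq S m (U ω) (sample O m ω) η, h4]
  ring

theorem IsSampling.tendstoInDistribution_sum [IsProbabilityMeasure μ] [IsProbabilityMeasure P]
    (h : IsSampling μ P O U) {g : Cluster p → ℝ} (hg : Measurable g)
    (hg2 : MemLp g 2 P) (hg0 : ∫ o, g o ∂P = 0) :
    TendstoInDistribution (fun (m : ℕ) ω => (√(m : ℝ))⁻¹ * ∑ i, g (sample O m ω i)) atTop
      (fun x => √(∫ o, g o ^ 2 ∂P) * x) (fun _ => μ) (gaussianReal 0 1) := by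
  have hmean : ∫ ω, g (O 0 ω) ∂μ = 0 := (h.integral_comp hg 0).trans hg0
  have hvar : Var[fun ω => g (O 0 ω); μ] = ∫ o, g o ^ 2 ∂P := by
    rw [variance_of_integral_eq_zero (X := fun ω => g (O 0 ω))
      (hg.comp (h.meas 0)).aemeasurable hmean]
    exact h.integral_comp (hg.pow_const 2) 0
  have h1 := gaussianReal_const_mul (HasLaw.id (μ := gaussianReal 0 1)) √(∫ o, g o ^ 2 ∂P)
  have h2 : gaussianReal (√(∫ o, g o ^ 2 ∂P) * 0)
      (.mk (√(∫ o, g o ^ 2 ∂P) ^ 2) (sq_nonneg _) * 1)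
      = gaussianReal 0 Var[fun ω => g (O 0 ω); μ].toNNReal := by
    rw [mul_zero, mul_one, hvar]
    congr 1
    ext
    have h3 : 0 ≤ ∫ o, g o ^ 2 ∂P := integral_nonneg fun o => sq_nonneg _
    simp [Real.sq_sqrt h3, h3]
  rw [h2] at h1
  have h4 := tendstoInDistribution_inv_sqrt_mul_sum_sub (X := fun i ω => g (O i ω)) h1
    (hg2.comp_measurePreserving (h.measurePreserving 0))
    (h.indep.comp (fun _ => g) fun _ => hg) (h.identDistrib hg)
  refine h4.congr (fun m => Eventually.of_forall fun ω => ?_) (ae_eq_refl _)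
  simp only [hmean, mul_zero, sub_zero, Finset.sum_range, sample]

/-- Slutsky's theorem turns asymptotic linearity and consistency of the variance estimator into
asymptotic normality of the studentized estimator. -/
theorem tendstoInDistribution_studentized [IsProbabilityMeasure μ] [IsProbabilityMeasure P]
    (h : IsSampling μ P O U) (hM : RegularModel P η c C)
    (hlin : TendstoInMeasure μ (fun (m : ℕ) ω =>
      √(m : ℝ) * (S.psiHat m (U ω) (sample O m ω) - estimand P η)
        - (√(m : ℝ))⁻¹ * ∑ i, (uncenteredEIF η (sample O m ω i) - estimand P η)) atTop
      fun _ => 0)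
    (hvar : TendstoInMeasure μ (fun (m : ℕ) ω => S.varHat m (U ω) (sample O m ω)) atTop
      fun _ => asympVar P η) (hpos : 0 < asympVar P η) :
    TendstoInDistribution
      (fun (m : ℕ) ω => √(m : ℝ) * (S.psiHat m (U ω) (sample O m ω) - estimand P η)
        / √(S.varHat m (U ω) (sample O m ω)))
      atTop (id : ℝ → ℝ) (fun _ => μ) (gaussianReal 0 1) := by
  have hL := hM.memLp_uncenteredEIF hM.meas hM.bdd
  have h1 := h.tendstoInDistribution_sum
    ((measurable_uncenteredEIF hM.meas).sub_const (estimand P η))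
    (hL.sub (memLp_const (estimand P η))) hM.integral_uncenteredEIF_sub
  have hψ : ∀ m : ℕ, AEMeasurable (fun ω =>
      √(m : ℝ) * (S.psiHat m (U ω) (sample O m ω) - estimand P η)) μ := fun m =>
    ((((measurable_psiHat m).comp (h.measurable_sample m)).sub_const _).const_mul _).aemeasurable
  have h2 := tendstoInDistribution_of_tendstoInMeasure_sub (fun (m : ℕ) ω =>
    √(m : ℝ) * (S.psiHat m (U ω) (sample O m ω) - estimand P η)) _ h1 hlin hψ
  have hσ : √(asympVar P η) ≠ 0 := (Real.sqrt_pos.2 hpos).ne'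
  have h3 := TendstoInMeasure.comp_continuousAt (g := fun x => (√x)⁻¹) hvar
    (ContinuousAt.inv₀ (by fun_prop) hσ)
  have h4 := h2.continuous_comp_prodMk_of_tendstoInMeasure_const (g := fun z => z.1 * z.2)
    (by fun_prop) h3 fun m =>
      (((measurable_varHat m).comp (h.measurable_sample m)).sqrt.inv).aemeasurable
  refine h4.congr (fun m => Eventually.of_forall fun ω => ?_) (Eventually.of_forall fun x => ?_)
  · exact (div_eq_mul_inv _ _).symm
  · change √(asympVar P η) * x * (√(asympVar P η))⁻¹ = x
    field_simp

/-- The rates of the nuisance estimators make the second-order bias negligible. -/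
theorem tendsto_sqrt_mul_rate {r s : ℕ → ℝ}
    (hr : r =o[atTop] fun m : ℕ => (m : ℝ) ^ (-(1 / 4) : ℝ))
    (hs : s =o[atTop] fun m : ℕ => (m : ℝ) ^ (-(1 / 2) : ℝ)) :
    Tendsto (fun m : ℕ => √(m : ℝ) * (r m ^ 2 + s m)) atTop (𝓝 0) := by
  have h1 : (fun m => r m ^ 2) =o[atTop] fun m : ℕ => (m : ℝ) ^ (-(1 / 2) : ℝ) := by
    refine (hr.pow two_pos).congr_right fun m => ?_
    rw [← Real.rpow_mul_natCast (Nat.cast_nonneg m)]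
    norm_num
  refine (h1.add hs).tendsto_div_nhds_zero.congr fun m => ?_
  rw [Real.rpow_neg (Nat.cast_nonneg m), ← Real.sqrt_eq_rpow, div_inv_eq_mul, mul_comm]

end Normality

end ClusterPolicy

end

theorem theorem4
    {p K : ℕ} (hK : 0 < K)
    {Ω 𝒰 : Type*} [MeasurableSpace Ω] [MeasurableSpace 𝒰]
    (μ : Measure Ω) [IsProbabilityMeasure μ]
    -- i.i.d. clusters with law `P`
    (P : Measure (Cluster p)) [IsProbabilityMeasure P]
    (O : ℕ → Ω → Cluster p) (hO : ∀ i, Measurable (O i)) (hlaw : ∀ i, μ.map (O i) = P)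
    (hindep : iIndepFun O μ)
    -- finite moments and finite cluster size
    (hmom : FiniteMoments P) (hsize : FiniteClusterSize P)
    -- the true nuisance functions `G`, `H`, `w = W(P)`, `φ`
    (η : Nuisance p) (hη : η.IsMeasurable)
    (hG : IsOutcomeRegression P η.G) (hH : IsTreatmentProb P η.H)
    (W : Measure (Cluster p) → VecFn p) (hw : η.w = W P) (hphi : IsWeightEIF P W η.phi)
    -- sample splitting: the partition is independent of the data, the groups are of comparable size
    (S : Scheme p K 𝒰) (U : Ω → 𝒰) (hU : Measurable U)
    (hUO : IndepFun U (fun ω i => O i ω) μ)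
    (hbal : ∀ k : Fin K, TendstoInMeasure μ
      (fun (m : ℕ) ω => ((S.group m (U ω) k).card : ℝ) / (m : ℝ)) atTop (fun _ => (K : ℝ)⁻¹))
    -- boundedness of the nuisance functions and of their estimators
    (c C : ℝ) (hc : c ∈ Set.Ioo (0 : ℝ) 1) (hC : 0 < C)
    (hbdd : IsBoundedBy P c C η)
    (hbddHat : ∀ (m : ℕ) (k : Fin K), ∀ᵐ ω ∂μ,
      IsBoundedBy P c C (S.est m k (U ω) (sample O m ω)))
    -- convergence rates of the estimators
    (rG rH rPhi rW : ℕ → ℝ)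
    (hr : ∀ m, 0 < rG m ∧ 0 < rH m ∧ 0 < rPhi m ∧ 0 < rW m)
    (hB5 : ∀ k : Fin K,
      IsBigOP μ (fun m ω => errH P (S.est m k (U ω) (sample O m ω)) η) rH)
    (hB6 : ∀ k : Fin K,
      IsBigOP μ (fun m ω => errG P (S.est m k (U ω) (sample O m ω)) η) rG)
    (hB7 : ∀ k : Fin K,
      IsBigOP μ (fun m ω => errPhi P (S.est m k (U ω) (sample O m ω)) η) rPhi)
    (hB8 : ∀ k : Fin K,
      IsBigOP μ (fun m ω => errW P (S.est m k (U ω) (sample O m ω)) η) (fun m => rW m ^ 2)) :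
    -- consistency of the variance estimator
    (Tendsto rW atTop (𝓝 0) → Tendsto rG atTop (𝓝 0) → Tendsto rH atTop (𝓝 0) →
      Tendsto rPhi atTop (𝓝 0) →
      TendstoInMeasure μ (fun m ω => S.varHat m (U ω) (sample O m ω)) atTop
        (fun _ => asympVar P η)) ∧
    -- asymptotic normality of the studentized statistic
    (Tendsto rG atTop (𝓝 0) → Tendsto rH atTop (𝓝 0) → Tendsto rPhi atTop (𝓝 0) →
      (rW =o[atTop] fun m : ℕ => (m : ℝ) ^ (-(1 / 4) : ℝ)) →
      ((fun m => rG m * (rH m + rPhi m)) =o[atTop] fun m : ℕ => (m : ℝ) ^ (-(1 / 2) : ℝ)) →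
      0 < asympVar P η →
      TendstoInDistribution
        (fun (m : ℕ) ω => √(m : ℝ) * (S.psiHat m (U ω) (sample O m ω) - estimand P η)
          / √(S.varHat m (U ω) (sample O m ω)))
        atTop (id : ℝ → ℝ) (fun _ => μ) (gaussianReal 0 1)) := by
  have hM : RegularModel P η c C :=
    { finite_size := hsize
      moments := hmom
      meas := hη
      regression := hG
      propensity := hH
      phi_mean_zero := ae_sum_H_smul_phi_eq_zero hsize hη hH hphi hc.1 hbdd
      c_mem := hc
      C_pos := hC
      bdd := hbdd }
  have hS : IsSampling μ P O U := ⟨hO, hlaw, hindep, hU, hUO⟩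
  have hzero : ∀ {Z : ℕ → Ω → ℝ} {r : ℕ → ℝ}, IsBigOP μ Z r → Tendsto r atTop (𝓝 0) →
      TendstoInMeasure μ Z atTop fun _ => 0 := by
    intro Z r hZ hr0
    simpa using hZ.tendstoInMeasure (s := fun _ => 1) (fun _ => zero_le_one) (by simpa using hr0)
  have hV : Tendsto rW atTop (𝓝 0) → Tendsto rG atTop (𝓝 0) → Tendsto rH atTop (𝓝 0) →
      Tendsto rPhi atTop (𝓝 0) → ∀ k : Fin K, ∀ δ : ENNReal, 0 < δ → Tendsto (fun m => μ {ω |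
        δ < ∫⁻ o, ENNReal.ofReal (eifError S η m k ((U ω, sample O m ω), o) ^ 2) ∂P})
        atTop (𝓝 0) := fun h1 h2 h3 h4 k =>
    hM.tendsto_condMeanSq hbddHat k (hzero (hB8 k) (by simpa using h1.pow 2))
      (hzero (hB7 k) h4) (hzero (hB6 k) h2) (hzero (hB5 k) h3)
  have hvar : Tendsto rW atTop (𝓝 0) → Tendsto rG atTop (𝓝 0) → Tendsto rH atTop (𝓝 0) →
      Tendsto rPhi atTop (𝓝 0) →
      TendstoInMeasure μ (fun m ω => S.varHat m (U ω) (sample O m ω)) atTop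
        (fun _ => asympVar P η) := fun h1 h2 h3 h4 =>
    tendsto_varHat hS hbal hK hM (hS.tendsto_meanSqError hbal hK hη (hV h1 h2 h3 h4))
  refine ⟨hvar, fun h2 h3 h4 hrW hrG hpos => ?_⟩
  -- `rW → 0` is not assumed here, but follows from `rW = o(m^(-1/4))`
  have h1 : Tendsto rW atTop (𝓝 0) := hrW.isBigO.trans_tendsto
    ((tendsto_rpow_neg_atTop (by norm_num)).comp tendsto_natCast_atTop_atTop)
  have hE := hS.tendsto_sqrt_mul_groupAverage_eifError hbal hK hη (hV h1 h2 h3 h4) fun k =>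
    hM.tendsto_sqrt_mul_bias hbddHat k hr (hB5 k) (hB6 k) (hB7 k) (hB8 k)
      (tendsto_sqrt_mul_rate hrW hrG)
  exact tendstoInDistribution_studentized hS hM
    (tendsto_sqrt_mul_psiHat_sub hS hbal hK hM hE) (hvar h1 h2 h3 h4) hpos
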